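/- **Conventions.** All vector spaces are complex and finite-dimensional. A partition is a weakly decreasing sequence $p_1\ge p_2\ge\cdots$ of nonnegative integers that is eventually $0$ (trailing zeros may be omitted), and $|p|=\sum_j p_j$. For $k\le n$, it is a partition for $\mathrm{Gr}(k,n)$ if $p_1\le n-k$ and $p_{k+1}=0$. A Schubert problem in $\mathrm{Gr}(k,n)$ is a list $(\lambda^1,\dots,\lambda^s)$ of partitions for $\mathrm{Gr}(k,n)$ (some of them may be $0$) with $|\lambda^1|+\dots+|\lambda^s|=k(n-k)$. For a complete flag $F_\bullet$ in an $n$-dimensional space $E$, let $\Omega_pF_\bullet$ be the set of $k$-dimensional subspaces $H\subset E$ with $\dim(H\cap F_{n-k+j-p_j})\ge j$ for $j=1,\dots,k$. An instance of $\boldsymbol\lambda$ in $\mathrm{Gr}(k,E)$ is an $s$-tuple $\mathcal F=(F^1_\bullet,\dots,F^s_\bullet)$ of complete flags in $E$, with set of solutions $\Omega_{\boldsymbol\lambda}\mathcal F=\bigcap_i\Omega_{\lambda^i}F^i_\bullet$. A property holds for general instances if it holds on a dense Zariski-open set of tuples of flags. Write $c^r$ for the partition with $r$ parts equal to $c$,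 $p+q$ for the componentwise sum, $(c^r,p)$ for the partition with $r$ parts $c$ followed by the parts of $p$ (where $c\ge p_1$), and $\square=(1)$. **Fibrations.** Let $\boldsymbol\lambda$, $\boldsymbol\mu$, $\boldsymbol\nu$ be Schubert problems in $\mathrm{Gr}(k+a,n+b)$, $\mathrm{Gr}(k,n)$, $\mathrm{Gr}(a,b)$. Then $\boldsymbol\lambda$ is *fibered over* $\boldsymbol\mu$ *with fiber* $\boldsymbol\nu$ if there are a dense Zariski-open set $U$ of instances of $\boldsymbol\lambda$ in $\mathrm{Gr}(k+a,\mathbb C^{n+b})$ and a construction that assigns to each $\mathcal F\in U$ an $n$-dimensional subspace $V\subset\mathbb C^{n+b}$, an instance $\mathcal E$ of $\boldsymbol\mu$ in $\mathrm{Gr}(k,V)$, and, for each $h\in\Omega_{\boldsymbol\mu}\mathcal E$, an instance $\mathcal G(h)$ of $\boldsymbol\nu$ in $\mathrm{Gr}(a,W)$, where $W=\mathbb C^{n+b}/V$, such that: 1. for every $\mathcal F\in U$ and $H\in\Omega_{\boldsymbol\lambda}\mathcal F$, $H\cap V\in\Omega_{\boldsymbol\mu}\mathcal E$; 2. for every $\mathcal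 F\in U$, $h\in\Omega_{\boldsymbol\mu}\mathcal E$ and $H\in\Omega_{\boldsymbol\lambda}\mathcal F$ with $H\cap V=h$, the image $H/h$ of $H$ in $W$ lies in $\Omega_{\boldsymbol\nu}\mathcal G(h)$; 3. for every $\mathcal F\in U$, the map $H\mapsto(H\cap V,\,H/(H\cap V))$ is a bijection from $\Omega_{\boldsymbol\lambda}\mathcal F$ to $\{(h,K): h\in\Omega_{\boldsymbol\mu}\mathcal E,\ K\in\Omega_{\boldsymbol\nu}\mathcal G(h)\}$; 4. for every $n$-dimensional $V\subset\mathbb C^{n+b}$, every general instance $\mathcal E$ of $\boldsymbol\mu$ in $\mathrm{Gr}(k,V)$ arises together with $V$ from some $\mathcal F\in U$; moreover, for general $\mathcal E$ and each $h\in\Omega_{\boldsymbol\mu}\mathcal E$, every general instance of $\boldsymbol\nu$ in $\mathrm{Gr}(a,\mathbb C^{n+b}/V)$ arises as $\mathcal G(h)$ from some $\mathcal F\in U$ that induces $V$ and $\mathcal E$. **Theorem 3.7.** Let $0<a<b$ and $s\ge 4$ be integers, let $\kappa,\rho$ be partitions with $\kappa_1\le b-a-1$ and $\rho_a=0$, and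 suppose that $$\boldsymbol\nu=\bigl((b-a-1,\kappa),\,1^{a-1}+\rho,\,\nu^3,\nu^4,\dots,\nu^s\bigr)$$ is a Schubert problem in $\mathrm{Gr}(a,b)$. Then $$\boldsymbol\lambda=\bigl((b-a,b-a,\kappa),\,2^a+\rho,\,(b-a+1,\nu^3),\,1^{a+1}+\nu^4,\,\nu^5,\dots,\nu^s\bigr)$$ is a Schubert problem in $\mathrm{Gr}(2+a,4+b)$, and it is fibered over the Schubert problem $\square^4=(\square,\square,\square,\square)$ in $\mathrm{Gr}(2,4)$ with fiber $\boldsymbol\nu$. -/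

import Mathlib

open Module

noncomputable section

/-- A partition `p₁ ≥ p₂ ≥ ⋯`, with trailing zeros; the part `pⱼ` is `p (j - 1)`. -/
def IsPartition (p : ℕ → ℕ) : Prop :=
  Antitone p ∧ ∃ r, p r = 0

/-- `p` is a partition for `Gr(k,n)`: `p₁ ≤ n - k` and `p_{k+1} = 0`. -/
def IsPartitionFor (k n : ℕ) (p : ℕ → ℕ) : Prop :=
  Antitone p ∧ p 0 ≤ n - k ∧ p k = 0

/-- The partition `c^r` with `r` parts equal to `c`. -/
def rect (r c : ℕ) : ℕ → ℕ :=
  fun i => if i < r then c else 0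

/-- The partition `(c^r, p)`: `r` rows of length `c`, followed by the rows of `p`.
It is only used for `p₁ ≤ c`, where it is the decreasing rearrangement of the parts. -/
def prependRows (r c : ℕ) (p : ℕ → ℕ) : ℕ → ℕ :=
  fun i => if i < r then c else p (i - r)

/-- A Schubert problem in `Gr(k,n)`: a list of partitions for `Gr(k,n)` whose total size is
`k(n-k) = dim Gr(k,n)`. -/
def IsSchubertProblem (k n : ℕ) {s : ℕ} (lam : Fin s → ℕ → ℕ) : Prop :=
  k ≤ n ∧ (∀ i, IsPartitionFor k n (lam i)) ∧
    k * (n - k) = ∑ i, ∑ j ∈ Finset.range k, lam i j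

/-- A complete flag `0 = F₀ ⊂ F₁ ⊂ ⋯ ⊂ Fₙ = E` in an `n`-dimensional complex vector space `E`,
continued by `Fⱼ = E` for `j > n`. -/
@[ext]
structure CompleteFlag (E : Type*) [AddCommGroup E] [Module ℂ E] [FiniteDimensional ℂ E] where
  space : ℕ → Submodule ℂ E
  mono : Monotone space
  finrank_space : ∀ j, finrank ℂ (space j) = min j (finrank ℂ E)

section Flags

variable {E : Type*} [AddCommGroup E] [Module ℂ E] [FiniteDimensional ℂ E]

/-- The flag whose `j`-th space is spanned by the first `j` vectors of a basis. -/
def CompleteFlag.ofBasis (e : Basis (Fin (finrank ℂ E)) ℂ E) : CompleteFlag E where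
  space j := Submodule.span ℂ (e '' {i | (i : ℕ) < j})
  mono := fun _ _ h => Submodule.span_mono (Set.image_mono fun _ hi => lt_of_lt_of_le hi h)
  finrank_space j := by
    classical
    have h := finrank_span_set_eq_card
      (s := e '' {i : Fin (finrank ℂ E) | (i : ℕ) < j})
      ((e.linearIndependent.comp (Subtype.val : {i : Fin (finrank ℂ E) | (i : ℕ) < j} → _)
        Subtype.val_injective).linearIndepOn_id' (by
          rw [Set.range_comp, Subtype.range_coe]))
    rw [h, Set.toFinset_card, ← Nat.card_eq_fintype_card,
      Nat.card_image_of_injective e.injective, Nat.card_eq_fintype_card]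
    have h2 := Fintype.card_subtype (fun i : Fin (finrank ℂ E) => (i : ℕ) < j)
    rw [Fin.card_filter_val_lt, min_comm] at h2
    exact h2

/-- The matrix entries of a tuple of bases of `E`, with respect to a fixed basis of `E`. -/
def frameCoords {s : ℕ} (e : Fin s → Basis (Fin (finrank ℂ E)) ℂ E) :
    Fin s × Fin (finrank ℂ E) × Fin (finrank ℂ E) → ℂ :=
  fun x => (finBasis ℂ E).repr (e x.1 x.2.1) x.2.2

/-- Zariski open sets of `s`-tuples of complete flags in `E`. The variety of such tuples is the
quotient of the space `GL(E)^s` of `s`-tuples of bases, with the quotient topology, so a set is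
open if and only if its preimage is a union of basic open sets `{p ≠ 0}` with `p` a polynomial in
the matrix entries. As this variety is irreducible, its dense open sets are the nonempty ones. -/
def IsZariskiOpen {s : ℕ} (U : Set (Fin s → CompleteFlag E)) : Prop :=
  ∀ e : Fin s → Basis (Fin (finrank ℂ E)) ℂ E, (fun i => CompleteFlag.ofBasis (e i)) ∈ U →
    ∃ p : MvPolynomial (Fin s × Fin (finrank ℂ E) × Fin (finrank ℂ E)) ℂ,
      MvPolynomial.eval (frameCoords e) p ≠ 0 ∧
      ∀ e' : Fin s → Basis (Fin (finrank ℂ E)) ℂ E,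
        MvPolynomial.eval (frameCoords e') p ≠ 0 → (fun i => CompleteFlag.ofBasis (e' i)) ∈ U

/-- The Schubert variety of the `k`-planes `H` in the `n`-dimensional space `E` with
`dim (H ∩ F_{n-k+j-λⱼ}) ≥ j` for `j = 1, …, k`. -/
def schubertVariety (k : ℕ) (p : ℕ → ℕ) (F : CompleteFlag E) : Set (Submodule ℂ E) :=
  {H | finrank ℂ H = k ∧ ∀ j < k,
    j + 1 ≤ finrank ℂ ↥(H ⊓ F.space (finrank ℂ E - k + (j + 1) - p j))}

/-- The set of solutions of the instance `F` of a Schubert problem in `Gr(k,E)`. -/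
def solutions (k : ℕ) {s : ℕ} (lam : Fin s → ℕ → ℕ) (F : Fin s → CompleteFlag E) :
    Set (Submodule ℂ E) :=
  {H | finrank ℂ H = k ∧ ∀ i, H ∈ schubertVariety k (lam i) (F i)}

end Flags

/-- What a fibration attaches to a tuple of flags in `E`: a subspace `V`, a tuple of flags in `V`,
and, for each subspace `h` of `V`, a tuple of flags in `W = E/V`. -/
structure InducedInstances (E : Type*) [AddCommGroup E] [Module ℂ E] [FiniteDimensional ℂ E]
    (t u : ℕ) where
  V : Submodule ℂ E
  base : Fin t → CompleteFlag V
  fiber : Submodule ℂ V → Fin u → CompleteFlag (E ⧸ V)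

/-- For Schubert problems `lam` in `Gr(k+a,n+b)`, `mu` in `Gr(k,n)` and `nu` in `Gr(a,b)`:
`lam` is fibered over `mu` with fiber `nu`. The general instances are those in a dense Zariski
open set `U`, and `Φ` is the construction of `V`, `ℰ` and the `𝒢(h)` from a general instance.
The intersection `H ∩ V` is `H.comap V.subtype`, a subspace of `V`, and `H/(H ∩ V)`, seen in
`W = ℂ^{n+b}/V`, is `H.map V.mkQ`. -/
def IsFiberedOver (k n a b : ℕ) {s t u : ℕ}
    (lam : Fin s → ℕ → ℕ) (mu : Fin t → ℕ → ℕ) (nu : Fin u → ℕ → ℕ) : Prop :=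
  ∃ (U : Set (Fin s → CompleteFlag (Fin (n + b) → ℂ)))
    (Φ : (Fin s → CompleteFlag (Fin (n + b) → ℂ)) → InducedInstances (Fin (n + b) → ℂ) t u),
    IsZariskiOpen U ∧ U.Nonempty ∧
    (∀ F ∈ U,
      finrank ℂ (Φ F).V = n ∧
      -- part (1)
      (∀ H ∈ solutions (k + a) lam F,
        H.comap (Φ F).V.subtype ∈ solutions k mu (Φ F).base) ∧
      -- part (2)
      (∀ h ∈ solutions k mu (Φ F).base, ∀ H ∈ solutions (k + a) lam F,
        H.comap (Φ F).V.subtype = h →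
          H.map (Φ F).V.mkQ ∈ solutions a nu ((Φ F).fiber h)) ∧
      -- part (3)
      Set.BijOn (fun H => (H.comap (Φ F).V.subtype, H.map (Φ F).V.mkQ))
        (solutions (k + a) lam F)
        {x | x.1 ∈ solutions k mu (Φ F).base ∧ x.2 ∈ solutions a nu ((Φ F).fiber x.1)}) ∧
    -- part (4): for each `V`, all general `ℰ` arise; for general `ℰ` and each of its solutions `h`,
    -- all general tuples of flags in `W` arise as `𝒢(h)` from flags that induce `V` and `ℰ`
    (∀ V : Submodule ℂ (Fin (n + b) → ℂ), finrank ℂ V = n →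
      ∃ B : Set (Fin t → CompleteFlag V), IsZariskiOpen B ∧ B.Nonempty ∧
        ∀ E ∈ B,
          (∃ F ∈ U, ∃ G, Φ F = ⟨V, E, G⟩) ∧
          ∀ h ∈ solutions k mu E,
            ∃ C : Set (Fin u → CompleteFlag ((Fin (n + b) → ℂ) ⧸ V)),
              IsZariskiOpen C ∧ C.Nonempty ∧
              ∀ Gh ∈ C, ∃ F ∈ U, ∃ G, Φ F = ⟨V, E, G⟩ ∧ G h = Gh)

end

open Module

noncomputable section

/-! ### Dimension counts for intersections and images -/

section LinearAlgebra

variable {E W : Type*} [AddCommGroup E] [Module ℂ E] [FiniteDimensional ℂ E]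
  [AddCommGroup W] [Module ℂ W]

/-! Let `A`, `C`, `B`, `D` be the members of dimensions `4`, `b`, `2`, `b + 2` of the first four
flags in `E = ℂ^(b+4)`, in general position. A solution `H` meets them in dimensions at least `2`,
`a`, `1`, `a + 1`. As `E = A ⊕ C` and `dim H = 2 + a`, the first two conditions give `H = (H ∩ A) ⊕
(H ∩ C)`. Hence the components `p ∈ A` and `w ∈ C` of a nonzero vector of `H ∩ B` lie in `H`. Let
`V` be the sum of the projections of `B` to `A` and to `C`, which has dimension 4, and put `h = ⟨p,
w⟩ ⊂ V`. The condition on `D` gives `dim (D + H) ≤ b + 3`. So `h` must meet `D`, and as `p ∉ D` the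
space `D + h` is already a hyperplane, equal to `D + H`. Thus `h` meets `A`, `C`, `B`, `D`, which is
the problem of four lines in `V`, and `H` lies in `X_h = A ∩ (D + h) + C ∩ (D + h)`. Since `X_h ∩ V
= h` and `X_h + V = E`, the spaces between `h` and `X_h` correspond to the subspaces of `X_h/h =
E/V`. This is the content of `exists_isTransversal`, `liftSpace_inf_crossSpace` and
`liftSpace_map_mkQ`.

The flags in `E/V` consist of the images of `F_t ∩ X_h`. For general flags the dimensions of `F_t ∩
X_h` and `F_t ∩ h` are known in the ranges that matter. Each Schubert condition on `H` then becomes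
one on `H/h` by a shift of index and rank, or is automatic (`mem_solutions_total_iff`). The
bijection follows in `bijOn_solutions`.

The vectors of `B` have two coordinates `(s, t)`, and the planes `h` come from zeros of a binary
quadratic form. Genericity along all `h` says that this form has no common zero with certain other
quadratic forms. That is the nonvanishing of resultants, an open condition (`frameOpen_isGood`).

For part (4), a linear section `σ` of `E → E/V` allows bases of `V` and of `E/V` to be merged into
bases of `E`. In a suitable order, `σ(E/V)` lies in every `X_h`, and the induced flags are exactly
the prescribed ones, the same for all `h` (`inducedOn_interleaveFrames`). Merging is regular, so the
good pairs form an open set, and an explicit example shows that it is not empty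
(`IsModelFrames.isGood`). -/

theorem finrank_map_add_finrank_inf_ker (f : E →ₗ[ℂ] W) (Y : Submodule ℂ E) :
    finrank ℂ (Y.map f) + finrank ℂ ↥(Y ⊓ LinearMap.ker f) = finrank ℂ Y := by
  have h := (f.domRestrict Y).finrank_range_add_finrank_ker
  rw [LinearMap.range_domRestrict, LinearMap.ker_domRestrict] at h
  have h2 : finrank ℂ ↥((LinearMap.ker f).comap Y.subtype) = finrank ℂ ↥(Y ⊓ LinearMap.ker f) := by
    rw [← Submodule.map_comap_subtype, Submodule.finrank_map_subtype_eq]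
  rw [← h2]; exact h

theorem finrank_inf_add_le {Y Y' : Submodule ℂ E} (h : Y ≤ Y') (X : Submodule ℂ E) :
    finrank ℂ ↥(Y' ⊓ X) + finrank ℂ Y ≤ finrank ℂ ↥(Y ⊓ X) + finrank ℂ Y' := by
  have h1 := Submodule.finrank_sup_add_finrank_inf_eq (Y' ⊓ X) Y
  have h2 : Y' ⊓ X ⊓ Y = Y ⊓ X := by
    rw [inf_right_comm, inf_eq_right.2 h]
  have h3 : finrank ℂ ↥(Y' ⊓ X ⊔ Y) ≤ finrank ℂ Y' :=
    Submodule.finrank_mono (sup_le inf_le_left h)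
  rw [h2] at h1
  omega

theorem finrank_map_add_le (f : E →ₗ[ℂ] W) {Y Y' : Submodule ℂ E} (h : Y ≤ Y') :
    finrank ℂ (Y'.map f) + finrank ℂ Y ≤ finrank ℂ (Y.map f) + finrank ℂ Y' := by
  have h1 := finrank_map_add_finrank_inf_ker f Y
  have h2 := finrank_map_add_finrank_inf_ker f Y'
  have h3 : finrank ℂ ↥(Y ⊓ LinearMap.ker f) ≤ finrank ℂ ↥(Y' ⊓ LinearMap.ker f) :=
    Submodule.finrank_mono (inf_le_inf_right _ h)
  omega

end LinearAlgebra

/-! ### Complete flags from chains with repetitions -/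

section Chains

variable {W : Type*} [AddCommGroup W] [Module ℂ W] [FiniteDimensional ℂ W]

/-- A chain of subspaces from `0` to `W` whose dimension increases by at most one in each step. -/
structure IsFlagChain (S : ℕ → Submodule ℂ W) : Prop where
  mono : Monotone S
  zero : S 0 = ⊥
  step : ∀ m, finrank ℂ (S (m + 1)) ≤ finrank ℂ (S m) + 1
  top : ∃ N, S N = ⊤

/-- A discrete intermediate value argument: the first member of dimension at least `j + 1` has
exactly this dimension, because a step adds at most one. -/
theorem IsFlagChain.exists_finrank_eq {S : ℕ → Submodule ℂ W} (hS : IsFlagChain S) (j : ℕ) :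
    ∃ m, finrank ℂ (S m) = min j (finrank ℂ W) := by
  obtain ⟨N, hN⟩ := hS.top
  induction j with
  | zero => exact ⟨0, by simp [hS.zero]⟩
  | succ j ih =>
    classical
    by_cases hj : finrank ℂ W ≤ j
    · obtain ⟨m, hm⟩ := ih
      exact ⟨m, by omega⟩
    · have hex : ∃ m, j + 1 ≤ finrank ℂ (S m) := ⟨N, by rw [hN, finrank_top]; omega⟩
      refine ⟨Nat.find hex, ?_⟩
      have h1 := Nat.find_spec hex
      rcases h : Nat.find hex with _ | k
      · rw [h, hS.zero] at h1
        simp at h1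
      · have h2 := Nat.find_min hex (m := k) (by omega)
        have h3 := hS.step k
        rw [h] at h1
        omega

open Classical in
/-- The complete flag formed by the spaces of a chain. -/
def flagOfChain (S : ℕ → Submodule ℂ W) : CompleteFlag W :=
  if hS : IsFlagChain S then
    { space := fun j => S (hS.exists_finrank_eq j).choose
      mono := fun i j hij => by
        have hi := (hS.exists_finrank_eq i).choose_spec
        have hj := (hS.exists_finrank_eq j).choose_spec
        rcases le_total (hS.exists_finrank_eq i).choose (hS.exists_finrank_eq j).choose with h | h
        · exact hS.mono h
        · exact (Submodule.eq_of_le_of_finrank_le (hS.mono h) (by omega)).ge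
      finrank_space := fun j => (hS.exists_finrank_eq j).choose_spec }
  -- Default value: fiber flags are assigned to every `h`, also where the images of `F_t ∩ X_h` need
  -- not exhaust the quotient.
  else CompleteFlag.ofBasis (finBasis ℂ W)

theorem flagOfChain_space_mem {S : ℕ → Submodule ℂ W} (hS : IsFlagChain S) (j : ℕ) :
    ∃ m, (flagOfChain S).space j = S m := by
  rw [flagOfChain, dif_pos hS]
  exact ⟨_, rfl⟩

theorem flagOfChain_space {S : ℕ → Submodule ℂ W} (hS : IsFlagChain S) {m j : ℕ}
    (h : finrank ℂ (S m) = j) : (flagOfChain S).space j = S m := by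
  obtain ⟨l, hl⟩ := flagOfChain_space_mem hS j
  have h1 := (flagOfChain S).finrank_space j
  have h2 := (S m).finrank_le
  rw [hl] at h1 ⊢
  rcases le_total l m with h' | h'
  · exact Submodule.eq_of_le_of_finrank_le (hS.mono h') (by omega)
  · exact (Submodule.eq_of_le_of_finrank_le (hS.mono h') (by omega)).symm

theorem CompleteFlag.space_zero (G : CompleteFlag W) : G.space 0 = ⊥ := by
  have := G.finrank_space 0
  simpa using this

theorem CompleteFlag.space_eq_top (G : CompleteFlag W) {j : ℕ} (hj : finrank ℂ W ≤ j) :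
    G.space j = ⊤ :=
  Submodule.eq_top_of_finrank_eq (by rw [G.finrank_space]; omega)

theorem flagOfChain_eq {S : ℕ → Submodule ℂ W} (hS : IsFlagChain S) (G : CompleteFlag W)
    (hG : ∀ m, ∃ j, S m = G.space j) : flagOfChain S = G := by
  ext1
  funext j
  obtain ⟨m, hm⟩ := flagOfChain_space_mem hS j
  obtain ⟨l, hl⟩ := hG m
  have h1 := (flagOfChain S).finrank_space j
  have h2 := G.finrank_space j
  rw [hm, hl] at h1 ⊢
  rcases le_total l j with h' | h'
  · exact Submodule.eq_of_le_of_finrank_le (G.mono h') (by omega)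
  · exact (Submodule.eq_of_le_of_finrank_le (G.mono h') (by omega)).symm

variable {E : Type*} [AddCommGroup E] [Module ℂ E] [FiniteDimensional ℂ E]

theorem CompleteFlag.finrank_space_succ_le (F : CompleteFlag E) (m : ℕ) :
    finrank ℂ (F.space (m + 1)) ≤ finrank ℂ (F.space m) + 1 := by
  rw [F.finrank_space, F.finrank_space]; omega

theorem isFlagChain_comap_subtype (F : CompleteFlag E) (V : Submodule ℂ E) :
    IsFlagChain fun m => (F.space m).comap V.subtype where
  mono _ _ h := Submodule.comap_mono (F.mono h)
  zero := by simp [F.space_zero]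
  step m := by
    have key (Y : Submodule ℂ E) : finrank ℂ (Y.comap V.subtype) = finrank ℂ ↥(Y ⊓ V) := by
      rw [← Submodule.finrank_map_subtype_eq, Submodule.map_comap_subtype, inf_comm]
    have h1 := finrank_inf_add_le (F.mono m.le_succ) V
    have h2 := F.finrank_space_succ_le m
    simp only [key]
    simp only [Nat.succ_eq_add_one] at h1
    omega
  top := ⟨finrank ℂ E, by simp [F.space_eq_top le_rfl]⟩

theorem isFlagChain_map (F : CompleteFlag E) (X : Submodule ℂ E) (f : E →ₗ[ℂ] W)
    (hf : X.map f = ⊤) : IsFlagChain fun m => (F.space m ⊓ X).map f where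
  mono _ _ h := Submodule.map_mono (inf_le_inf_right _ (F.mono h))
  zero := by simp [F.space_zero]
  step m := by
    have h1 := finrank_inf_add_le (F.mono m.le_succ) X
    have h2 := F.finrank_space_succ_le m
    have h3 := finrank_map_add_le f (inf_le_inf_right X (F.mono m.le_succ))
    simp only [Nat.succ_eq_add_one] at h1 h3
    omega
  top := ⟨finrank ℂ E, by simp [F.space_eq_top le_rfl, hf]⟩

end Chains

/-! ### Vectors and coordinates of a basis, and the flag it spans -/

section Frames

variable {E : Type*} [AddCommGroup E] [Module ℂ E] [FiniteDimensional ℂ E]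

/-- The vectors of a basis, indexed from `0` and continued by `0`. -/
def frameVec (e : Basis (Fin (finrank ℂ E)) ℂ E) (k : ℕ) : E :=
  if h : k < finrank ℂ E then e ⟨k, h⟩ else 0

/-- The coordinates with respect to a basis, indexed from `0` and continued by `0`. -/
def frameCoord (e : Basis (Fin (finrank ℂ E)) ℂ E) (k : ℕ) : E →ₗ[ℂ] ℂ :=
  if h : k < finrank ℂ E then e.coord ⟨k, h⟩ else 0

theorem frameCoord_frameVec (e : Basis (Fin (finrank ℂ E)) ℂ E) (k l : ℕ) :
    frameCoord e k (frameVec e l) = if k = l ∧ k < finrank ℂ E then 1 else 0 := by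
  unfold frameCoord frameVec
  split_ifs <;> simp_all
  all_goals omega

theorem ofBasis_space (e : Basis (Fin (finrank ℂ E)) ℂ E) (j : ℕ) :
    (CompleteFlag.ofBasis e).space j = Submodule.span ℂ (e '' {i | (i : ℕ) < j}) := rfl

theorem mem_ofBasis_space {e : Basis (Fin (finrank ℂ E)) ℂ E} {j : ℕ} {x : E} :
    x ∈ (CompleteFlag.ofBasis e).space j ↔ ∀ k, j ≤ k → frameCoord e k x = 0 := by
  rw [ofBasis_space, Basis.mem_span_image]
  constructor
  · intro h k hk
    unfold frameCoord
    split_ifs with hk'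
    · by_contra hne
      have : (⟨k, hk'⟩ : Fin (finrank ℂ E)) ∈ (e.repr x).support := by simpa using hne
      have := h this
      simp at this
      omega
    · simp
  · intro h i hi
    by_contra hne
    have := h i (by simpa using hne)
    simp [frameCoord] at this
    simp [this] at hi

theorem frameVec_mem {e : Basis (Fin (finrank ℂ E)) ℂ E} {j k : ℕ} (h : k < j) :
    frameVec e k ∈ (CompleteFlag.ofBasis e).space j := by
  rw [mem_ofBasis_space]
  intro l hl
  rw [frameCoord_frameVec, if_neg (by omega)]

theorem sum_frameCoord_smul_frameVec (e : Basis (Fin (finrank ℂ E)) ℂ E) (x : E) :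
    ∑ k ∈ Finset.range (finrank ℂ E), frameCoord e k x • frameVec e k = x := by
  rw [← Fin.sum_univ_eq_sum_range (fun k => frameCoord e k x • frameVec e k)]
  conv_rhs => rw [← e.sum_repr x]
  simp [frameCoord, frameVec]

theorem mem_ofBasis_space_iff_sum {e : Basis (Fin (finrank ℂ E)) ℂ E} {j : ℕ} {x : E} :
    x ∈ (CompleteFlag.ofBasis e).space j ↔
      x = ∑ k ∈ Finset.range j, frameCoord e k x • frameVec e k := by
  constructor
  · intro h
    rw [mem_ofBasis_space] at h
    conv_lhs => rw [← sum_frameCoord_smul_frameVec e x]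
    rcases le_total j (finrank ℂ E) with hj | hj
    · refine (Finset.sum_subset (Finset.range_mono hj) fun k _ hk => ?_).symm
      rw [h k (by simpa using hk), zero_smul]
    · refine Finset.sum_subset (Finset.range_mono hj) fun k _ hk => ?_
      rw [frameVec, dif_neg (by simpa using hk), smul_zero]
  · intro h
    rw [h]
    exact Submodule.sum_mem _ fun k hk =>
      Submodule.smul_mem _ _ (frameVec_mem (by simpa using hk))

end Frames

/-- The tuples of bases of `E`. -/
abbrev Frames (s : ℕ) (E : Type*) [AddCommGroup E] [Module ℂ E] :=
  Fin s → Basis (Fin (finrank ℂ E)) ℂ E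

/-! ### Regular functions and open sets on tuples of bases -/

section Regular

variable {s : ℕ} {E : Type*} [AddCommGroup E] [Module ℂ E] [FiniteDimensional ℂ E]

/-- Regular functions of a tuple of bases: quotients of polynomials in the matrix entries with
nowhere vanishing denominator. -/
def IsRegularFun (f : Frames s E → ℂ) : Prop :=
  ∃ p q : MvPolynomial (Fin s × Fin (finrank ℂ E) × Fin (finrank ℂ E)) ℂ,
    (∀ e : Frames s E, MvPolynomial.eval (frameCoords e) q ≠ 0) ∧
    ∀ e : Frames s E, f e * MvPolynomial.eval (frameCoords e) q = MvPolynomial.eval (frameCoords e) p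

namespace IsRegularFun

theorem const (c : ℂ) : IsRegularFun (fun _ : Frames s E => c) :=
  ⟨MvPolynomial.C c, 1, by simp, by simp⟩

theorem coord (x : Fin s × Fin (finrank ℂ E) × Fin (finrank ℂ E)) :
    IsRegularFun (fun e : Frames s E => frameCoords e x) :=
  ⟨MvPolynomial.X x, 1, by simp, by simp⟩

variable {f g : Frames s E → ℂ}

theorem add (hf : IsRegularFun f) (hg : IsRegularFun g) : IsRegularFun (fun e => f e + g e) := by
  obtain ⟨p, q, hq, hp⟩ := hf
  obtain ⟨p', q', hq', hp'⟩ := hg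
  refine ⟨p * q' + p' * q, q * q', fun e => ?_, fun e => ?_⟩
  · rw [map_mul]; exact mul_ne_zero (hq e) (hq' e)
  · simp only [map_mul, map_add, ← hp, ← hp']; ring

theorem mul (hf : IsRegularFun f) (hg : IsRegularFun g) : IsRegularFun (fun e => f e * g e) := by
  obtain ⟨p, q, hq, hp⟩ := hf
  obtain ⟨p', q', hq', hp'⟩ := hg
  refine ⟨p * p', q * q', fun e => ?_, fun e => ?_⟩
  · rw [map_mul]; exact mul_ne_zero (hq e) (hq' e)
  · simp only [map_mul, ← hp, ← hp']; ring

theorem neg (hf : IsRegularFun f) : IsRegularFun (fun e => -f e) := by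
  simpa using (const (-1)).mul hf

theorem sub (hf : IsRegularFun f) (hg : IsRegularFun g) : IsRegularFun (fun e => f e - g e) := by
  simpa [sub_eq_add_neg] using hf.add hg.neg

theorem pow (hf : IsRegularFun f) (n : ℕ) : IsRegularFun (fun e => f e ^ n) := by
  induction n with
  | zero => simpa using const 1
  | succ n ih => simpa [pow_succ] using ih.mul hf

theorem inv (hf : IsRegularFun f) (h : ∀ e, f e ≠ 0) : IsRegularFun (fun e => (f e)⁻¹) := by
  obtain ⟨p, q, hq, hp⟩ := hf
  refine ⟨q, p, fun e => ?_, fun e => ?_⟩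
  · rw [← hp]; exact mul_ne_zero (h e) (hq e)
  · rw [← hp, inv_mul_cancel_left₀ (h e)]

theorem sum {ι : Type*} (t : Finset ι) {f : ι → Frames s E → ℂ} (hf : ∀ i ∈ t, IsRegularFun (f i)) :
    IsRegularFun (fun e => ∑ i ∈ t, f i e) := by
  classical
  induction t using Finset.induction_on with
  | empty => simpa using const 0
  | insert i t hi ih =>
    simp only [Finset.sum_insert hi]
    exact (hf i (by simp)).add (ih fun j hj => hf j (by simp [hj]))

theorem prod {ι : Type*} (t : Finset ι) {f : ι → Frames s E → ℂ}
    (hf : ∀ i ∈ t, IsRegularFun (f i)) : IsRegularFun (fun e => ∏ i ∈ t, f i e) := by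
  classical
  induction t using Finset.induction_on with
  | empty => simpa using const 1
  | insert i t hi ih =>
    simp only [Finset.prod_insert hi]
    exact (hf i (by simp)).mul (ih fun j hj => hf j (by simp [hj]))

theorem det {ι : Type*} [Fintype ι] [DecidableEq ι] {M : Frames s E → Matrix ι ι ℂ}
    (hM : ∀ i j, IsRegularFun (fun e => M e i j)) : IsRegularFun (fun e => (M e).det) := by
  simp only [Matrix.det_apply, Units.smul_def, zsmul_eq_mul]
  exact sum _ fun σ _ => (const _).mul (prod _ fun i _ => hM _ _)

theorem adjugate {ι : Type*} [Fintype ι] [DecidableEq ι] {M : Frames s E → Matrix ι ι ℂ}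
    (hM : ∀ i j, IsRegularFun (fun e => M e i j)) (i j : ι) :
    IsRegularFun (fun e => (M e).adjugate i j) := by
  simp only [Matrix.adjugate_apply]
  refine det fun k l => ?_
  by_cases hk : k = j
  · subst hk
    simpa using const _
  · simpa [Matrix.updateRow_apply, hk] using hM k l

/-- Polynomials in regular functions are regular, and a denominator that vanishes at no tuple of
bases still vanishes nowhere after substituting `Θ`. -/
theorem comp {s' : ℕ} {E' : Type*} [AddCommGroup E'] [Module ℂ E'] [FiniteDimensional ℂ E']
    {Θ : Frames s' E' → Frames s E} (hf : IsRegularFun f)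
    (hΘ : ∀ i j k, IsRegularFun (fun e => (finBasis ℂ E).repr (Θ e i j) k)) :
    IsRegularFun (fun e => f (Θ e)) := by
  have key (p : MvPolynomial (Fin s × Fin (finrank ℂ E) × Fin (finrank ℂ E)) ℂ) :
      IsRegularFun (fun e => MvPolynomial.eval (frameCoords (Θ e)) p) := by
    induction p using MvPolynomial.induction_on with
    | C a => simpa using const a
    | add p q hp hq => simpa using hp.add hq
    | mul_X p i hp => simpa [frameCoords] using hp.mul (hΘ i.1 i.2.1 i.2.2)
  obtain ⟨p, q, hq, hp⟩ := hf
  have : (fun e => f (Θ e)) = fun e => MvPolynomial.eval (frameCoords (Θ e)) p *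
      (MvPolynomial.eval (frameCoords (Θ e)) q)⁻¹ := by
    funext e
    rw [← hp, mul_inv_cancel_right₀ (hq _)]
  rw [this]
  exact (key p).mul ((key q).inv fun e => hq _)

end IsRegularFun

/-- Regular vector-valued functions of a tuple of bases. -/
def IsRegularVec {E' : Type*} [AddCommGroup E'] [Module ℂ E'] [FiniteDimensional ℂ E']
    (v : Frames s E → E') : Prop :=
  ∀ k, IsRegularFun (fun e => (finBasis ℂ E').repr (v e) k)

namespace IsRegularVec

section

variable {E' E'' : Type*} [AddCommGroup E'] [Module ℂ E'] [FiniteDimensional ℂ E']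
  [AddCommGroup E''] [Module ℂ E''] [FiniteDimensional ℂ E'']

theorem const (x : E') : IsRegularVec (fun _ : Frames s E => x) :=
  fun _ => IsRegularFun.const _

theorem basis (i : Fin s) (j : Fin (finrank ℂ E)) :
    IsRegularVec (fun e : Frames s E => e i j) :=
  fun k => IsRegularFun.coord (i, j, k)

theorem frameVec (i : Fin s) (j : ℕ) : IsRegularVec (fun e : Frames s E => frameVec (e i) j) := by
  unfold _root_.frameVec
  split_ifs with h
  · exact basis i _
  · exact const 0

theorem add {v w : Frames s E → E'} (hv : IsRegularVec v) (hw : IsRegularVec w) :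
    IsRegularVec (fun e => v e + w e) := fun k => by
  simpa using (hv k).add (hw k)

theorem smul {f : Frames s E → ℂ} {v : Frames s E → E'} (hf : IsRegularFun f) (hv : IsRegularVec v) :
    IsRegularVec (fun e => f e • v e) := fun k => by
  simpa using hf.mul (hv k)

theorem sub {v w : Frames s E → E'} (hv : IsRegularVec v) (hw : IsRegularVec w) :
    IsRegularVec (fun e => v e - w e) := fun k => by
  simpa using (hv k).sub (hw k)

theorem sum {ι : Type*} (t : Finset ι) {v : ι → Frames s E → E'}
    (hv : ∀ i ∈ t, IsRegularVec (v i)) : IsRegularVec (fun e => ∑ i ∈ t, v i e) := fun k => by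
  simpa using IsRegularFun.sum t fun i hi => hv i hi k

theorem map {v : Frames s E → E'} (hv : IsRegularVec v) (f : E' →ₗ[ℂ] E'') :
    IsRegularVec (fun e => f (v e)) := by
  have : (fun e => f (v e)) = fun e => ∑ k, (finBasis ℂ E').repr (v e) k • f (finBasis ℂ E' k) := by
    funext e
    conv_lhs => rw [← (finBasis ℂ E').sum_repr (v e), map_sum]
    simp only [map_smul]
  rw [this]
  exact sum _ fun k _ => smul (hv k) (const _)

end

/-- Cramer's rule: the coordinates in the varying basis are obtained with the adjugate of the change
of basis matrix, divided by its nowhere vanishing determinant. -/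
theorem repr_basis {v : Frames s E → E} (hv : IsRegularVec v) (i : Fin s)
    (k : Fin (finrank ℂ E)) : IsRegularFun (fun e => (e i).repr (v e) k) := by
  have hM (a b) : IsRegularFun (fun e : Frames s E => (finBasis ℂ E).toMatrix (e i) a b) :=
    IsRegularFun.coord (i, b, a)
  have hdet (e : Frames s E) : ((finBasis ℂ E).toMatrix (e i)).det ≠ 0 := by
    have h := congrArg Matrix.det ((finBasis ℂ E).toMatrix_mul_toMatrix_flip (e i))
    rw [Matrix.det_mul, Matrix.det_one] at h
    exact left_ne_zero_of_mul_eq_one h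
  have hinv (e : Frames s E) : (e i).toMatrix (finBasis ℂ E) =
      ((finBasis ℂ E).toMatrix (e i)).det⁻¹ • ((finBasis ℂ E).toMatrix (e i)).adjugate := by
    have h := (finBasis ℂ E).toMatrix_mul_toMatrix_flip (e i)
    rw [← Matrix.inv_eq_right_inv h, Matrix.inv_def, Ring.inverse_eq_inv']
  have : (fun e : Frames s E => (e i).repr (v e) k) = fun e : Frames s E =>
      ∑ l, ((finBasis ℂ E).toMatrix (e i)).det⁻¹ * ((finBasis ℂ E).toMatrix (e i)).adjugate k l *
        (finBasis ℂ E).repr (v e) l := by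
    funext e
    conv_lhs => rw [← (finBasis ℂ E).sum_repr (v e)]
    have h (l) : (e i).repr (finBasis ℂ E l) k = ((finBasis ℂ E).toMatrix (e i)).det⁻¹ *
        ((finBasis ℂ E).toMatrix (e i)).adjugate k l := by
      rw [← Basis.toMatrix_apply, hinv]; simp
    simp [← h, mul_comm, -Basis.sum_repr]
  rw [this]
  exact IsRegularFun.sum _ fun l _ =>
    (((IsRegularFun.det hM).inv hdet).mul (IsRegularFun.adjugate hM k l)).mul (hv l)

theorem frameCoord {v : Frames s E → E} (hv : IsRegularVec v) (i : Fin s) (k : ℕ) :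
    IsRegularFun (fun e => frameCoord (e i) k (v e)) := by
  unfold _root_.frameCoord
  split_ifs with h
  · exact hv.repr_basis i _
  · exact IsRegularFun.const 0

end IsRegularVec

/-- Zariski open sets of tuples of bases. -/
def FrameOpen (S : Set (Frames s E)) : Prop :=
  ∀ e ∈ S, ∃ f : Frames s E → ℂ, IsRegularFun f ∧ f e ≠ 0 ∧ ∀ e', f e' ≠ 0 → e' ∈ S

namespace FrameOpen

theorem of_ne {f : Frames s E → ℂ} (hf : IsRegularFun f) : FrameOpen {e | f e ≠ 0} :=
  fun _ he => ⟨f, hf, he, fun _ h => h⟩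

theorem inter {S T : Set (Frames s E)} (hS : FrameOpen S) (hT : FrameOpen T) :
    FrameOpen (S ∩ T) := fun e he => by
  obtain ⟨f, hf, hfe, hfS⟩ := hS e he.1
  obtain ⟨g, hg, hge, hgT⟩ := hT e he.2
  exact ⟨_, hf.mul hg, mul_ne_zero hfe hge,
    fun e' h => ⟨hfS _ (left_ne_zero_of_mul h), hgT _ (right_ne_zero_of_mul h)⟩⟩

theorem iInter {ι : Type*} [Fintype ι] {S : ι → Set (Frames s E)} (hS : ∀ i, FrameOpen (S i)) :
    FrameOpen (⋂ i, S i) := fun e he => by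
  choose f hf hfe hfS using fun i => hS i e (Set.mem_iInter.1 he i)
  refine ⟨_, IsRegularFun.prod Finset.univ fun i _ => hf i, Finset.prod_ne_zero_iff.2 fun i _ => hfe i,
    fun e' h => Set.mem_iInter.2 fun i => hfS i e' (Finset.prod_ne_zero_iff.1 h i (by simp))⟩

theorem preimage {s' : ℕ} {E' : Type*} [AddCommGroup E'] [Module ℂ E'] [FiniteDimensional ℂ E']
    {S : Set (Frames s E)} (hS : FrameOpen S) {Θ : Frames s' E' → Frames s E}
    (hΘ : ∀ i j, IsRegularVec (fun e => Θ e i j)) : FrameOpen (Θ ⁻¹' S) := fun e he => by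
  obtain ⟨f, hf, hfe, hfS⟩ := hS _ he
  exact ⟨_, hf.comp hΘ, hfe, fun e' h => hfS _ h⟩

/-- The map from bases to flags is open. A tuple `e` over the image of `S` may only share its flags
with some `d ∈ S`. Carrying `d` along by the linear maps that take `e` to `e'` gives a tuple `Θ e'`
with the flags of `e'`. It depends regularly on `e'`, and `Θ e = d`. -/
theorem isZariskiOpen {S : Set (Frames s E)} (hS : FrameOpen S) :
    IsZariskiOpen {F : Fin s → CompleteFlag E | ∃ e ∈ S, (fun i => CompleteFlag.ofBasis (e i)) = F} := by
  rintro e ⟨d, hd, hde⟩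
  have hde' (i) : CompleteFlag.ofBasis (d i) = CompleteFlag.ofBasis (e i) := congrFun hde i
  let L (e' : Frames s E) (i : Fin s) : E ≃ₗ[ℂ] E := (e i).equiv (e' i) (Equiv.refl _)
  let Θ (e' : Frames s E) : Frames s E := fun i => (d i).map (L e' i)
  have hL (e' i x) : L e' i x = ∑ j, (e i).repr x j • e' i j := by
    conv_lhs => rw [← (e i).sum_repr x, map_sum]
    simp [L, -Basis.sum_repr]
  have hΘ (i j) : IsRegularVec (fun e' => Θ e' i j) := by
    have : (fun e' => Θ e' i j) = fun e' => ∑ k, (e i).repr (d i j) k • e' i k := by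
      funext e'
      simp [Θ, hL]
    rw [this]
    exact IsRegularVec.sum _ fun k _ =>
      IsRegularVec.smul (IsRegularFun.const _) (IsRegularVec.basis i k)
  have hΘe : Θ e = d := by
    funext i
    have : L e i = LinearEquiv.refl ℂ E := by
      ext x
      rw [hL, (e i).sum_repr]; rfl
    simp only [Θ, this]
    ext j
    simp
  have hflag (e') : (fun i => CompleteFlag.ofBasis (Θ e' i)) =
      fun i => CompleteFlag.ofBasis (e' i) := by
    funext i
    ext1
    funext j
    have h := congrArg (fun G => (CompleteFlag.space G j).map (L e' i).toLinearMap) (hde' i)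
    simp only [ofBasis_space, Submodule.map_span, ← Set.image_comp] at h
    simp only [ofBasis_space]
    have hd : (Θ e' i : Fin (finrank ℂ E) → E) = (L e' i).toLinearMap ∘ d i := by
      ext k; simp [Θ]
    have he : (e' i : Fin (finrank ℂ E) → E) = (L e' i).toLinearMap ∘ e i := by
      ext k; simp [L]
    rw [hd, he, h]
  obtain ⟨f, hf, hfe, hfS⟩ := hS.preimage hΘ e (by simpa [hΘe] using hd)
  obtain ⟨p, q, hq, hp⟩ := hf
  refine ⟨p, ?_, fun e' h => ⟨Θ e', hfS e' ?_, hflag e'⟩⟩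
  · rw [← hp]; exact mul_ne_zero hfe (hq _)
  · rw [← hp] at h; exact left_ne_zero_of_mul h

end FrameOpen

end Regular

/-! ### Elimination of a point of the projective line -/

section Elimination

/-- The resultant of the binary quadratic forms `a s² + b s t + c t²` and
`a' s² + b' s t + c' t²`. -/
def quadraticResultant (a b c a' b' c' : ℂ) : ℂ :=
  (a * c' - a' * c) ^ 2 - (a * b' - a' * b) * (b * c' - b' * c)

/-- The resultant times `s³` or `t³` is a combination of the two forms, so a common zero kills it.
Conversely, it is the product of the values of the second form at suitable representatives of the
two roots of the first, provided the first is not zero. -/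
theorem quadraticResultant_ne_zero_iff (a b c a' b' c' : ℂ) :
    quadraticResultant a b c a' b' c' ≠ 0 ↔ ∀ s t : ℂ, (s ≠ 0 ∨ t ≠ 0) →
      a * s ^ 2 + b * s * t + c * t ^ 2 = 0 → a' * s ^ 2 + b' * s * t + c' * t ^ 2 ≠ 0 := by
  unfold quadraticResultant
  have hroot (x y z : ℂ) (hx : x ≠ 0) : ∃ r : ℂ, x * r ^ 2 + y * r + z = 0 := by
    exact (exists_quadratic_eq_zero (b := y) (c := z) hx (IsAlgClosed.exists_eq_mul_self _)).imp fun r hr => by rw [← hr]; ring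
  constructor
  · intro hR s t hst h0 h1
    apply hR
    rcases hst with hs | ht
    · refine (mul_eq_zero.1 (?_ : s ^ 3 * _ = 0)).resolve_left (pow_ne_zero 3 hs)
      linear_combination
        (s * (a * c' - a' * c) - t * (b * c' - b' * c)) * (c' * h0 - c * h1) -
          s * (b * c' - b' * c) * (b' * h0 - b * h1)
    · refine (mul_eq_zero.1 (?_ : t ^ 3 * _ = 0)).resolve_left (pow_ne_zero 3 ht)
      linear_combination
        (s * (a * b' - a' * b) - t * (a * c' - a' * c)) * (a' * h0 - a * h1) +
          t * (a * b' - a' * b) * (b' * h0 - b * h1)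
  · intro h hR
    by_cases ha : a = 0
    -- Now `(1, 0)` is a root of the first form, and `(c, -b)` is the other one unless the form is
    -- zero.
    · subst ha
      have h1 : a' * 1 ^ 2 + b' * 1 * 0 + c' * 0 ^ 2 ≠ 0 := h 1 0 (by simp) (by ring)
      by_cases hbc : b = 0 ∧ c = 0
      · obtain ⟨rfl, rfl⟩ := hbc
        obtain ⟨r, hr⟩ := hroot a' b' c' (by simpa using h1)
        exact h r 1 (by simp) (by ring) (by rw [← hr]; ring)
      · refine mul_ne_zero h1 (h c (-b) ?_ (by ring)) (by linear_combination hR)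
        by_contra! hcb
        exact hbc ⟨by simpa using hcb.2, hcb.1⟩
    · obtain ⟨r, hr⟩ := hroot a b c ha
      have h1 := h r 1 (by simp) (by rw [← hr]; ring)
      -- The second root, since the sum of the roots is `-b/a`, with denominators cleared.
      have h2 := h (-b - a * r) a (by simp [ha]) (by
        linear_combination a ^ 2 * hr)
      refine mul_ne_zero h1 h2 ?_
      have hc : c = -(a * r ^ 2 + b * r) := by linear_combination hr
      subst hc
      linear_combination hR

end Elimination

/-! ### Linear algebra of the subspaces `A`, `C`, `B`, `D` -/

section Position

variable {E : Type*} [AddCommGroup E] [Module ℂ E] [FiniteDimensional ℂ E]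

/-- The span of the projections of `B` to the summands of `E = A ⊕ C`. -/
def crossSpace (A C B : Submodule ℂ E) : Submodule ℂ E :=
  A ⊓ (B ⊔ C) ⊔ C ⊓ (A ⊔ B)

/-- The span of the intersections of `D + h` with the summands of `E = A ⊕ C`. -/
def liftSpace (A C D h : Submodule ℂ E) : Submodule ℂ E :=
  A ⊓ (D ⊔ h) ⊔ C ⊓ (D ⊔ h)

/-- Subspaces `A`, `C`, `B`, `D` of dimensions `4`, `b`, `2`, `b + 2` in a space of dimension
`b + 4`, such that `A` and `C` are complementary, and `D` meets neither of the projections of `B`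
to `A` and to `C`. -/
structure IsTransverse (b : ℕ) (A C B D : Submodule ℂ E) : Prop where
  finrank_total : finrank ℂ E = b + 4
  finrank_A : finrank ℂ A = 4
  finrank_C : finrank ℂ C = b
  finrank_B : finrank ℂ B = 2
  finrank_D : finrank ℂ D = b + 2
  inf_eq_bot : A ⊓ C = ⊥
  proj_notMem : ∀ p ∈ A, ∀ w ∈ C, p + w ∈ B → p + w ≠ 0 → p ∉ D ∧ w ∉ D

/-- The planes spanned by `p ∈ A` and `w ∈ C` with `0 ≠ p + w ∈ B` that meet `D`. -/
def IsTransversal (A C B D h : Submodule ℂ E) : Prop :=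
  ∃ p ∈ A, ∃ w ∈ C, p + w ∈ B ∧ p + w ≠ 0 ∧ h = Submodule.span ℂ {p} ⊔ Submodule.span ℂ {w} ∧
    h ⊓ D ≠ ⊥

theorem exists_ne_zero_of_one_le_finrank {S : Submodule ℂ E} (h : 1 ≤ finrank ℂ S) :
    ∃ x ∈ S, x ≠ 0 := by
  apply S.exists_mem_ne_zero_of_ne_bot
  rintro rfl
  simp at h

theorem one_le_finrank_of_mem {S : Submodule ℂ E} {x : E} (hx : x ∈ S) (h0 : x ≠ 0) :
    1 ≤ finrank ℂ S := by
  rw [Submodule.one_le_finrank_iff]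
  rintro rfl
  exact h0 (by simpa using hx)

theorem finrank_sup_eq_top_iff {S T : Submodule ℂ E} (h : S ⊔ T = ⊤) :
    finrank ℂ ↥(S ⊓ T) + finrank ℂ E = finrank ℂ S + finrank ℂ T := by
  have := Submodule.finrank_sup_add_finrank_inf_eq S T
  rw [h, finrank_top] at this
  omega

theorem finrank_add_le_finrank_inf (S T : Submodule ℂ E) :
    finrank ℂ S + finrank ℂ T ≤ finrank ℂ ↥(S ⊓ T) + finrank ℂ E := by
  have := Submodule.finrank_sup_add_finrank_inf_eq S T
  have := (S ⊔ T).finrank_le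
  omega

theorem finrank_sup_of_inf_eq_bot {S T : Submodule ℂ E} (h : S ⊓ T = ⊥) :
    finrank ℂ ↥(S ⊔ T) = finrank ℂ S + finrank ℂ T := by
  have := Submodule.finrank_sup_add_finrank_inf_eq S T
  rw [h, finrank_bot] at this
  omega

theorem sup_eq_top_of_not_le {S T : Submodule ℂ E} (hT : finrank ℂ E ≤ finrank ℂ T + 1)
    (h : ¬ S ≤ T) : S ⊔ T = ⊤ := by
  apply Submodule.eq_top_of_finrank_eq
  have h1 : T < S ⊔ T := lt_of_le_of_ne le_sup_right fun heq => h (heq ▸ le_sup_left)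
  have := Submodule.finrank_lt_finrank_of_lt h1
  have := (S ⊔ T).finrank_le
  omega

theorem eq_and_eq_of_add_eq_add {A C : Submodule ℂ E} (h : A ⊓ C = ⊥) {a a' c c' : E} (ha : a ∈ A)
    (ha' : a' ∈ A) (hc : c ∈ C) (hc' : c' ∈ C) (heq : a + c = a' + c') : a = a' ∧ c = c' := by
  have h1 : a - a' = c' - c := by
    rw [sub_eq_sub_iff_add_eq_add, heq, add_comm]
  have h2 : a - a' ∈ A ⊓ C := ⟨A.sub_mem ha ha', h1 ▸ C.sub_mem hc' hc⟩
  rw [h, Submodule.mem_bot] at h2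
  rw [h2] at h1
  exact ⟨sub_eq_zero.1 h2, (sub_eq_zero.1 h1.symm).symm⟩

namespace IsTransverse

variable {b : ℕ} {A C B D : Submodule ℂ E} (T : IsTransverse b A C B D)

include T

theorem sup_eq_top : A ⊔ C = ⊤ := by
  apply Submodule.eq_top_of_finrank_eq
  rw [finrank_sup_of_inf_eq_bot T.inf_eq_bot, T.finrank_A, T.finrank_C, T.finrank_total, add_comm]

theorem exists_add_eq (x : E) : ∃ p ∈ A, ∃ w ∈ C, p + w = x := by
  have : x ∈ A ⊔ C := by rw [T.sup_eq_top]; trivial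
  exact Submodule.mem_sup.1 this

theorem proj_ne_zero {p w : E} (hp : p ∈ A) (hw : w ∈ C) (hy : p + w ∈ B) (h0 : p + w ≠ 0) :
    p ≠ 0 ∧ w ≠ 0 := by
  obtain ⟨h1, h2⟩ := T.proj_notMem p hp w hw hy h0
  exact ⟨fun h => h1 (h ▸ D.zero_mem), fun h => h2 (h ▸ D.zero_mem)⟩

theorem inf_B_A : B ⊓ A = ⊥ := by
  rw [Submodule.eq_bot_iff]
  rintro x ⟨hB, hA⟩
  by_contra h0
  exact (T.proj_ne_zero hA C.zero_mem (by simpa using hB) (by simpa using h0)).2 rfl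

theorem inf_B_C : B ⊓ C = ⊥ := by
  rw [Submodule.eq_bot_iff]
  rintro x ⟨hB, hC⟩
  by_contra h0
  exact (T.proj_ne_zero A.zero_mem hC (by simpa using hB) (by simpa using h0)).1 rfl

/-- `A ⊓ (B ⊔ C)` is the projection of `B` to `A` along `C`, and no dimension is lost because `B ⊓ C
= ⊥`. -/
theorem finrank_projA : finrank ℂ ↥(A ⊓ (B ⊔ C)) = 2 := by
  have h := finrank_sup_eq_top_iff (S := A) (T := B ⊔ C) (by
    rw [sup_left_comm, T.sup_eq_top, sup_top_eq])
  rw [finrank_sup_of_inf_eq_bot T.inf_B_C, T.finrank_A, T.finrank_B, T.finrank_C,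
    T.finrank_total] at h
  omega

theorem finrank_projC : finrank ℂ ↥(C ⊓ (A ⊔ B)) = 2 := by
  have h := finrank_sup_eq_top_iff (S := C) (T := A ⊔ B) (by
    rw [← sup_assoc, sup_comm C, T.sup_eq_top, top_sup_eq])
  rw [sup_comm A, finrank_sup_of_inf_eq_bot T.inf_B_A, sup_comm, T.finrank_A, T.finrank_B,
    T.finrank_C, T.finrank_total] at h
  omega

theorem finrank_crossSpace : finrank ℂ (crossSpace A C B) = 4 := by
  rw [crossSpace, finrank_sup_of_inf_eq_bot, T.finrank_projA, T.finrank_projC]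
  exact le_bot_iff.1 ((inf_le_inf inf_le_left inf_le_left).trans T.inf_eq_bot.le)

theorem mem_projA {p : E} : p ∈ A ⊓ (B ⊔ C) ↔ p ∈ A ∧ ∃ w ∈ C, p + w ∈ B := by
  rw [Submodule.mem_inf, Submodule.mem_sup]
  refine and_congr_right fun hp => ⟨?_, ?_⟩
  · rintro ⟨y, hy, z, hz, rfl⟩
    exact ⟨-z, C.neg_mem hz, by simpa using hy⟩
  · rintro ⟨w, hw, hy⟩
    exact ⟨p + w, hy, -w, C.neg_mem hw, by simp⟩

theorem mem_projC {w : E} : w ∈ C ⊓ (A ⊔ B) ↔ w ∈ C ∧ ∃ p ∈ A, p + w ∈ B := by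
  rw [Submodule.mem_inf, Submodule.mem_sup]
  refine and_congr_right fun hp => ⟨?_, ?_⟩
  · rintro ⟨z, hz, y, hy, rfl⟩
    exact ⟨-z, A.neg_mem hz, by simpa using hy⟩
  · rintro ⟨p, hp, hy⟩
    exact ⟨-p, A.neg_mem hp, p + w, hy, by simp⟩

theorem crossSpace_inf_A : crossSpace A C B ⊓ A = A ⊓ (B ⊔ C) := by
  rw [crossSpace, sup_inf_assoc_of_le _ inf_le_left, inf_right_comm, inf_comm C, T.inf_eq_bot,
    bot_inf_eq, sup_bot_eq]

theorem crossSpace_inf_C : crossSpace A C B ⊓ C = C ⊓ (A ⊔ B) := by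
  rw [crossSpace, sup_comm, sup_inf_assoc_of_le _ inf_le_left, inf_right_comm, T.inf_eq_bot,
    bot_inf_eq, sup_bot_eq]

theorem mem_crossSpace {p w : E} (hp : p ∈ A) (hw : w ∈ C) (hy : p + w ∈ B) :
    p ∈ crossSpace A C B ∧ w ∈ crossSpace A C B :=
  ⟨Submodule.mem_sup_left (T.mem_projA.2 ⟨hp, w, hw, hy⟩),
    Submodule.mem_sup_right (T.mem_projC.2 ⟨hw, p, hp, hy⟩)⟩

theorem B_le_crossSpace : B ≤ crossSpace A C B := fun y hy => by
  obtain ⟨p, hp, w, hw, rfl⟩ := T.exists_add_eq y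
  obtain ⟨h1, h2⟩ := T.mem_crossSpace hp hw hy
  exact add_mem h1 h2

theorem projA_inf_D : A ⊓ (B ⊔ C) ⊓ D = ⊥ := by
  rw [Submodule.eq_bot_iff]
  rintro p ⟨hp, hD⟩
  obtain ⟨hp, w, hw, hy⟩ := T.mem_projA.1 hp
  by_cases h0 : p + w = 0
  · exact (eq_and_eq_of_add_eq_add T.inf_eq_bot hp A.zero_mem hw C.zero_mem (by simpa using h0)).1
  · exact absurd hD (T.proj_notMem p hp w hw hy h0).1

theorem projC_inf_D : C ⊓ (A ⊔ B) ⊓ D = ⊥ := by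
  rw [Submodule.eq_bot_iff]
  rintro w ⟨hw, hD⟩
  obtain ⟨hw, p, hp, hy⟩ := T.mem_projC.1 hw
  by_cases h0 : p + w = 0
  · exact (eq_and_eq_of_add_eq_add T.inf_eq_bot hp A.zero_mem hw C.zero_mem (by simpa using h0)).2
  · exact absurd hD (T.proj_notMem p hp w hw hy h0).2

/-- The dimension formula gives at least 2. There is no more, because inside the four-dimensional
`V` this space misses the plane `A ⊓ (B ⊔ C)`. -/
theorem finrank_crossSpace_inf_D : finrank ℂ ↥(crossSpace A C B ⊓ D) = 2 := by
  have h1 := finrank_add_le_finrank_inf (crossSpace A C B) D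
  have h2 : A ⊓ (B ⊔ C) ⊓ (crossSpace A C B ⊓ D) = ⊥ :=
    le_bot_iff.1 ((inf_le_inf_left _ inf_le_right).trans T.projA_inf_D.le)
  have h3 := finrank_sup_of_inf_eq_bot h2
  have h4 : finrank ℂ ↥(A ⊓ (B ⊔ C) ⊔ crossSpace A C B ⊓ D) ≤ finrank ℂ (crossSpace A C B) :=
    Submodule.finrank_mono (sup_le le_sup_left inf_le_left)
  rw [T.finrank_crossSpace, T.finrank_D, T.finrank_total] at h1
  rw [T.finrank_crossSpace] at h4
  rw [T.finrank_projA] at h3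
  omega

theorem finrank_span_sup_span {p w : E} (hp : p ∈ A) (hw : w ∈ C) (hp0 : p ≠ 0) (hw0 : w ≠ 0) :
    finrank ℂ ↥(Submodule.span ℂ {p} ⊔ Submodule.span ℂ {w}) = 2 := by
  rw [finrank_sup_of_inf_eq_bot, finrank_span_singleton hp0, finrank_span_singleton hw0]
  rw [← le_bot_iff, ← T.inf_eq_bot]
  exact inf_le_inf (by simpa using hp) (by simpa using hw)

/-- A plane that meets the complementary spaces `A` and `C` is spanned by a vector of each. The
components of its vector in `B` therefore lie in the plane, and neither is zero. -/
theorem isTransversal_of_finrank {h : Submodule ℂ E} (h2 : finrank ℂ h = 2)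
    (hA : 1 ≤ finrank ℂ ↥(h ⊓ A)) (hC : 1 ≤ finrank ℂ ↥(h ⊓ C)) (hB : 1 ≤ finrank ℂ ↥(h ⊓ B))
    (hD : 1 ≤ finrank ℂ ↥(h ⊓ D)) : IsTransversal A C B D h := by
  obtain ⟨p, ⟨hph, hpA⟩, hp0⟩ := exists_ne_zero_of_one_le_finrank hA
  obtain ⟨w, ⟨hwh, hwC⟩, hw0⟩ := exists_ne_zero_of_one_le_finrank hC
  obtain ⟨y, ⟨hyh, hyB⟩, hy0⟩ := exists_ne_zero_of_one_le_finrank hB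
  have hspan : Submodule.span ℂ {p} ⊔ Submodule.span ℂ {w} = h :=
    Submodule.eq_of_le_of_finrank_eq (sup_le (by simpa using hph) (by simpa using hwh))
      (by rw [T.finrank_span_sup_span hpA hwC hp0 hw0, h2])
  have hy : y ∈ Submodule.span ℂ {p} ⊔ Submodule.span ℂ {w} := by rwa [hspan]
  obtain ⟨_, hα, _, hβ, rfl⟩ := Submodule.mem_sup.1 hy
  obtain ⟨α, rfl⟩ := Submodule.mem_span_singleton.1 hα
  obtain ⟨β, rfl⟩ := Submodule.mem_span_singleton.1 hβ
  have hpA' := A.smul_mem α hpA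
  have hwC' := C.smul_mem β hwC
  obtain ⟨h1, h2'⟩ := T.proj_ne_zero hpA' hwC' hyB hy0
  refine ⟨α • p, hpA', β • w, hwC', hyB, hy0, ?_, ?_⟩
  · refine (Submodule.eq_of_le_of_finrank_eq (sup_le ?_ ?_) ?_).symm
    · simpa using h.smul_mem α hph
    · simpa using h.smul_mem β hwh
    · rw [T.finrank_span_sup_span hpA' hwC' h1 h2', h2]
  · rwa [Submodule.one_le_finrank_iff] at hD

section Transversal

variable {h : Submodule ℂ E} (hh : IsTransversal A C B D h)

include hh

theorem finrank_eq_two : finrank ℂ h = 2 := by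
  obtain ⟨p, hp, w, hw, hy, h0, rfl, -⟩ := hh
  obtain ⟨hp0, hw0⟩ := T.proj_ne_zero hp hw hy h0
  exact T.finrank_span_sup_span hp hw hp0 hw0

theorem le_crossSpace : h ≤ crossSpace A C B := by
  obtain ⟨p, hp, w, hw, hy, h0, rfl, -⟩ := hh
  obtain ⟨h1, h2⟩ := T.mem_crossSpace hp hw hy
  exact sup_le (by simpa using h1) (by simpa using h2)

theorem one_le_finrank_inf : 1 ≤ finrank ℂ ↥(h ⊓ A) ∧ 1 ≤ finrank ℂ ↥(h ⊓ C) ∧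
    1 ≤ finrank ℂ ↥(h ⊓ B) ∧ 1 ≤ finrank ℂ ↥(h ⊓ D) := by
  obtain ⟨p, hp, w, hw, hy, h0, rfl, hD⟩ := hh
  obtain ⟨hp0, hw0⟩ := T.proj_ne_zero hp hw hy h0
  have h1 : p ∈ Submodule.span ℂ {p} ⊔ Submodule.span ℂ {w} :=
    Submodule.mem_sup_left (Submodule.mem_span_singleton_self p)
  have h2 : w ∈ Submodule.span ℂ {p} ⊔ Submodule.span ℂ {w} :=
    Submodule.mem_sup_right (Submodule.mem_span_singleton_self w)
  exact ⟨one_le_finrank_of_mem ⟨h1, hp⟩ hp0, one_le_finrank_of_mem ⟨h2, hw⟩ hw0,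
    one_le_finrank_of_mem ⟨add_mem h1 h2, hy⟩ h0, by rwa [Submodule.one_le_finrank_iff]⟩

theorem finrank_inf_D : finrank ℂ ↥(h ⊓ D) = 1 := by
  have h1 := (T.one_le_finrank_inf hh).2.2.2
  have h2 := T.finrank_eq_two hh
  have h3 : h ⊓ D < h := by
    refine lt_of_le_of_ne inf_le_left fun heq => ?_
    obtain ⟨p, hp, w, hw, hy, h0, rfl, -⟩ := hh
    refine (T.proj_notMem p hp w hw hy h0).1 (inf_eq_left.1 heq ?_)
    exact Submodule.mem_sup_left (Submodule.mem_span_singleton_self p)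
  have := Submodule.finrank_lt_finrank_of_lt h3
  omega

theorem finrank_A_inf_eq_one : finrank ℂ ↥(A ⊓ h) = 1 := by
  obtain ⟨hA, hC, -, -⟩ := T.one_le_finrank_inf hh
  have e := finrank_sup_of_inf_eq_bot (S := h ⊓ A) (T := h ⊓ C)
    (le_bot_iff.1 ((inf_le_inf inf_le_right inf_le_right).trans T.inf_eq_bot.le))
  have e2 : finrank ℂ ↥(h ⊓ A ⊔ h ⊓ C) ≤ finrank ℂ h :=
    Submodule.finrank_mono (sup_le inf_le_left inf_le_left)
  rw [T.finrank_eq_two hh] at e2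
  rw [inf_comm]
  omega

theorem finrank_C_inf_eq_one : finrank ℂ ↥(C ⊓ h) = 1 := by
  obtain ⟨hA, hC, -, -⟩ := T.one_le_finrank_inf hh
  have e := finrank_sup_of_inf_eq_bot (S := h ⊓ A) (T := h ⊓ C)
    (le_bot_iff.1 ((inf_le_inf inf_le_right inf_le_right).trans T.inf_eq_bot.le))
  have e2 : finrank ℂ ↥(h ⊓ A ⊔ h ⊓ C) ≤ finrank ℂ h :=
    Submodule.finrank_mono (sup_le inf_le_left inf_le_left)
  rw [T.finrank_eq_two hh] at e2
  rw [inf_comm]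
  omega

theorem finrank_D_sup : finrank ℂ ↥(D ⊔ h) = b + 3 := by
  have h1 := Submodule.finrank_sup_add_finrank_inf_eq D h
  rw [inf_comm, T.finrank_inf_D hh, T.finrank_eq_two hh, T.finrank_D] at h1
  omega

theorem finrank_crossSpace_inf_D_sup : finrank ℂ ↥((D ⊔ h) ⊓ crossSpace A C B) = 3 := by
  rw [sup_comm, sup_inf_assoc_of_le _ (T.le_crossSpace hh), inf_comm D]
  have h1 := Submodule.finrank_sup_add_finrank_inf_eq h (crossSpace A C B ⊓ D)
  rw [← inf_assoc, inf_eq_left.2 (T.le_crossSpace hh), T.finrank_inf_D hh, T.finrank_eq_two hh,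
    T.finrank_crossSpace_inf_D] at h1
  omega

/-- The plane `A ⊓ (B ⊔ C)` and `V ⊓ D` are complementary in `V`, so otherwise `D ⊔ h` would contain
`V`. It meets `V` only in dimension 3. -/
theorem projA_not_le : ¬ A ⊓ (B ⊔ C) ≤ D ⊔ h := fun hle => by
  have h1 : A ⊓ (B ⊔ C) ⊓ (crossSpace A C B ⊓ D) = ⊥ :=
    le_bot_iff.1 ((inf_le_inf_left _ inf_le_right).trans T.projA_inf_D.le)
  have h2 := finrank_sup_of_inf_eq_bot h1
  have h3 : finrank ℂ ↥(A ⊓ (B ⊔ C) ⊔ crossSpace A C B ⊓ D) ≤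
      finrank ℂ ↥((D ⊔ h) ⊓ crossSpace A C B) :=
    Submodule.finrank_mono (le_inf (sup_le hle (inf_le_right.trans le_sup_left))
      (sup_le le_sup_left inf_le_left))
  rw [T.finrank_crossSpace_inf_D_sup hh, h2, T.finrank_projA, T.finrank_crossSpace_inf_D] at h3
  omega

theorem projC_not_le : ¬ C ⊓ (A ⊔ B) ≤ D ⊔ h := fun hle => by
  have h1 : C ⊓ (A ⊔ B) ⊓ (crossSpace A C B ⊓ D) = ⊥ :=
    le_bot_iff.1 ((inf_le_inf_left _ inf_le_right).trans T.projC_inf_D.le)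
  have h2 := finrank_sup_of_inf_eq_bot h1
  have h3 : finrank ℂ ↥(C ⊓ (A ⊔ B) ⊔ crossSpace A C B ⊓ D) ≤
      finrank ℂ ↥((D ⊔ h) ⊓ crossSpace A C B) :=
    Submodule.finrank_mono (le_inf (sup_le hle (inf_le_right.trans le_sup_left))
      (sup_le le_sup_right inf_le_left))
  rw [T.finrank_crossSpace_inf_D_sup hh, h2, T.finrank_projC, T.finrank_crossSpace_inf_D] at h3
  omega

theorem finrank_inf_D_sup {S : Submodule ℂ E} (hS : ¬ S ≤ D ⊔ h) :
    finrank ℂ ↥(S ⊓ (D ⊔ h)) + 1 = finrank ℂ S := by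
  have h1 := finrank_sup_eq_top_iff
    (sup_eq_top_of_not_le (T := D ⊔ h) (by rw [T.finrank_D_sup hh, T.finrank_total]) hS)
  rw [T.finrank_D_sup hh, T.finrank_total] at h1
  omega

theorem finrank_A_inf : finrank ℂ ↥(A ⊓ (D ⊔ h)) = 3 := by
  have := T.finrank_inf_D_sup hh (S := A) fun hle => T.projA_not_le hh (inf_le_left.trans hle)
  rw [T.finrank_A] at this
  omega

theorem finrank_C_inf : finrank ℂ ↥(C ⊓ (D ⊔ h)) + 1 = b := by
  rw [T.finrank_inf_D_sup hh (S := C) fun hle => T.projC_not_le hh (inf_le_left.trans hle),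
    T.finrank_C]

theorem liftSpace_inf_A : liftSpace A C D h ⊓ A = A ⊓ (D ⊔ h) := by
  rw [liftSpace, sup_inf_assoc_of_le _ inf_le_left, inf_right_comm, inf_comm C, T.inf_eq_bot,
    bot_inf_eq, sup_bot_eq]

theorem liftSpace_inf_C : liftSpace A C D h ⊓ C = C ⊓ (D ⊔ h) := by
  rw [liftSpace, sup_comm, sup_inf_assoc_of_le _ inf_le_left, inf_right_comm, T.inf_eq_bot,
    bot_inf_eq, sup_bot_eq]

theorem finrank_liftSpace : finrank ℂ (liftSpace A C D h) = b + 2 := by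
  rw [liftSpace, finrank_sup_of_inf_eq_bot, T.finrank_A_inf hh]
  · have := T.finrank_C_inf hh
    omega
  · exact le_bot_iff.1 ((inf_le_inf inf_le_left inf_le_left).trans T.inf_eq_bot.le)

/-- Both spaces are sums of a part in `A` and a part in `C`, so they can be intersected
componentwise. The hyperplane `D ⊔ h` cuts the projections of `B` in lines, which are spanned by `p`
and `w`. -/
theorem liftSpace_inf_crossSpace : liftSpace A C D h ⊓ crossSpace A C B = h := by
  have hA1 := T.finrank_inf_D_sup hh (T.projA_not_le hh)
  have hC1 := T.finrank_inf_D_sup hh (T.projC_not_le hh)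
  rw [T.finrank_projA] at hA1
  rw [T.finrank_projC] at hC1
  have hh' := hh
  obtain ⟨p, hp, w, hw, hy, h0, hhe, -⟩ := hh'
  obtain ⟨hp0, hw0⟩ := T.proj_ne_zero hp hw hy h0
  have hph : p ∈ h := hhe ▸ Submodule.mem_sup_left (Submodule.mem_span_singleton_self p)
  have hwh : w ∈ h := hhe ▸ Submodule.mem_sup_right (Submodule.mem_span_singleton_self w)
  have hpD : p ∈ D ⊔ h := Submodule.mem_sup_right hph
  have hwD : w ∈ D ⊔ h := Submodule.mem_sup_right hwh
  have e1 : Submodule.span ℂ {p} = A ⊓ (B ⊔ C) ⊓ (D ⊔ h) :=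
    Submodule.eq_of_le_of_finrank_eq
      (by simpa only [Submodule.span_singleton_le_iff_mem] using
        ⟨T.mem_projA.2 ⟨hp, w, hw, hy⟩, hpD⟩)
      (by rw [finrank_span_singleton hp0]; omega)
  have e2 : Submodule.span ℂ {w} = C ⊓ (A ⊔ B) ⊓ (D ⊔ h) :=
    Submodule.eq_of_le_of_finrank_eq
      (by simpa only [Submodule.span_singleton_le_iff_mem] using
        ⟨T.mem_projC.2 ⟨hw, p, hp, hy⟩, hwD⟩)
      (by rw [finrank_span_singleton hw0]; omega)
  apply le_antisymm
  · rintro x ⟨hx, hxV⟩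
    obtain ⟨a, ⟨haA, haD⟩, c, ⟨hcC, hcD⟩, rfl⟩ := Submodule.mem_sup.1 hx
    obtain ⟨a', ha', c', hc', heq⟩ := Submodule.mem_sup.1 hxV
    obtain ⟨rfl, rfl⟩ := eq_and_eq_of_add_eq_add T.inf_eq_bot haA ha'.1 hcC hc'.1 heq.symm
    rw [hhe, e1, e2]
    exact Submodule.add_mem_sup ⟨ha', haD⟩ ⟨hc', hcD⟩
  · refine le_inf ?_ (T.le_crossSpace hh)
    rw [hhe]
    refine sup_le ?_ ?_
    · rw [Submodule.span_singleton_le_iff_mem]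
      exact Submodule.mem_sup_left ⟨hp, hhe ▸ hpD⟩
    · rw [Submodule.span_singleton_le_iff_mem]
      exact Submodule.mem_sup_right ⟨hw, hhe ▸ hwD⟩

theorem liftSpace_map_mkQ : (liftSpace A C D h).map (crossSpace A C B).mkQ = ⊤ := by
  have h1 := Submodule.finrank_sup_add_finrank_inf_eq (liftSpace A C D h) (crossSpace A C B)
  rw [T.liftSpace_inf_crossSpace hh, T.finrank_eq_two hh, T.finrank_liftSpace hh,
    T.finrank_crossSpace] at h1
  rw [Submodule.map_mkQ_eq_top, sup_comm]
  apply Submodule.eq_top_of_finrank_eq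
  rw [T.finrank_total]
  omega

theorem le_liftSpace : h ≤ liftSpace A C D h := by
  conv_lhs => rw [← T.liftSpace_inf_crossSpace hh]
  exact inf_le_left

omit T hh in
theorem liftSpace_le : liftSpace A C D h ≤ D ⊔ h := sup_le inf_le_right inf_le_right

end Transversal

/-- A subspace `H` that satisfies the conditions of the big Schubert problem on `A`, `C`, `B`, `D`
contains a transversal `h` as its intersection with `V`, and is contained in `X_h`. -/
theorem exists_isTransversal {a : ℕ} {H : Submodule ℂ E} (hH : finrank ℂ H = 2 + a)
    (hA : 2 ≤ finrank ℂ ↥(H ⊓ A)) (hC : a ≤ finrank ℂ ↥(H ⊓ C)) (hB : 1 ≤ finrank ℂ ↥(H ⊓ B))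
    (hD : a + 1 ≤ finrank ℂ ↥(H ⊓ D)) :
    ∃ h, IsTransversal A C B D h ∧ H ⊓ crossSpace A C B = h ∧ H ≤ liftSpace A C D h := by
  have hbot : H ⊓ A ⊓ (H ⊓ C) = ⊥ :=
    le_bot_iff.1 ((inf_le_inf inf_le_right inf_le_right).trans T.inf_eq_bot.le)
  have hdec : H ⊓ A ⊔ H ⊓ C = H :=
    Submodule.eq_of_le_of_finrank_le (sup_le inf_le_left inf_le_left) (by
      rw [finrank_sup_of_inf_eq_bot hbot]; omega)
  obtain ⟨y, ⟨hyH, hyB⟩, hy0⟩ := exists_ne_zero_of_one_le_finrank hB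
  have hy : y ∈ H ⊓ A ⊔ H ⊓ C := by rwa [hdec]
  obtain ⟨p, ⟨hpH, hp⟩, w, ⟨hwH, hw⟩, rfl⟩ := Submodule.mem_sup.1 hy
  obtain ⟨hp0, hw0⟩ := T.proj_ne_zero hp hw hyB hy0
  have hpD := (T.proj_notMem p hp w hw hyB hy0).1
  set h := Submodule.span ℂ {p} ⊔ Submodule.span ℂ {w} with hh
  have hhH : h ≤ H := sup_le (by simpa using hpH) (by simpa using hwH)
  have h2 : finrank ℂ h = 2 := T.finrank_span_sup_span hp hw hp0 hw0
  have hDH := Submodule.finrank_sup_add_finrank_inf_eq D H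
  rw [inf_comm D H, hH, T.finrank_D] at hDH
  have hDh := Submodule.finrank_sup_add_finrank_inf_eq D h
  rw [inf_comm D h, h2, T.finrank_D] at hDh
  have hle : D ⊔ h ≤ D ⊔ H := sup_le_sup_left hhH D
  have hmono := Submodule.finrank_mono hle
  -- If `h` missed `D`, then `D ⊔ h` would have dimension `b + 4`, whereas the condition on `D`
  -- bounds the dimension of `D ⊔ H` by `b + 3`.
  have hT : IsTransversal A C B D h := by
    refine ⟨p, hp, w, hw, hyB, hy0, hh, fun hbot => ?_⟩
    rw [hbot, finrank_bot] at hDh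
    omega
  -- The smaller space already has dimension `b + 3`.
  have heq : D ⊔ h = D ⊔ H := Submodule.eq_of_le_of_finrank_le hle (by
    rw [T.finrank_D_sup hT]; omega)
  have hHX : H ≤ liftSpace A C D h := by
    conv_lhs => rw [← hdec]
    exact sup_le_sup (le_inf inf_le_right (inf_le_left.trans (heq ▸ le_sup_right)))
      (le_inf inf_le_right (inf_le_left.trans (heq ▸ le_sup_right)))
  refine ⟨h, hT, le_antisymm ?_ (le_inf hhH (T.le_crossSpace hT)), hHX⟩
  conv_rhs => rw [← T.liftSpace_inf_crossSpace hT]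
  exact inf_le_inf_right _ hHX

end IsTransverse

end Position

/-! ### Translation of the Schubert conditions, one flag at a time -/

section SchubertConditions

variable {E W : Type*} [AddCommGroup E] [Module ℂ E] [FiniteDimensional ℂ E]
  [AddCommGroup W] [Module ℂ W] [FiniteDimensional ℂ W]

/-- The dimension of `H ∩ Fₜ`. -/
def CompleteFlag.meetDim (F : CompleteFlag E) (H : Submodule ℂ E) (t : ℕ) : ℕ :=
  finrank ℂ ↥(H ⊓ F.space t)

theorem mem_schubertVariety_iff {k : ℕ} {p : ℕ → ℕ} {F : CompleteFlag E} {H : Submodule ℂ E} :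
    H ∈ schubertVariety k p F ↔ finrank ℂ H = k ∧
      ∀ j < k, j + 1 ≤ F.meetDim H (finrank ℂ E - k + (j + 1) - p j) :=
  Iff.rfl

theorem CompleteFlag.add_le_finrank_inf (F : CompleteFlag E) (H : Submodule ℂ E) {t : ℕ}
    (ht : t ≤ finrank ℂ E) :
    finrank ℂ H + t ≤ F.meetDim H t + finrank ℂ E := by
  have h1 := finrank_add_le_finrank_inf H (F.space t)
  rw [F.finrank_space] at h1
  rw [CompleteFlag.meetDim]
  omega

theorem CompleteFlag.finrank_inf_mono (F : CompleteFlag E) (H : Submodule ℂ E) {t u : ℕ}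
    (h : t ≤ u) : F.meetDim H t ≤ F.meetDim H u :=
  Submodule.finrank_mono (inf_le_inf_left _ (F.mono h))

theorem CompleteFlag.finrank_inf_succ_le (F : CompleteFlag E) (H : Submodule ℂ E) (t : ℕ) :
    F.meetDim H (t + 1) ≤ F.meetDim H t + 1 := by
  have h1 := finrank_inf_add_le (F.mono t.le_succ) H
  have h2 := F.finrank_space_succ_le t
  rw [CompleteFlag.meetDim, CompleteFlag.meetDim, inf_comm H, inf_comm H]
  simp only [Nat.succ_eq_add_one] at h1
  omega

variable {a b : ℕ} {F : CompleteFlag E} {G : CompleteFlag W} {H : Submodule ℂ E}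
  {K : Submodule ℂ W} (ha : 0 < a) (hab : a < b) (hE : finrank ℂ E = b + 4)
  (hW : finrank ℂ W = b) (hH : finrank ℂ H = 2 + a) (hK : finrank ℂ K = a)

include ha hab hE hW hH hK

/-- From `F_m` to its image, two dimensions are lost to `X_h` and one to `h`, so the index drops by
3 and the rank by 1. The two rows of length `b - a` amount to a single condition on `F_4`, which
becomes the first row for `K`. Zero parts impose nothing, by the dimension formula. -/
theorem mem_schubertVariety_prependRows_two {κ : ℕ → ℕ} (hκ₁ : κ 0 ≤ b - a - 1)
    (hκ : Antitone κ) (hκa : κ (a - 1) = 0)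
    (h4 : G.meetDim K 2 + 1 = F.meetDim H 4)
    (hrel : ∀ m, 5 ≤ m → m ≤ b + 2 →
      G.meetDim K (m - 3) + 1 = F.meetDim H m) :
    H ∈ schubertVariety (2 + a) (prependRows 2 (b - a) κ) F ↔
      K ∈ schubertVariety a (prependRows 1 (b - a - 1) κ) G := by
  simp only [mem_schubertVariety_iff, hH, hK, hE, hW, true_and]
  have key (i : ℕ) (hi : i < a) (hκi : κ (i - 1) ≠ 0) (hi1 : 1 ≤ i) :
      G.meetDim K (b - a + (i + 1) - κ (i - 1)) + 1 =
        F.meetDim H (b + 4 - (2 + a) + (i + 1 + 1) - κ (i - 1)) := by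
    have h0 := hκ (Nat.zero_le (i - 1))
    rw [← hrel _ (by omega) (by omega)]
    congr 2
    omega
  constructor
  · intro h j hj
    rcases j with _ | i
    · have := h 1 (by omega)
      simp only [prependRows] at this ⊢
      rw [if_pos (by omega)] at this ⊢
      rw [show b + 4 - (2 + a) + (1 + 1) - (b - a) = 4 by omega] at this
      rw [show b - a + (0 + 1) - (b - a - 1) = 2 by omega]
      omega
    · simp only [prependRows]
      rw [if_neg (by omega)]
      by_cases hκi : κ (i + 1 - 1) = 0
      · rw [hκi]
        have := G.add_le_finrank_inf K (t := b - a + (i + 1 + 1)) (by omega)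
        rw [Nat.sub_zero]
        omega
      · have := h (i + 1 + 1) (by omega)
        simp only [prependRows] at this
        rw [if_neg (by omega)] at this
        have h2 := key (i + 1) (by omega) hκi (by omega)
        rw [show i + 1 + 1 - 2 = i + 1 - 1 by omega] at this
        omega
  · intro h
    have h1 : 2 ≤ F.meetDim H 4 := by
      have := h 0 (by omega)
      simp only [prependRows] at this
      rw [if_pos (by omega), show b - a + (0 + 1) - (b - a - 1) = 2 by omega] at this
      omega
    intro j hj
    rcases j with _ | _ | i
    · simp only [prependRows]
      rw [if_pos (by omega), show b + 4 - (2 + a) + (0 + 1) - (b - a) = 3 by omega]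
      -- The condition on `F_3` follows from that on `F_4`.
      have := F.finrank_inf_succ_le H 3
      norm_num at this
      omega
    · simp only [prependRows]
      rw [if_pos (by omega), show b + 4 - (2 + a) + (0 + 1 + 1) - (b - a) = 4 by omega]
      exact h1
    · simp only [prependRows]
      rw [if_neg (by omega), show i + 1 + 1 - 2 = i + 1 - 1 by omega]
      by_cases hκi : κ (i + 1 - 1) = 0
      · rw [hκi]
        have := F.add_le_finrank_inf H (t := b + 4 - (2 + a) + (i + 1 + 1 + 1)) (by omega)
        rw [Nat.sub_zero]
        omega
      · have hi : i + 1 < a := by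
          by_contra hi
          exact hκi (Nat.le_zero.1 ((hκ (by omega)).trans_eq hκa))
        have := h (i + 1) hi
        simp only [prependRows] at this
        rw [if_neg (by omega)] at this
        have h2 := key (i + 1) (by omega) hκi (by omega)
        omega

/-- Below `F_b` only the index drops, by 1. At `F_b` both index and rank drop further. The resulting
condition `a - 1 ≤ dim (K ∩ G_{b-2})` follows from the preceding row for `K`, and is empty when `a =
1`. -/
theorem mem_schubertVariety_rect_two_add {ρ : ℕ → ℕ} (hρ : Antitone ρ)
    (hρ₁ : 1 < a → ρ 0 + 1 ≤ b - a) (hρa : ρ (a - 1) = 0)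
    (hb : G.meetDim K (b - 2) + 1 = F.meetDim H b)
    (hrel : ∀ m, 1 ≤ m → m ≤ b - 1 →
      G.meetDim K (m - 1) = F.meetDim H m) :
    H ∈ schubertVariety (2 + a) (rect a 2 + ρ) F ↔
      K ∈ schubertVariety a (rect (a - 1) 1 + ρ) G := by
  simp only [mem_schubertVariety_iff, hH, hK, hE, hW, true_and, rect, Pi.add_apply]
  have key (j : ℕ) (hj : j < a - 1) :
      G.meetDim K (b - a + (j + 1) - (1 + ρ j)) =
        F.meetDim H (b + 4 - (2 + a) + (j + 1) - (2 + ρ j)) := by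
    have h0 := hρ (Nat.zero_le j)
    have h1 := hρ₁ (by omega)
    rw [← hrel _ (by omega) (by omega)]
    congr 1
    omega
  constructor
  · intro h j hj
    split_ifs with hj'
    · have := h j (by omega)
      rw [if_pos hj] at this
      rwa [key j hj']
    · obtain rfl : j = a - 1 := by omega
      rw [hρa]
      have := G.add_le_finrank_inf K (t := b - a + (a - 1 + 1)) (by omega)
      simp only [add_zero, Nat.sub_zero]
      omega
  · intro h j hj
    rcases lt_trichotomy j (a - 1) with hj' | rfl | hj'
    · have := h j (by omega)
      rw [if_pos hj', key j hj'] at this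
      rwa [if_pos (by omega)]
    · rw [if_pos (by omega), hρa,
        show b + 4 - (2 + a) + (a - 1 + 1) - (2 + 0) = b by omega, ← hb]
      by_cases ha1 : a = 1
      · omega
      · have := h (a - 2) (by omega)
        rw [if_pos (by omega)] at this
        have h2 := G.finrank_inf_mono K
          (show b - a + (a - 2 + 1) - (1 + ρ (a - 2)) ≤ b - 2 by omega)
        omega
    · rw [if_neg (by omega), Nat.le_zero.1 ((hρ hj'.le).trans_eq hρa)]
      have := F.add_le_finrank_inf H (t := b + 4 - (2 + a) + (j + 1)) (by omega)
      simp only [add_zero, Nat.sub_zero]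
      omega

/-- The first row only says that `H` meets `F_2`, which `h2` provides. In the other rows the index
drops by 3 and the rank by 1. -/
theorem mem_schubertVariety_prependRows_one {ν : ℕ → ℕ} (hν : Antitone ν) (hν₁ : ν 0 ≤ b - a)
    (hνa : ν a = 0) (h2 : 1 ≤ F.meetDim H 2)
    (hrel : ∀ m, 3 ≤ m → m ≤ b + 2 →
      G.meetDim K (m - 3) + 1 = F.meetDim H m) :
    H ∈ schubertVariety (2 + a) (prependRows 1 (b - a + 1) ν) F ↔ K ∈ schubertVariety a ν G := by
  simp only [mem_schubertVariety_iff, hH, hK, hE, hW, true_and, prependRows]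
  have key (i : ℕ) (hi : i < a) (hνi : ν i ≠ 0) :
      G.meetDim K (b - a + (i + 1) - ν i) + 1 =
        F.meetDim H (b + 4 - (2 + a) + (i + 1 + 1) - ν i) := by
    have h0 := hν (Nat.zero_le i)
    rw [← hrel _ (by omega) (by omega)]
    congr 2
    omega
  constructor
  · intro h i hi
    by_cases hνi : ν i = 0
    · rw [hνi]
      have := G.add_le_finrank_inf K (t := b - a + (i + 1)) (by omega)
      rw [Nat.sub_zero]
      omega
    · have := h (i + 1) (by omega)
      rw [if_neg (by omega), Nat.add_sub_cancel, ← key i hi hνi] at this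
      omega
  · intro h j hj
    rcases j with _ | i
    · rw [if_pos (by omega), show b + 4 - (2 + a) + (0 + 1) - (b - a + 1) = 2 by omega]
      exact h2
    · rw [if_neg (by omega), Nat.add_sub_cancel]
      by_cases hνi : ν i = 0
      · rw [hνi]
        have := F.add_le_finrank_inf H (t := b + 4 - (2 + a) + (i + 1 + 1)) (by omega)
        rw [Nat.sub_zero]
        omega
      · have hi : i < a := by
          by_contra hi
          exact hνi (Nat.le_zero.1 ((hν (by omega)).trans_eq hνa))
        have := h i hi
        rw [← key i hi hνi]
        omega

/-- The last nontrivial row is the condition at `F_{b+2}`, provided by `hb`. In the first `a` rows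
the index drops by 1 and the rank is kept. -/
theorem mem_schubertVariety_rect_one_add {ν : ℕ → ℕ} (hν : Antitone ν) (hν₁ : ν 0 ≤ b - a)
    (hνa : ν a = 0) (hb : a + 1 ≤ F.meetDim H (b + 2))
    (hrel : ∀ m, 1 ≤ m → m ≤ b + 1 →
      G.meetDim K (m - 1) = F.meetDim H m) :
    H ∈ schubertVariety (2 + a) (rect (a + 1) 1 + ν) F ↔ K ∈ schubertVariety a ν G := by
  simp only [mem_schubertVariety_iff, hH, hK, hE, hW, true_and, rect, Pi.add_apply]
  have key (j : ℕ) (hj : j < a) :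
      G.meetDim K (b - a + (j + 1) - ν j) =
        F.meetDim H (b + 4 - (2 + a) + (j + 1) - (1 + ν j)) := by
    have h0 := hν (Nat.zero_le j)
    rw [← hrel _ (by omega) (by omega)]
    congr 1
    omega
  constructor
  · intro h j hj
    have := h j (by omega)
    rw [if_pos (by omega)] at this
    rwa [key j hj]
  · intro h j hj
    rcases lt_trichotomy j a with hj' | rfl | hj'
    · have := h j hj'
      rw [if_pos (by omega), ← key j hj']
      exact this
    · rw [if_pos (by omega), hνa, show b + 4 - (2 + j) + (j + 1) - (1 + 0) = b + 2 by omega]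
      exact hb
    · rw [if_neg (by omega), Nat.le_zero.1 ((hν hj'.le).trans_eq hνa)]
      have := F.add_le_finrank_inf H (t := b + 4 - (2 + a) + (j + 1)) (by omega)
      simp only [add_zero, Nat.sub_zero]
      omega

/-- Here `h` costs nothing, so only the codimension 2 of `X_h` is felt. -/
theorem mem_schubertVariety_same {ν : ℕ → ℕ} (hν : Antitone ν) (hν₁ : ν 0 ≤ b - a)
    (hνa : ν a = 0)
    (hrel : ∀ m, 2 ≤ m → m ≤ b + 2 →
      G.meetDim K (m - 2) = F.meetDim H m) :
    H ∈ schubertVariety (2 + a) ν F ↔ K ∈ schubertVariety a ν G := by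
  simp only [mem_schubertVariety_iff, hH, hK, hE, hW, true_and]
  have key (j : ℕ) (hj : j < a) :
      G.meetDim K (b - a + (j + 1) - ν j) =
        F.meetDim H (b + 4 - (2 + a) + (j + 1) - ν j) := by
    have h0 := hν (Nat.zero_le j)
    rw [← hrel _ (by omega) (by omega)]
    congr 1
    omega
  constructor
  · intro h j hj
    rw [key j hj]
    exact h j (by omega)
  · intro h j hj
    by_cases hj' : j < a
    · rw [← key j hj']
      exact h j hj'
    · rw [Nat.le_zero.1 ((hν (not_lt.1 hj')).trans_eq hνa)]
      have := F.add_le_finrank_inf H (t := b + 4 - (2 + a) + (j + 1)) (by omega)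
      rw [Nat.sub_zero]
      omega

end SchubertConditions

/-! ### Generic tuples of flags: base problem, fibers and the bijection -/

section Generic

variable {E : Type*} [AddCommGroup E] [Module ℂ E] [FiniteDimensional ℂ E] {m : ℕ}

theorem forall_fin_four_add {P : Fin (4 + m) → Prop} :
    (∀ i, P i) ↔ P (Fin.castAdd m 0) ∧ P (Fin.castAdd m 1) ∧ P (Fin.castAdd m 2) ∧
      P (Fin.castAdd m 3) ∧ ∀ j, P (Fin.natAdd 4 j) := by
  constructor
  · exact fun h => ⟨h _, h _, h _, h _, fun _ => h _⟩
  · rintro ⟨h0, h1, h2, h3, h⟩ i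
    induction i using Fin.addCases with
    | left i => fin_cases i <;> assumption
    | right j => exact h j

/-- The four-dimensional space of the first flag. -/
def spaceA (F : Fin (4 + m) → CompleteFlag E) : Submodule ℂ E := (F (Fin.castAdd m 0)).space 4

/-- The `b`-dimensional space of the second flag. -/
def spaceC (b : ℕ) (F : Fin (4 + m) → CompleteFlag E) : Submodule ℂ E :=
  (F (Fin.castAdd m 1)).space b

/-- The two-dimensional space of the third flag. -/
def spaceB (F : Fin (4 + m) → CompleteFlag E) : Submodule ℂ E := (F (Fin.castAdd m 2)).space 2

/-- The `(b + 2)`-dimensional space of the fourth flag. -/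
def spaceD (b : ℕ) (F : Fin (4 + m) → CompleteFlag E) : Submodule ℂ E :=
  (F (Fin.castAdd m 3)).space (b + 2)

/-- The four-dimensional space `V` of a generic tuple of flags. -/
def baseSpace (b : ℕ) (F : Fin (4 + m) → CompleteFlag E) : Submodule ℂ E :=
  crossSpace (spaceA F) (spaceC b F) (spaceB F)

/-- The space that contains all solutions whose intersection with `V` is `h`. -/
def solutionSpan (b : ℕ) (F : Fin (4 + m) → CompleteFlag E) (h : Submodule ℂ E) :
    Submodule ℂ E :=
  liftSpace (spaceA F) (spaceC b F) (spaceD b F) h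

/-- The planes in `V` that solve the base problem. -/
def IsBaseSolution (b : ℕ) (F : Fin (4 + m) → CompleteFlag E) (h : Submodule ℂ E) : Prop :=
  IsTransversal (spaceA F) (spaceC b F) (spaceB F) (spaceD b F) h

/-- The dimensions of the intersections of the spaces of a flag with `X` and `h`, within the range
from `lo` to `hi`. -/
def HasProfile (F : CompleteFlag E) (X h : Submodule ℂ E) (lo hi d r : ℕ) : Prop :=
  ∀ t, lo ≤ t → t ≤ hi → finrank ℂ ↥(F.space t ⊓ X) + d = t ∧ finrank ℂ ↥(F.space t ⊓ h) = r

/-- Tuples of flags in general position. -/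
structure IsGeneric (b : ℕ) (F : Fin (4 + m) → CompleteFlag E) : Prop where
  transverse : IsTransverse b (spaceA F) (spaceC b F) (spaceB F) (spaceD b F)
  profile₁ : ∀ h, IsBaseSolution b F h →
    HasProfile (F (Fin.castAdd m 0)) (solutionSpan b F h) h 5 (b + 2) 2 1
  profile₂ : ∀ h, IsBaseSolution b F h →
    HasProfile (F (Fin.castAdd m 1)) (solutionSpan b F h) h 1 (b - 1) 1 0
  profile₃ : ∀ h, IsBaseSolution b F h →
    HasProfile (F (Fin.castAdd m 2)) (solutionSpan b F h) h 3 (b + 2) 2 1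
  profile₄ : ∀ h, IsBaseSolution b F h →
    HasProfile (F (Fin.castAdd m 3)) (solutionSpan b F h) h 1 (b + 1) 1 0
  profile : ∀ h, IsBaseSolution b F h → ∀ j,
    HasProfile (F (Fin.natAdd 4 j)) (solutionSpan b F h) h 2 (b + 2) 2 0

/-- The flags in `V` formed by the intersections with `V`. -/
def baseFlags (F : Fin (4 + m) → CompleteFlag E) (V : Submodule ℂ E) (i : Fin 4) :
    CompleteFlag V :=
  flagOfChain fun t => ((F (Fin.castAdd m i)).space t).comap V.subtype

/-- The flags in `E/V` formed by the images of the intersections with `X_h`. -/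
def fiberFlags (b : ℕ) (F : Fin (4 + m) → CompleteFlag E) (V h : Submodule ℂ E)
    (i : Fin (4 + m)) : CompleteFlag (E ⧸ V) :=
  flagOfChain fun t => ((F i).space t ⊓ solutionSpan b F h).map V.mkQ

/-- The instances induced on a subspace `V` and on the quotient by `V`. -/
def inducedOn (b : ℕ) (F : Fin (4 + m) → CompleteFlag E) (V : Submodule ℂ E) :
    InducedInstances E 4 (4 + m) where
  V := V
  base := baseFlags F V
  fiber h := fiberFlags b F V (h.map V.subtype)

/-- The partitions of the problem in `Gr(2 + a, 4 + b)`. -/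
def totalProblem (a b : ℕ) (κ ρ ν₃ ν₄ : ℕ → ℕ) (τ : Fin m → ℕ → ℕ) : Fin (4 + m) → ℕ → ℕ :=
  Fin.append ![prependRows 2 (b - a) κ, rect a 2 + ρ,
    prependRows 1 (b - a + 1) ν₃, rect (a + 1) 1 + ν₄] τ

/-- The partitions of the problem in `Gr(a, b)`. -/
def fiberProblem (a b : ℕ) (κ ρ ν₃ ν₄ : ℕ → ℕ) (τ : Fin m → ℕ → ℕ) : Fin (4 + m) → ℕ → ℕ :=
  Fin.append ![prependRows 1 (b - a - 1) κ, rect (a - 1) 1 + ρ, ν₃, ν₄] τ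

/-- The bounds on the partitions that form the fiber problem. -/
structure FiberBounds (a b : ℕ) (κ ρ ν₃ ν₄ : ℕ → ℕ) (τ : Fin m → ℕ → ℕ) : Prop where
  pos : 0 < a
  lt : a < b
  antitone_κ : Antitone κ
  κ_zero : κ 0 ≤ b - a - 1
  κ_last : κ (a - 1) = 0
  antitone_ρ : Antitone ρ
  ρ_zero : 1 < a → ρ 0 + 1 ≤ b - a
  ρ_last : ρ (a - 1) = 0
  part₃ : IsPartitionFor a b ν₃
  part₄ : IsPartitionFor a b ν₄
  part : ∀ j, IsPartitionFor a b (τ j)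

theorem map_subtype_inf_comap (V Y : Submodule ℂ E) (h : Submodule ℂ V) :
    (h ⊓ Y.comap V.subtype).map V.subtype = h.map V.subtype ⊓ Y := by
  ext x
  simp only [Submodule.mem_map, Submodule.mem_inf, Submodule.mem_comap]
  constructor
  · rintro ⟨y, ⟨hy, hY⟩, rfl⟩
    exact ⟨⟨y, hy, rfl⟩, hY⟩
  · rintro ⟨⟨y, hy, rfl⟩, hY⟩
    exact ⟨y, ⟨hy, hY⟩, rfl⟩

theorem finrank_comap_subtype (V Y : Submodule ℂ E) :
    finrank ℂ (Y.comap V.subtype) = finrank ℂ ↥(Y ⊓ V) := by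
  rw [← Submodule.finrank_map_subtype_eq, Submodule.map_comap_subtype, inf_comm]

section Quotient

variable {V X h H : Submodule ℂ E}

/-- Two lifts in `X` of one vector of the quotient differ by an element of `X ⊓ V = h`, which `H'`
contains. This makes the map to pairs injective. -/
theorem le_of_map_mkQ_le {H' : Submodule ℂ E} (hXV : X ⊓ V = h) (hh : h ≤ H') (hHX : H ≤ X)
    (hHX' : H' ≤ X) (hmap : H.map V.mkQ ≤ H'.map V.mkQ) : H ≤ H' := fun x hx => by
  obtain ⟨y, hy, hxy⟩ := hmap (Submodule.mem_map_of_mem hx)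
  have h1 : x - y ∈ X ⊓ V :=
    ⟨X.sub_mem (hHX hx) (hHX' hy), (Submodule.Quotient.eq V).1 hxy.symm⟩
  rw [hXV] at h1
  simpa using H'.add_mem (hh h1) hy

theorem map_inf_comap_mkQ (hX : X.map V.mkQ = ⊤) (K : Submodule ℂ (E ⧸ V)) :
    (X ⊓ K.comap V.mkQ).map V.mkQ = K := by
  ext z
  constructor
  · rintro ⟨x, hx, rfl⟩
    exact hx.2
  · intro hz
    obtain ⟨x, hx, rfl⟩ : z ∈ X.map V.mkQ := by rw [hX]; trivial
    exact ⟨x, ⟨hx, hz⟩, rfl⟩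

variable (hXV : X ⊓ V = h) (hh : h ≤ H) (hHX : H ≤ X)

include hXV hh hHX

theorem inf_eq_of_le : H ⊓ V = h :=
  le_antisymm (hXV ▸ inf_le_inf_right V hHX) (le_inf hh (hXV ▸ inf_le_right))

/-- Images need not commute with intersections in general, but here two lifts in `X` differ by an
element of `h ≤ H`. -/
theorem map_mkQ_inf_map_mkQ (Y : Submodule ℂ E) :
    H.map V.mkQ ⊓ (Y ⊓ X).map V.mkQ = (H ⊓ Y).map V.mkQ := by
  apply le_antisymm
  · rintro _ ⟨⟨x, hx, rfl⟩, y, hy, hxy⟩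
    have h1 : y - x ∈ X ⊓ V :=
      ⟨X.sub_mem hy.2 (hHX hx), (Submodule.Quotient.eq V).1 hxy⟩
    rw [hXV] at h1
    have h2 : y ∈ H := by simpa using H.add_mem (hh h1) hx
    exact ⟨y, ⟨h2, hy.1⟩, hxy⟩
  · exact le_inf (Submodule.map_mono inf_le_left)
      (Submodule.map_mono (le_inf inf_le_right (inf_le_left.trans hHX)))

theorem finrank_map_mkQ_inf (Y : Submodule ℂ E) :
    finrank ℂ ((H ⊓ Y).map V.mkQ) + finrank ℂ ↥(Y ⊓ h) = finrank ℂ ↥(H ⊓ Y) := by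
  rw [← finrank_map_add_finrank_inf_ker V.mkQ (H ⊓ Y), Submodule.ker_mkQ, inf_right_comm,
    inf_eq_of_le hXV hh hHX, inf_comm h]

theorem finrank_map_mkQ : finrank ℂ (H.map V.mkQ) + finrank ℂ h = finrank ℂ H := by
  have := finrank_map_mkQ_inf hXV hh hHX ⊤
  rwa [inf_top_eq, top_inf_eq] at this

/-- The image of `F_t ⊓ X` has dimension `t - d - r`, the loss being `d` from `X` and `r` from `h`.
The space `H ⊓ F_t` already lies in `X`, so it loses only the `r`. -/
theorem meetDim_flagOfChain (hX : X.map V.mkQ = ⊤) (F : CompleteFlag E) {t d r : ℕ}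
    (hd : finrank ℂ ↥(F.space t ⊓ X) + d = t) (hr : finrank ℂ ↥(F.space t ⊓ h) = r) :
    (flagOfChain fun t => (F.space t ⊓ X).map V.mkQ).meetDim (H.map V.mkQ) (t - d - r) + r =
      F.meetDim H t := by
  have h1 : finrank ℂ ((F.space t ⊓ X).map V.mkQ) = t - d - r := by
    have := finrank_map_mkQ_inf hXV (H := X) (hh.trans hHX) le_rfl (F.space t)
    rw [inf_comm X] at this
    omega
  have h2 := flagOfChain_space (isFlagChain_map F X V.mkQ hX) h1
  rw [CompleteFlag.meetDim, h2, map_mkQ_inf_map_mkQ hXV hh hHX, CompleteFlag.meetDim, ← hr,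
    finrank_map_mkQ_inf hXV hh hHX]

end Quotient

namespace IsGeneric

variable {a b : ℕ} {κ ρ ν₃ ν₄ : ℕ → ℕ} {τ : Fin m → ℕ → ℕ} {F : Fin (4 + m) → CompleteFlag E}
  (hF : IsGeneric b F)

include hF

theorem finrank_baseSpace : finrank ℂ (baseSpace b F) = 4 :=
  hF.transverse.finrank_crossSpace

theorem finrank_quotient : finrank ℂ (E ⧸ baseSpace b F) = b := by
  have := Submodule.finrank_quotient_add_finrank (baseSpace b F)
  rw [hF.finrank_baseSpace, hF.transverse.finrank_total] at this
  omega

/-- The planes of the four flags in `V` are the traces of `A`, `C`, `B`, `D`. Hence the four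
conditions say that `h` meets these spaces. -/
theorem mem_solutions_base_iff (h : Submodule ℂ (baseSpace b F)) :
    h ∈ solutions 2 (fun _ : Fin 4 => rect 1 1) (baseFlags F (baseSpace b F)) ↔
      IsBaseSolution b F (h.map (baseSpace b F).subtype) := by
  have T := hF.transverse
  have key (i : Fin 4) (t : ℕ)
      (ht : finrank ℂ ↥((F (Fin.castAdd m i)).space t ⊓ baseSpace b F) = 2)
      (h2 : finrank ℂ h = 2) :
      h ∈ schubertVariety 2 (rect 1 1) (baseFlags F (baseSpace b F) i) ↔
        1 ≤ finrank ℂ ↥(h.map (baseSpace b F).subtype ⊓ (F (Fin.castAdd m i)).space t) := by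
    have hs : (baseFlags F (baseSpace b F) i).space 2 =
        ((F (Fin.castAdd m i)).space t).comap (baseSpace b F).subtype :=
      flagOfChain_space (isFlagChain_comap_subtype _ _) (by rw [finrank_comap_subtype, ht])
    rw [mem_schubertVariety_iff, ← map_subtype_inf_comap, Submodule.finrank_map_subtype_eq, ← hs]
    have h4 := hF.finrank_baseSpace
    constructor
    · rintro ⟨-, hj⟩
      have := hj 0 (by omega)
      rwa [h4] at this
    · refine fun hle => ⟨h2, fun j hj => ?_⟩
      obtain rfl | rfl : j = 0 ∨ j = 1 := by omega
      · rw [h4]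
        exact hle
      -- The second part of `rect 1 1` is zero, so this condition concerns the whole of `V`.
      · rw [h4, CompleteFlag.meetDim, CompleteFlag.space_eq_top _ (by rw [h4]; simp [rect]),
          inf_top_eq]
        exact h2.ge
  have t0 : finrank ℂ ↥((F (Fin.castAdd m 0)).space 4 ⊓ baseSpace b F) = 2 := by
    rw [inf_comm, ← T.finrank_projA, ← T.crossSpace_inf_A]; rfl
  have t1 : finrank ℂ ↥((F (Fin.castAdd m 1)).space b ⊓ baseSpace b F) = 2 := by
    rw [inf_comm, ← T.finrank_projC, ← T.crossSpace_inf_C]; rfl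
  have t2 : finrank ℂ ↥((F (Fin.castAdd m 2)).space 2 ⊓ baseSpace b F) = 2 := by
    have : (F (Fin.castAdd m 2)).space 2 ⊓ baseSpace b F = (F (Fin.castAdd m 2)).space 2 :=
      inf_eq_left.2 T.B_le_crossSpace
    rw [this]
    exact T.finrank_B
  have t3 : finrank ℂ ↥((F (Fin.castAdd m 3)).space (b + 2) ⊓ baseSpace b F) = 2 := by
    rw [inf_comm]; exact T.finrank_crossSpace_inf_D
  constructor
  · rintro ⟨h2, hi⟩
    exact T.isTransversal_of_finrank (by rw [Submodule.finrank_map_subtype_eq, h2])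
      ((key 0 4 t0 h2).1 (hi 0)) ((key 1 b t1 h2).1 (hi 1)) ((key 2 2 t2 h2).1 (hi 2))
      ((key 3 (b + 2) t3 h2).1 (hi 3))
  · intro hh
    have h2 : finrank ℂ h = 2 := by
      rw [← Submodule.finrank_map_subtype_eq]; exact T.finrank_eq_two hh
    obtain ⟨h0, h1, h2', h3⟩ := T.one_le_finrank_inf hh
    refine ⟨h2, fun i => ?_⟩
    fin_cases i
    · exact (key 0 4 t0 h2).2 h0
    · exact (key 1 b t1 h2).2 h1
    · exact (key 2 2 t2 h2).2 h2'
    · exact (key 3 (b + 2) t3 h2).2 h3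

theorem solutionSpan_inf {h : Submodule ℂ E} (hh : IsBaseSolution b F h) :
    solutionSpan b F h ⊓ baseSpace b F = h :=
  hF.transverse.liftSpace_inf_crossSpace hh

theorem map_solutionSpan {h : Submodule ℂ E} (hh : IsBaseSolution b F h) :
    (solutionSpan b F h).map (baseSpace b F).mkQ = ⊤ :=
  hF.transverse.liftSpace_map_mkQ hh

section FixedBaseSolution

variable (hB : FiberBounds a b κ ρ ν₃ ν₄ τ) {h H : Submodule ℂ E} (hh : IsBaseSolution b F h)
  (hH : h ≤ H) (hHX : H ≤ solutionSpan b F h)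

include hh hH hHX

theorem finrank_map_add_two :
    finrank ℂ (H.map (baseSpace b F).mkQ) + 2 = finrank ℂ H := by
  rw [← finrank_map_mkQ (hF.solutionSpan_inf hh) hH hHX, hF.transverse.finrank_eq_two hh]

theorem meetDim_fiberFlags (i) {t d r : ℕ}
    (hd : finrank ℂ ↥((F i).space t ⊓ solutionSpan b F h) + d = t)
    (hr : finrank ℂ ↥((F i).space t ⊓ h) = r) :
    (fiberFlags b F (baseSpace b F) h i).meetDim (H.map (baseSpace b F).mkQ) (t - d - r) + r =
      (F i).meetDim H t :=
  meetDim_flagOfChain (hF.solutionSpan_inf hh) hH hHX (hF.map_solutionSpan hh) (F i) hd hr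

theorem meetDim_fiberFlags_of_hasProfile (i) {lo hi d r : ℕ}
    (hp : HasProfile (F i) (solutionSpan b F h) h lo hi d r) {k : ℕ} (hk : d + r = k) (t : ℕ)
    (h1 : lo ≤ t) (h2 : t ≤ hi) :
    (fiberFlags b F (baseSpace b F) h i).meetDim (H.map (baseSpace b F).mkQ) (t - k) + r =
      (F i).meetDim H t := by
  rw [← hk, ← Nat.sub_sub]
  exact hF.meetDim_fiberFlags hh hH hHX i (hp t h1 h2).1 (hp t h1 h2).2

variable (hH2 : finrank ℂ H = 2 + a)

include hB hH2

theorem mem_schubertVariety_total_iff₁ :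
    H ∈ schubertVariety (2 + a) (prependRows 2 (b - a) κ) (F (Fin.castAdd m 0)) ↔
      H.map (baseSpace b F).mkQ ∈ schubertVariety a (prependRows 1 (b - a - 1) κ)
        (fiberFlags b F (baseSpace b F) h (Fin.castAdd m 0)) := by
  have hK := hF.finrank_map_add_two hh hH hHX
  have T := hF.transverse
  have hXA : finrank ℂ ↥(spaceA F ⊓ solutionSpan b F h) + 1 = 4 := by
    have := T.finrank_A_inf hh
    rw [← T.liftSpace_inf_A hh] at this
    rw [inf_comm, solutionSpan, this]
  have h4 := hF.meetDim_fiberFlags hh hH hHX (Fin.castAdd m 0) hXA (T.finrank_A_inf_eq_one hh)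
  rw [Nat.sub_sub] at h4
  exact mem_schubertVariety_prependRows_two hB.pos hB.lt T.finrank_total hF.finrank_quotient hH2
    (by omega) hB.κ_zero hB.antitone_κ hB.κ_last h4
    (hF.meetDim_fiberFlags_of_hasProfile hh hH hHX _ (hF.profile₁ h hh) rfl)

theorem mem_schubertVariety_total_iff₂ :
    H ∈ schubertVariety (2 + a) (rect a 2 + ρ) (F (Fin.castAdd m 1)) ↔
      H.map (baseSpace b F).mkQ ∈ schubertVariety a (rect (a - 1) 1 + ρ)
        (fiberFlags b F (baseSpace b F) h (Fin.castAdd m 1)) := by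
  have hK := hF.finrank_map_add_two hh hH hHX
  have T := hF.transverse
  have hXC : finrank ℂ ↥(spaceC b F ⊓ solutionSpan b F h) + 1 = b := by
    have := T.finrank_C_inf hh
    rw [← T.liftSpace_inf_C hh] at this
    rwa [inf_comm, solutionSpan]
  have hb := hF.meetDim_fiberFlags hh hH hHX (Fin.castAdd m 1) hXC (T.finrank_C_inf_eq_one hh)
  rw [Nat.sub_sub] at hb
  exact mem_schubertVariety_rect_two_add hB.pos hB.lt T.finrank_total hF.finrank_quotient hH2
    (by omega) hB.antitone_ρ hB.ρ_zero hB.ρ_last hb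
    (hF.meetDim_fiberFlags_of_hasProfile hh hH hHX _ (hF.profile₂ h hh) rfl)

theorem mem_schubertVariety_total_iff₃ :
    H ∈ schubertVariety (2 + a) (prependRows 1 (b - a + 1) ν₃) (F (Fin.castAdd m 2)) ↔
      H.map (baseSpace b F).mkQ ∈ schubertVariety a ν₃
        (fiberFlags b F (baseSpace b F) h (Fin.castAdd m 2)) := by
  have hK := hF.finrank_map_add_two hh hH hHX
  have T := hF.transverse
  exact mem_schubertVariety_prependRows_one hB.pos hB.lt T.finrank_total hF.finrank_quotient hH2
    (by omega) hB.part₃.1 hB.part₃.2.1 hB.part₃.2.2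
    ((T.one_le_finrank_inf hh).2.2.1.trans (Submodule.finrank_mono (inf_le_inf_right _ hH)))
    (hF.meetDim_fiberFlags_of_hasProfile hh hH hHX _ (hF.profile₃ h hh) rfl)

theorem mem_schubertVariety_total_iff₄ :
    H ∈ schubertVariety (2 + a) (rect (a + 1) 1 + ν₄) (F (Fin.castAdd m 3)) ↔
      H.map (baseSpace b F).mkQ ∈ schubertVariety a ν₄
        (fiberFlags b F (baseSpace b F) h (Fin.castAdd m 3)) := by
  have hK := hF.finrank_map_add_two hh hH hHX
  have T := hF.transverse
  have hD : a + 1 ≤ (F (Fin.castAdd m 3)).meetDim H (b + 2) := by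
    have e := Submodule.finrank_sup_add_finrank_inf_eq H (spaceD b F)
    have e1 : finrank ℂ ↥(H ⊔ spaceD b F) ≤ b + 3 := by
      rw [← T.finrank_D_sup hh]
      exact Submodule.finrank_mono
        (sup_le (hHX.trans IsTransverse.liftSpace_le) le_sup_left)
    rw [hH2, T.finrank_D] at e
    have e2 : (F (Fin.castAdd m 3)).meetDim H (b + 2) = finrank ℂ ↥(H ⊓ spaceD b F) := rfl
    omega
  exact mem_schubertVariety_rect_one_add hB.pos hB.lt T.finrank_total hF.finrank_quotient hH2
    (by omega) hB.part₄.1 hB.part₄.2.1 hB.part₄.2.2 hD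
    (hF.meetDim_fiberFlags_of_hasProfile hh hH hHX _ (hF.profile₄ h hh) rfl)

theorem mem_schubertVariety_total_iff (j : Fin m) :
    H ∈ schubertVariety (2 + a) (τ j) (F (Fin.natAdd 4 j)) ↔
      H.map (baseSpace b F).mkQ ∈ schubertVariety a (τ j)
        (fiberFlags b F (baseSpace b F) h (Fin.natAdd 4 j)) := by
  have hK := hF.finrank_map_add_two hh hH hHX
  have T := hF.transverse
  exact mem_schubertVariety_same hB.pos hB.lt T.finrank_total hF.finrank_quotient hH2
    (by omega) (hB.part j).1 (hB.part j).2.1 (hB.part j).2.2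
    (hF.meetDim_fiberFlags_of_hasProfile hh hH hHX _ (hF.profile h hh j) rfl)

omit hH2 in
theorem mem_solutions_total_iff :
    H ∈ solutions (2 + a) (totalProblem a b κ ρ ν₃ ν₄ τ) F ↔
      H.map (baseSpace b F).mkQ ∈ solutions a (fiberProblem a b κ ρ ν₃ ν₄ τ)
        (fiberFlags b F (baseSpace b F) h) := by
  have hK := hF.finrank_map_add_two hh hH hHX
  have hfin : finrank ℂ H = 2 + a ↔ finrank ℂ (H.map (baseSpace b F).mkQ) = a := by omega
  have key (hH2 : finrank ℂ H = 2 + a) :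
      (∀ i, H ∈ schubertVariety (2 + a) (totalProblem a b κ ρ ν₃ ν₄ τ i) (F i)) ↔
        ∀ i, H.map (baseSpace b F).mkQ ∈ schubertVariety a (fiberProblem a b κ ρ ν₃ ν₄ τ i)
          (fiberFlags b F (baseSpace b F) h i) := by
    rw [forall_fin_four_add, forall_fin_four_add]
    simp only [totalProblem, fiberProblem, Fin.append_left, Fin.append_right]
    exact and_congr (hF.mem_schubertVariety_total_iff₁ hB hh hH hHX hH2) <|
      and_congr (hF.mem_schubertVariety_total_iff₂ hB hh hH hHX hH2) <|
      and_congr (hF.mem_schubertVariety_total_iff₃ hB hh hH hHX hH2) <|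
      and_congr (hF.mem_schubertVariety_total_iff₄ hB hh hH hHX hH2) <|
      forall_congr' (hF.mem_schubertVariety_total_iff hB hh hH hHX hH2)
  exact ⟨fun ⟨h1, h2⟩ => ⟨hfin.1 h1, (key h1).1 h2⟩,
    fun ⟨h1, h2⟩ => ⟨hfin.2 h1, (key (hfin.2 h1)).2 h2⟩⟩

end FixedBaseSolution

/-- Of each of the first four partitions a single row is needed, the one at `A`, `C`, `B` or `D`. -/
theorem exists_isBaseSolution (hB : FiberBounds a b κ ρ ν₃ ν₄ τ) {H : Submodule ℂ E}
    (hH : H ∈ solutions (2 + a) (totalProblem a b κ ρ ν₃ ν₄ τ) F) :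
    ∃ h, IsBaseSolution b F h ∧ H ⊓ baseSpace b F = h ∧ H ≤ solutionSpan b F h := by
  have T := hF.transverse
  have hE := T.finrank_total
  have ha := hB.pos
  have hab := hB.lt
  obtain ⟨hH2, hi⟩ := hH
  unfold totalProblem at hi
  rw [forall_fin_four_add] at hi
  simp only [Fin.append_left, Fin.append_right] at hi
  obtain ⟨h1, h2, h3, h4, -⟩ := hi
  rw [mem_schubertVariety_iff] at h1 h2 h3 h4
  refine T.exists_isTransversal hH2 ?_ ?_ ?_ ?_
  · have := h1.2 1 (by omega)
    rw [hE] at this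
    simp only [Matrix.cons_val, prependRows] at this
    rw [if_pos (by omega), show b + 4 - (2 + a) + (1 + 1) - (b - a) = 4 by omega] at this
    exact this
  · have := h2.2 (a - 1) (by omega)
    rw [hE] at this
    simp only [Matrix.cons_val, rect, Pi.add_apply] at this
    rw [if_pos (by omega), hB.ρ_last,
      show b + 4 - (2 + a) + (a - 1 + 1) - (2 + 0) = b by omega,
      show a - 1 + 1 = a by omega] at this
    exact this
  · have := h3.2 0 (by omega)
    rw [hE] at this
    simp only [Matrix.cons_val, prependRows] at this
    rw [if_pos (by omega), show b + 4 - (2 + a) + (0 + 1) - (b - a + 1) = 2 by omega] at this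
    exact this
  · have := h4.2 a (by omega)
    rw [hE] at this
    simp only [Matrix.cons_val, rect, Pi.add_apply] at this
    rw [if_pos (by omega), hB.part₄.2.2,
      show b + 4 - (2 + a) + (a + 1) - (1 + 0) = b + 2 by omega] at this
    exact this

theorem map_subtype_comap_subtype {h H : Submodule ℂ E} (hV : H ⊓ baseSpace b F = h) :
    (H.comap (baseSpace b F).subtype).map (baseSpace b F).subtype = h := by
  rw [Submodule.map_comap_subtype, inf_comm, hV]

theorem comap_mem_solutions_base (hB : FiberBounds a b κ ρ ν₃ ν₄ τ) {H : Submodule ℂ E}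
    (hH : H ∈ solutions (2 + a) (totalProblem a b κ ρ ν₃ ν₄ τ) F) :
    H.comap (baseSpace b F).subtype ∈
      solutions 2 (fun _ : Fin 4 => rect 1 1) (baseFlags F (baseSpace b F)) := by
  obtain ⟨h, hh, hV, -⟩ := hF.exists_isBaseSolution hB hH
  rwa [hF.mem_solutions_base_iff, hF.map_subtype_comap_subtype hV]

theorem map_mem_solutions_fiber (hB : FiberBounds a b κ ρ ν₃ ν₄ τ) {H : Submodule ℂ E}
    (hH : H ∈ solutions (2 + a) (totalProblem a b κ ρ ν₃ ν₄ τ) F) :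
    H.map (baseSpace b F).mkQ ∈ solutions a (fiberProblem a b κ ρ ν₃ ν₄ τ)
      (fiberFlags b F (baseSpace b F)
        ((H.comap (baseSpace b F).subtype).map (baseSpace b F).subtype)) := by
  obtain ⟨h, hh, hV, hX⟩ := hF.exists_isBaseSolution hB hH
  rw [hF.map_subtype_comap_subtype hV]
  exact (hF.mem_solutions_total_iff hB hh (hV ▸ inf_le_left) hX).1 hH

theorem bijOn_solutions (hB : FiberBounds a b κ ρ ν₃ ν₄ τ) :
    Set.BijOn (fun H : Submodule ℂ E =>
        (H.comap (baseSpace b F).subtype, H.map (baseSpace b F).mkQ))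
      (solutions (2 + a) (totalProblem a b κ ρ ν₃ ν₄ τ) F)
      {x | x.1 ∈ solutions 2 (fun _ : Fin 4 => rect 1 1) (baseFlags F (baseSpace b F)) ∧
        x.2 ∈ solutions a (fiberProblem a b κ ρ ν₃ ν₄ τ)
          (fiberFlags b F (baseSpace b F) (x.1.map (baseSpace b F).subtype))} := by
  refine ⟨fun H hH => ⟨hF.comap_mem_solutions_base hB hH, hF.map_mem_solutions_fiber hB hH⟩,
    fun H hH H' hH' heq => ?_, ?_⟩
  · obtain ⟨h, hh, hV, hX⟩ := hF.exists_isBaseSolution hB hH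
    obtain ⟨h', hh', hV', hX'⟩ := hF.exists_isBaseSolution hB hH'
    obtain ⟨h1, h2⟩ := Prod.mk.inj heq
    have he : h = h' := by
      rw [← hF.map_subtype_comap_subtype hV, h1, hF.map_subtype_comap_subtype hV']
    subst he
    have hXV := hF.solutionSpan_inf hh
    exact le_antisymm (le_of_map_mkQ_le hXV (hV' ▸ inf_le_left) hX hX' h2.le)
      (le_of_map_mkQ_le hXV (hV ▸ inf_le_left) hX' hX h2.ge)
  · rintro ⟨h', K⟩ ⟨hh', hK⟩
    dsimp only at hh' hK
    rw [hF.mem_solutions_base_iff] at hh'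
    have hXV := hF.solutionSpan_inf hh'
    have hX := hF.map_solutionSpan hh'
    set h := h'.map (baseSpace b F).subtype with hhe
    -- The solution over `(h, K)` is the preimage of `K` within `X_h`; it contains `h`.
    set H := solutionSpan b F h ⊓ K.comap (baseSpace b F).mkQ with hHe
    have hhH : h ≤ H := by
      refine le_inf (hF.transverse.le_liftSpace hh') ?_
      intro x hx
      have : (baseSpace b F).mkQ x = 0 := by
        rw [← LinearMap.mem_ker, Submodule.ker_mkQ]
        rw [← hXV] at hx
        exact hx.2
      rw [Submodule.mem_comap, this]
      exact K.zero_mem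
    have hHK : H.map (baseSpace b F).mkQ = K := map_inf_comap_mkQ hX K
    refine ⟨H, (hF.mem_solutions_total_iff hB hh' hhH inf_le_left).2 (by rwa [hHK]),
      Prod.ext ?_ hHK⟩
    have h1 : H ⊓ baseSpace b F = h := inf_eq_of_le hXV hhH inf_le_left
    apply Submodule.map_injective_of_injective (baseSpace b F).injective_subtype
    rw [hF.map_subtype_comap_subtype h1]

end IsGeneric

end Generic

/-! ### General position as the nonvanishing of polynomials -/

section GoodFrames

variable {E : Type*} [AddCommGroup E] [Module ℂ E] [FiniteDimensional ℂ E] {m : ℕ}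

/-- The matrix of the composite of the inclusion of the second distinguished space `C` and the
projection from the first one `A`. -/
def crossMatrix (b : ℕ) (e : Frames (4 + m) E) : Matrix (Fin b) (Fin b) ℂ :=
  Matrix.of fun k l => frameCoord (e (Fin.castAdd m 0)) (4 + k) (frameVec (e (Fin.castAdd m 1)) l)

/-- The projection from `A` to `C`, multiplied by the determinant of `crossMatrix`. -/
def projC (b : ℕ) (e : Frames (4 + m) E) : E →ₗ[ℂ] E :=
  ∑ l, ∑ k, (crossMatrix b e).adjugate l k •
    (frameCoord (e (Fin.castAdd m 0)) (4 + k)).smulRight (frameVec (e (Fin.castAdd m 1)) l)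

/-- The projection from `C` to `A`, multiplied by the determinant of `crossMatrix`. -/
def projA (b : ℕ) (e : Frames (4 + m) E) : E →ₗ[ℂ] E :=
  (crossMatrix b e).det • LinearMap.id - projC b e

/-- A minor of the coordinates of two vectors. -/
def coordMinor (e : Basis (Fin (finrank ℂ E)) ℂ E) (j k : ℕ) (x z : E) : ℂ :=
  frameCoord e j x * frameCoord e k z - frameCoord e k x * frameCoord e j z

/-- The point of the third distinguished space `B` with coordinates `s`, `t`. -/
def pointB (e : Frames (4 + m) E) (s t : ℂ) : E :=
  s • frameVec (e (Fin.castAdd m 2)) 0 + t • frameVec (e (Fin.castAdd m 2)) 1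

/-- The linear form that vanishes on `D` and the projection of `pointB e s t` to `A`. -/
def normalForm (b : ℕ) (e : Frames (4 + m) E) (s t : ℂ) (x : E) : ℂ :=
  coordMinor (e (Fin.castAdd m 3)) (b + 2) (b + 3) (projA b e (pointB e s t)) x

/-- The quadratic form whose zeros are the solutions of the base problem. -/
def baseForm (b : ℕ) (e : Frames (4 + m) E) (s t : ℂ) : ℂ :=
  normalForm b e s t (projC b e (pointB e s t))

/-- The determinant that decides whether `z₁` and `z₂` span a complement of `X_h`. -/
def spanForm (b : ℕ) (e : Frames (4 + m) E) (s t : ℂ) (z₁ z₂ : E) : ℂ :=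
  normalForm b e s t (projA b e z₁) * normalForm b e s t (projC b e z₂) -
    normalForm b e s t (projA b e z₂) * normalForm b e s t (projC b e z₁)

/-- The set where the forms `q` and `q'` have no common zero. -/
def noCommonZero {s : ℕ} (q q' : Frames s E → ℂ → ℂ → ℂ) : Set (Frames s E) :=
  {e | ∀ s t : ℂ, (s ≠ 0 ∨ t ≠ 0) → q e s t = 0 → q' e s t ≠ 0}

/-- The tuples of bases whose flags are in general position, by way of the nonvanishing of certain
polynomials. -/
structure IsGood (b : ℕ) (e : Frames (4 + m) E) : Prop where
  det_ne : (crossMatrix b e).det ≠ 0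
  projA_ne : e ∈ noCommonZero
    (fun e s t => frameCoord (e (Fin.castAdd m 3)) (b + 2) (projA b e (pointB e s t)) *
      frameCoord (e (Fin.castAdd m 3)) (b + 2) (projA b e (pointB e s t)))
    (fun e s t => frameCoord (e (Fin.castAdd m 3)) (b + 3) (projA b e (pointB e s t)) *
      frameCoord (e (Fin.castAdd m 3)) (b + 3) (projA b e (pointB e s t)))
  projC_ne : e ∈ noCommonZero
    (fun e s t => frameCoord (e (Fin.castAdd m 3)) (b + 2) (projC b e (pointB e s t)) *
      frameCoord (e (Fin.castAdd m 3)) (b + 2) (projC b e (pointB e s t)))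
    (fun e s t => frameCoord (e (Fin.castAdd m 3)) (b + 3) (projC b e (pointB e s t)) *
      frameCoord (e (Fin.castAdd m 3)) (b + 3) (projC b e (pointB e s t)))
  first_ne : e ∈ noCommonZero (baseForm b) fun e s t =>
    normalForm b e s t (projC b e (frameVec (e (Fin.castAdd m 0)) 4)) *
      frameCoord (e (Fin.castAdd m 0)) (b + 3) (projC b e (pointB e s t))
  second_ne : e ∈ noCommonZero (baseForm b) fun e s t =>
    normalForm b e s t (frameVec (e (Fin.castAdd m 1)) 0) *
      frameCoord (e (Fin.castAdd m 1)) (b - 1) (projC b e (pointB e s t))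
  third_fourth_ne : e ∈ noCommonZero (baseForm b) fun e s t =>
    normalForm b e s t (projA b e (frameVec (e (Fin.castAdd m 3)) 0)) *
      frameCoord (e (Fin.castAdd m 2)) (b + 3) (projA b e (pointB e s t))
  third_ne : e ∈ noCommonZero (baseForm b) fun e s t =>
    spanForm b e s t (pointB e 1 1) (frameVec (e (Fin.castAdd m 2)) 2)
  fourth_ne : e ∈ noCommonZero (baseForm b) fun e s t =>
    coordMinor (e (Fin.castAdd m 3)) (b + 1) (b + 2) (projA b e (pointB e s t))
      (projC b e (pointB e s t))
  span_ne : ∀ j, e ∈ noCommonZero (baseForm b) fun e s t =>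
    spanForm b e s t (frameVec (e (Fin.natAdd 4 j)) 0) (frameVec (e (Fin.natAdd 4 j)) 1)
  minor_ne : ∀ j, e ∈ noCommonZero (baseForm b) fun e s t =>
    coordMinor (e (Fin.natAdd 4 j)) (b + 2) (b + 3) (projA b e (pointB e s t))
      (projC b e (pointB e s t))

section Projections

variable {b : ℕ} {e : Frames (4 + m) E}

theorem projC_apply (x : E) : projC b e x = ∑ l : Fin b,
    ((crossMatrix b e).adjugate.mulVec
      fun k => frameCoord (e (Fin.castAdd m 0)) (4 + k) x) l • frameVec (e (Fin.castAdd m 1)) l := by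
  simp [projC, Matrix.mulVec, dotProduct, Finset.sum_smul, mul_smul]

theorem projC_mem (x : E) :
    projC b e x ∈ (CompleteFlag.ofBasis (e (Fin.castAdd m 1))).space b := by
  rw [projC_apply]
  exact Submodule.sum_mem _ fun l _ => Submodule.smul_mem _ _ (frameVec_mem l.2)

/-- This is the identity `M * adjugate M = det M • 1` read in coordinates. The coordinates of index
at least 4 cut out `A`, so `projC` is the determinant times the projection along `A`. -/
theorem frameCoord_projC (hE : finrank ℂ E = b + 4) (x : E) {k : ℕ} (hk : 4 ≤ k) :
    frameCoord (e (Fin.castAdd m 0)) k (projC b e x) =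
      (crossMatrix b e).det * frameCoord (e (Fin.castAdd m 0)) k x := by
  by_cases hk' : k < b + 4
  · obtain ⟨k, rfl⟩ := Nat.exists_eq_add_of_le hk
    have h := congrFun (congrArg (fun M : Matrix (Fin b) (Fin b) ℂ => M.mulVec
      fun k => frameCoord (e (Fin.castAdd m 0)) (4 + k) x)
      (crossMatrix b e).mul_adjugate) ⟨k, by omega⟩
    simp only [← Matrix.mulVec_mulVec, Matrix.smul_mulVec, Matrix.one_mulVec] at h
    rw [projC_apply, map_sum]
    simp only [map_smul, smul_eq_mul]
    simpa [Matrix.mulVec, dotProduct, crossMatrix, mul_comm] using h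
  · simp [frameCoord, hE, hk']

theorem projA_mem (hE : finrank ℂ E = b + 4) (x : E) :
    projA b e x ∈ (CompleteFlag.ofBasis (e (Fin.castAdd m 0))).space 4 := by
  rw [mem_ofBasis_space]
  intro k hk
  simp [projA, frameCoord_projC hE x hk]

theorem projA_add_projC (x : E) : projA b e x + projC b e x = (crossMatrix b e).det • x := by
  simp [projA]

theorem crossMatrix_mulVec (c : Fin b → ℂ) (k : Fin b) :
    (crossMatrix b e).mulVec c k = frameCoord (e (Fin.castAdd m 0)) (4 + k)
      (∑ l, c l • frameVec (e (Fin.castAdd m 1)) l) := by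
  simp [Matrix.mulVec, dotProduct, crossMatrix, mul_comm]

/-- The matrix represents `C → E/A` in the given bases, and the kernel of this map is `A ⊓ C`. -/
theorem det_crossMatrix_ne_zero_iff (hE : finrank ℂ E = b + 4) :
    (crossMatrix b e).det ≠ 0 ↔ (CompleteFlag.ofBasis (e (Fin.castAdd m 0))).space 4 ⊓
      (CompleteFlag.ofBasis (e (Fin.castAdd m 1))).space b = ⊥ := by
  constructor
  · intro hdet
    rw [Submodule.eq_bot_iff]
    rintro x ⟨hA, hC⟩
    rw [SetLike.mem_coe, mem_ofBasis_space] at hA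
    rw [SetLike.mem_coe, mem_ofBasis_space_iff_sum, ← Fin.sum_univ_eq_sum_range
      (fun k => frameCoord (e (Fin.castAdd m 1)) k x • frameVec (e (Fin.castAdd m 1)) k)] at hC
    have h : (crossMatrix b e).mulVec (fun l => frameCoord (e (Fin.castAdd m 1)) l x) = 0 := by
      funext k
      rw [crossMatrix_mulVec, ← hC, hA _ (by omega)]
      rfl
    have h2 := Matrix.eq_zero_of_mulVec_eq_zero hdet h
    rw [hC]
    exact Finset.sum_eq_zero fun l _ => by rw [congrFun h2 l]; simp
  · intro h hdet
    obtain ⟨c, hc, hM⟩ := Matrix.exists_mulVec_eq_zero_iff.2 hdet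
    have hx : ∑ l : Fin b, c l • frameVec (e (Fin.castAdd m 1)) l ∈
        (CompleteFlag.ofBasis (e (Fin.castAdd m 0))).space 4 ⊓
          (CompleteFlag.ofBasis (e (Fin.castAdd m 1))).space b := by
      refine ⟨?_, Submodule.sum_mem _ fun l _ => Submodule.smul_mem _ _ (frameVec_mem l.2)⟩
      rw [SetLike.mem_coe, mem_ofBasis_space]
      intro k hk
      by_cases hk' : k < b + 4
      · obtain ⟨k, rfl⟩ := Nat.exists_eq_add_of_le hk
        have := congrFun hM ⟨k, by omega⟩
        rwa [crossMatrix_mulVec] at this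
      · simp [frameCoord, hE, hk']
    rw [h, Submodule.mem_bot] at hx
    apply hc
    funext l
    have := congrArg (frameCoord (e (Fin.castAdd m 1)) l) hx
    simpa [frameCoord_frameVec, Fin.val_inj, hE, show (l : ℕ) < b + 4 by omega] using this

theorem proj_of_add (hE : finrank ℂ E = b + 4) (hdet : (crossMatrix b e).det ≠ 0) {p w : E}
    (hp : p ∈ (CompleteFlag.ofBasis (e (Fin.castAdd m 0))).space 4)
    (hw : w ∈ (CompleteFlag.ofBasis (e (Fin.castAdd m 1))).space b) :
    projA b e (p + w) = (crossMatrix b e).det • p ∧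
      projC b e (p + w) = (crossMatrix b e).det • w :=
  eq_and_eq_of_add_eq_add ((det_crossMatrix_ne_zero_iff hE).1 hdet) (projA_mem hE _)
    (Submodule.smul_mem _ _ hp) (projC_mem _) (Submodule.smul_mem _ _ hw)
    (by rw [projA_add_projC, smul_add])

end Projections

theorem mem_ofBasis_space_two {e : Basis (Fin (finrank ℂ E)) ℂ E} {y : E} :
    y ∈ (CompleteFlag.ofBasis e).space 2 ↔ ∃ s t : ℂ, y = s • frameVec e 0 + t • frameVec e 1 := by
  constructor
  · intro h
    rw [mem_ofBasis_space_iff_sum, Finset.sum_range_succ, Finset.sum_range_one] at h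
    exact ⟨_, _, h⟩
  · rintro ⟨s, t, rfl⟩
    exact add_mem (Submodule.smul_mem _ _ (frameVec_mem (by omega)))
      (Submodule.smul_mem _ _ (frameVec_mem (by omega)))

section Profiles

/-- Passing from `F_lo` to `F_t` adds at most `t - lo` to the intersection with `X`, so an upper
bound at `lo` suffices. The intersections with `h` grow with `t`, so bounds at the two ends suffice.
-/
theorem hasProfile_of_bounds {F : CompleteFlag E} {X h : Submodule ℂ E} {lo hi d r : ℕ}
    (hhi : hi ≤ finrank ℂ E)
    (hlow : ∀ t, lo ≤ t → t ≤ hi → t ≤ finrank ℂ ↥(F.space t ⊓ X) + d)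
    (hup : finrank ℂ ↥(F.space lo ⊓ X) + d ≤ lo) (hr : r ≤ finrank ℂ ↥(F.space lo ⊓ h))
    (hr' : finrank ℂ ↥(F.space hi ⊓ h) ≤ r) : HasProfile F X h lo hi d r := fun t h1 h2 => by
  have e1 := finrank_inf_add_le (F.mono h1) X
  have e2 : finrank ℂ ↥(F.space lo ⊓ h) ≤ finrank ℂ ↥(F.space t ⊓ h) :=
    Submodule.finrank_mono (inf_le_inf_right _ (F.mono h1))
  have e3 : finrank ℂ ↥(F.space t ⊓ h) ≤ finrank ℂ ↥(F.space hi ⊓ h) :=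
    Submodule.finrank_mono (inf_le_inf_right _ (F.mono h2))
  have e4 := hlow t h1 h2
  rw [F.finrank_space, F.finrank_space] at e1
  omega

theorem finrank_inf_le_of_notMem {S h : Submodule ℂ E} {x : E} {r : ℕ} (hh : finrank ℂ h = r + 1)
    (hx : x ∈ h) (hxS : x ∉ S) : finrank ℂ ↥(S ⊓ h) ≤ r := by
  have h1 : S ⊓ h < h := lt_of_le_of_ne inf_le_right fun heq => hxS (inf_eq_right.1 heq hx)
  have := Submodule.finrank_lt_finrank_of_lt h1
  omega

end Profiles

namespace IsGood

variable {b : ℕ} {e : Frames (4 + m) E} (he : IsGood b e) (hb : 2 ≤ b)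
  (hE : finrank ℂ E = b + 4)

include he hE

/-- The coordinates `b + 2` and `b + 3` of the fourth basis cut out `D`. The fields `projA_ne` and
`projC_ne` say that they never both vanish on a component of a nonzero vector of `B`. The linear
forms are squared there only to fit the resultant of quadratic forms. -/
theorem isTransverse : IsTransverse b (spaceA fun i => CompleteFlag.ofBasis (e i))
    (spaceC b fun i => CompleteFlag.ofBasis (e i)) (spaceB fun i => CompleteFlag.ofBasis (e i))
    (spaceD b fun i => CompleteFlag.ofBasis (e i)) where
  finrank_total := hE
  finrank_A := by rw [spaceA, CompleteFlag.finrank_space]; omega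
  finrank_C := by rw [spaceC, CompleteFlag.finrank_space]; omega
  finrank_B := by rw [spaceB, CompleteFlag.finrank_space]; omega
  finrank_D := by rw [spaceD, CompleteFlag.finrank_space]; omega
  inf_eq_bot := (det_crossMatrix_ne_zero_iff hE).1 he.det_ne
  proj_notMem p hp w hw hy h0 := by
    obtain ⟨h1, h2⟩ := proj_of_add hE he.det_ne hp hw
    obtain ⟨s, t, hst⟩ := mem_ofBasis_space_two.1 hy
    have hst0 : s ≠ 0 ∨ t ≠ 0 := by
      by_contra! hcon
      exact h0 (by rw [hst, hcon.1, hcon.2]; simp)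
    have hpt : p + w = pointB e s t := hst
    rw [hpt] at h1 h2
    have hA := he.projA_ne s t hst0
    have hC := he.projC_ne s t hst0
    simp only [h1, h2, map_smul] at hA hC
    refine ⟨fun hD => ?_, fun hD => ?_⟩
    · have hD' := mem_ofBasis_space.1 hD
      exact hA (by rw [hD' _ le_rfl]; simp) (by rw [hD' _ (by omega)]; simp)
    · have hD' := mem_ofBasis_space.1 hD
      exact hC (by rw [hD' _ le_rfl]; simp) (by rw [hD' _ (by omega)]; simp)

/-- As `⟨p, w⟩` meets `D`, the vectors `p` and `w` are dependent modulo `D`. Their minor in the two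
coordinates that cut out `D` is `baseForm`, up to the square of the determinant. -/
theorem exists_pointB {h : Submodule ℂ E}
    (hh : IsBaseSolution b (fun i => CompleteFlag.ofBasis (e i)) h) :
    ∃ s t : ℂ, (s ≠ 0 ∨ t ≠ 0) ∧ baseForm b e s t = 0 ∧
      h = Submodule.span ℂ {projA b e (pointB e s t)} ⊔
        Submodule.span ℂ {projC b e (pointB e s t)} := by
  obtain ⟨p, hp, w, hw, hy, h0, rfl, hD⟩ := hh
  obtain ⟨h1, h2⟩ := proj_of_add hE he.det_ne hp hw
  obtain ⟨s, t, hst⟩ := mem_ofBasis_space_two.1 hy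
  have hst0 : s ≠ 0 ∨ t ≠ 0 := by
    by_contra! hcon
    exact h0 (by rw [hst, hcon.1, hcon.2]; simp)
  have hpt : p + w = pointB e s t := hst
  rw [hpt] at h1 h2
  refine ⟨s, t, hst0, ?_, ?_⟩
  · obtain ⟨x, ⟨hx, hxD⟩, hx0⟩ := Submodule.exists_mem_ne_zero_of_ne_bot hD
    obtain ⟨_, hα, _, hβ, rfl⟩ := Submodule.mem_sup.1 hx
    obtain ⟨α, rfl⟩ := Submodule.mem_span_singleton.1 hα
    obtain ⟨β, rfl⟩ := Submodule.mem_span_singleton.1 hβ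
    have hD' := mem_ofBasis_space.1 hxD
    have e1 := hD' _ le_rfl
    have e2 := hD' (b + 3) (by omega)
    simp only [map_add, map_smul, smul_eq_mul] at e1 e2
    simp only [baseForm, normalForm, coordMinor, h1, h2, map_smul, smul_eq_mul]
    set P2 := frameCoord (e (Fin.castAdd m 3)) (b + 2) p
    set P3 := frameCoord (e (Fin.castAdd m 3)) (b + 3) p
    set W2 := frameCoord (e (Fin.castAdd m 3)) (b + 2) w
    set W3 := frameCoord (e (Fin.castAdd m 3)) (b + 3) w
    by_cases hα0 : α = 0
    · have hβ0 : β ≠ 0 := by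
        rintro rfl
        exact hx0 (by simp [hα0])
      apply mul_left_cancel₀ hβ0
      linear_combination (crossMatrix b e).det ^ 2 * (P2 * e2 - P3 * e1)
    · apply mul_left_cancel₀ hα0
      linear_combination (crossMatrix b e).det ^ 2 * (W3 * e1 - W2 * e2)
  · rw [h1, h2, Submodule.span_singleton_smul_eq (IsUnit.mk0 _ he.det_ne),
      Submodule.span_singleton_smul_eq (IsUnit.mk0 _ he.det_ne)]

end IsGood

end GoodFrames

/-! ### Good tuples of bases define generic flags -/

section GoodFramesAreGeneric

variable {E : Type*} [AddCommGroup E] [Module ℂ E] [FiniteDimensional ℂ E] {m : ℕ}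

theorem coordMinor_add (e : Basis (Fin (finrank ℂ E)) ℂ E) (j k : ℕ) (x y z : E) :
    coordMinor e j k x (y + z) = coordMinor e j k x y + coordMinor e j k x z := by
  simp only [coordMinor, map_add]; ring

theorem coordMinor_smul (e : Basis (Fin (finrank ℂ E)) ℂ E) (j k : ℕ) (x y : E) (c : ℂ) :
    coordMinor e j k x (c • y) = c * coordMinor e j k x y := by
  simp only [coordMinor, map_smul, smul_eq_mul]; ring

theorem coordMinor_self (e : Basis (Fin (finrank ℂ E)) ℂ E) (j k : ℕ) (x : E) :
    coordMinor e j k x x = 0 := by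
  simp only [coordMinor]; ring

theorem inf_span_eq_bot_of_coordMinor_ne_zero {e : Basis (Fin (finrank ℂ E)) ℂ E} {j k t : ℕ}
    (hj : t ≤ j) (hk : t ≤ k) {x z : E} (h : coordMinor e j k x z ≠ 0) :
    (CompleteFlag.ofBasis e).space t ⊓ (Submodule.span ℂ {x} ⊔ Submodule.span ℂ {z}) = ⊥ := by
  rw [Submodule.eq_bot_iff]
  rintro y ⟨hy, hs⟩
  obtain ⟨_, hα, _, hβ, rfl⟩ := Submodule.mem_sup.1 hs
  obtain ⟨α, rfl⟩ := Submodule.mem_span_singleton.1 hα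
  obtain ⟨β, rfl⟩ := Submodule.mem_span_singleton.1 hβ
  have hD := mem_ofBasis_space.1 hy
  have e1 := hD j hj
  have e2 := hD k hk
  simp only [map_add, map_smul, smul_eq_mul] at e1 e2
  unfold coordMinor at h
  have hα0 : α = 0 := by
    apply mul_left_cancel₀ h
    linear_combination frameCoord e k z * e1 - frameCoord e j z * e2
  have hβ0 : β = 0 := by
    apply mul_left_cancel₀ h
    linear_combination frameCoord e j x * e2 - frameCoord e k x * e1
  simp [hα0, hβ0]

theorem pointB_mem (e : Frames (4 + m) E) (s t : ℂ) :
    pointB e s t ∈ (CompleteFlag.ofBasis (e (Fin.castAdd m 2))).space 2 :=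
  mem_ofBasis_space_two.2 ⟨s, t, rfl⟩

namespace IsGood

variable {b : ℕ} {e : Frames (4 + m) E} {s t : ℂ} {h : Submodule ℂ E}

/-- The form kills `D` and the projection to `A` by construction, and the projection to `C` because
`baseForm` vanishes. -/
theorem normalForm_eq_zero_of_mem (hq : baseForm b e s t = 0)
    (hspan : h = Submodule.span ℂ {projA b e (pointB e s t)} ⊔
      Submodule.span ℂ {projC b e (pointB e s t)}) {x : E}
    (hx : x ∈ spaceD b (fun i => CompleteFlag.ofBasis (e i)) ⊔ h) : normalForm b e s t x = 0 := by
  obtain ⟨d, hd, y, hy, rfl⟩ := Submodule.mem_sup.1 hx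
  rw [hspan] at hy
  obtain ⟨_, hα, _, hβ, rfl⟩ := Submodule.mem_sup.1 hy
  obtain ⟨α, rfl⟩ := Submodule.mem_span_singleton.1 hα
  obtain ⟨β, rfl⟩ := Submodule.mem_span_singleton.1 hβ
  have hD := mem_ofBasis_space.1 hd
  have h1 : coordMinor (e (Fin.castAdd m 3)) (b + 2) (b + 3) (projA b e (pointB e s t)) d = 0 := by
    rw [coordMinor, hD _ le_rfl, hD _ (by omega)]; ring
  unfold baseForm normalForm at hq
  rw [normalForm, coordMinor_add, coordMinor_add, coordMinor_smul, coordMinor_smul,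
    coordMinor_self, hq, h1]
  ring

theorem normalForm_proj_eq_zero_of_mem (he : IsGood b e) (hE : finrank ℂ E = b + 4)
    (hq : baseForm b e s t = 0)
    (hspan : h = Submodule.span ℂ {projA b e (pointB e s t)} ⊔
      Submodule.span ℂ {projC b e (pointB e s t)}) {x : E}
    (hx : x ∈ solutionSpan b (fun i => CompleteFlag.ofBasis (e i)) h) :
    normalForm b e s t (projA b e x) = 0 ∧ normalForm b e s t (projC b e x) = 0 := by
  obtain ⟨a, ha, c, hc, rfl⟩ := Submodule.mem_sup.1 hx
  obtain ⟨h1, h2⟩ := proj_of_add hE he.det_ne ha.1 hc.1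
  rw [h1, h2]
  exact ⟨normalForm_eq_zero_of_mem hq hspan (Submodule.smul_mem _ _ ha.2),
    normalForm_eq_zero_of_mem hq hspan (Submodule.smul_mem _ _ hc.2)⟩

theorem normalForm_add (x y : E) :
    normalForm b e s t (x + y) = normalForm b e s t x + normalForm b e s t y :=
  coordMinor_add _ _ _ _ _ _

theorem normalForm_smul (c : ℂ) (x : E) :
    normalForm b e s t (c • x) = c * normalForm b e s t x :=
  coordMinor_smul _ _ _ _ _ _

/-- On `X_h` the two linear forms `normalForm ∘ projA` and `normalForm ∘ projC` vanish. `spanForm`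
is the determinant of their values at `z₁` and `z₂`, so these vectors are independent modulo `X_h`.
-/
theorem finrank_inf_solutionSpan_add_two_le (he : IsGood b e) (hE : finrank ℂ E = b + 4)
    (hq : baseForm b e s t = 0)
    (hspan : h = Submodule.span ℂ {projA b e (pointB e s t)} ⊔
      Submodule.span ℂ {projC b e (pointB e s t)}) {Y : Submodule ℂ E} {z₁ z₂ : E} (h1 : z₁ ∈ Y)
    (h2 : z₂ ∈ Y) (hz : spanForm b e s t z₁ z₂ ≠ 0) :
    finrank ℂ ↥(Y ⊓ solutionSpan b (fun i => CompleteFlag.ofBasis (e i)) h) + 2 ≤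
      finrank ℂ Y := by
  set X := solutionSpan b (fun i => CompleteFlag.ofBasis (e i)) h with hX
  have key (α β : ℂ) (hx : α • z₁ + β • z₂ ∈ X) : α = 0 ∧ β = 0 := by
    obtain ⟨e1, e2⟩ := normalForm_proj_eq_zero_of_mem he hE hq hspan hx
    simp only [map_add, map_smul, normalForm_add, normalForm_smul] at e1 e2
    unfold spanForm at hz
    constructor
    · apply mul_left_cancel₀ hz
      linear_combination normalForm b e s t (projC b e z₂) * e1 -
        normalForm b e s t (projA b e z₂) * e2
    · apply mul_left_cancel₀ hz
      linear_combination normalForm b e s t (projA b e z₁) * e2 -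
        normalForm b e s t (projC b e z₁) * e1
  have hli : LinearIndependent ℂ ![z₁, z₂] := by
    rw [LinearIndependent.pair_iff]
    exact fun α β h0 => key α β (by rw [h0]; exact X.zero_mem)
  have hfin : finrank ℂ (Submodule.span ℂ (Set.range ![z₁, z₂])) = 2 := by
    simpa using finrank_span_eq_card hli
  have hbot : Y ⊓ X ⊓ Submodule.span ℂ (Set.range ![z₁, z₂]) = ⊥ := by
    rw [Submodule.eq_bot_iff]
    rintro x ⟨hx, hs⟩
    rw [SetLike.mem_coe, Matrix.range_cons_cons_empty, Submodule.mem_span_pair] at hs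
    obtain ⟨α, β, rfl⟩ := hs
    obtain ⟨rfl, rfl⟩ := key α β hx.2
    simp
  have hle : Y ⊓ X ⊔ Submodule.span ℂ (Set.range ![z₁, z₂]) ≤ Y := by
    refine sup_le inf_le_left (Submodule.span_le.2 ?_)
    rw [Matrix.range_cons_cons_empty]
    rintro x (rfl | rfl) <;> assumption
  have := Submodule.finrank_mono hle
  rw [finrank_sup_of_inf_eq_bot hbot, hfin] at this
  exact this

theorem le_finrank_inf_solutionSpan (T : IsTransverse b (spaceA fun i => CompleteFlag.ofBasis (e i))
    (spaceC b fun i => CompleteFlag.ofBasis (e i)) (spaceB fun i => CompleteFlag.ofBasis (e i))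
    (spaceD b fun i => CompleteFlag.ofBasis (e i)))
    (hh : IsBaseSolution b (fun i => CompleteFlag.ofBasis (e i)) h) (F : CompleteFlag E) {k : ℕ}
    (hk : k ≤ b + 4) :
    k ≤ finrank ℂ ↥(F.space k ⊓ solutionSpan b (fun i => CompleteFlag.ofBasis (e i)) h) + 2 := by
  have := finrank_add_le_finrank_inf (F.space k)
    (solutionSpan b (fun i => CompleteFlag.ofBasis (e i)) h)
  rw [F.finrank_space, T.finrank_total, solutionSpan, T.finrank_liftSpace hh] at this
  rw [solutionSpan]
  omega

variable (he : IsGood b e) (hb : 2 ≤ b) (hE : finrank ℂ E = b + 4)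

include he hE

/-- The vector that `F_5` adds to `A` has its component in `C` outside `D ⊔ h`, so `F_5 ⊓ X = A ⊓
X`, of dimension 3. The plane `h` meets `A`, but its vector in `C` is outside even `F_{b+3}`. -/
theorem hasProfile₁ (hh : IsBaseSolution b (fun i => CompleteFlag.ofBasis (e i)) h) :
    HasProfile (CompleteFlag.ofBasis (e (Fin.castAdd m 0)))
      (solutionSpan b (fun i => CompleteFlag.ofBasis (e i)) h) h 5 (b + 2) 2 1 := by
  have T := he.isTransverse hE
  obtain ⟨s, t, hst, hq, hspan⟩ := he.exists_pointB hE hh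
  have hne := he.first_ne s t hst hq
  have h2 := T.finrank_eq_two hh
  refine hasProfile_of_bounds (by omega)
    (fun k _ hk => le_finrank_inf_solutionSpan T hh _ (by omega)) ?_ ?_ ?_
  · have hle : (CompleteFlag.ofBasis (e (Fin.castAdd m 0))).space 5 ⊓
        solutionSpan b (fun i => CompleteFlag.ofBasis (e i)) h ≤
        liftSpace (spaceA fun i => CompleteFlag.ofBasis (e i))
          (spaceC b fun i => CompleteFlag.ofBasis (e i))
          (spaceD b fun i => CompleteFlag.ofBasis (e i)) h ⊓
            (spaceA fun i => CompleteFlag.ofBasis (e i)) := by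
      rintro x ⟨hx, hX⟩
      refine ⟨hX, ?_⟩
      have hsum := mem_ofBasis_space_iff_sum.1 hx
      rw [Finset.sum_range_succ] at hsum
      have hA : ∑ k ∈ Finset.range 4, frameCoord (e (Fin.castAdd m 0)) k x •
          frameVec (e (Fin.castAdd m 0)) k ∈
          (CompleteFlag.ofBasis (e (Fin.castAdd m 0))).space 4 :=
        Submodule.sum_mem _ fun k hk => Submodule.smul_mem _ _ (frameVec_mem (by simpa using hk))
      have hproj := (normalForm_proj_eq_zero_of_mem he hE hq hspan hX).2
      have hA0 := (proj_of_add hE he.det_ne hA (Submodule.zero_mem _)).2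
      rw [add_zero, smul_zero] at hA0
      rw [hsum, map_add, hA0, zero_add, map_smul, normalForm_smul, mul_eq_zero] at hproj
      rw [hsum, hproj.resolve_right (left_ne_zero_of_mul hne), zero_smul, add_zero]
      exact hA
    have := Submodule.finrank_mono hle
    rw [T.liftSpace_inf_A hh, T.finrank_A_inf hh] at this
    omega
  · rw [inf_comm]
    refine (T.one_le_finrank_inf hh).1.trans (Submodule.finrank_mono (inf_le_inf_left _ ?_))
    exact CompleteFlag.mono _ (by omega)
  · refine finrank_inf_le_of_notMem h2 (x := projC b e (pointB e s t)) ?_ fun hmem => ?_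
    · rw [hspan]
      exact Submodule.mem_sup_right (Submodule.mem_span_singleton_self _)
    · exact right_ne_zero_of_mul hne (mem_ofBasis_space.1 hmem _ (by omega))

include hb in
-- Within `C` the space `X_h` is cut out by the hyperplane `D ⊔ h` alone, so the codimension is 1,
-- and `F_1` is not in this hyperplane. Vectors of `h` in `C` are multiples of the projection of a
-- point of `B`, which is outside `F_{b-1}`.
theorem hasProfile₂ (hh : IsBaseSolution b (fun i => CompleteFlag.ofBasis (e i)) h) :
    HasProfile (CompleteFlag.ofBasis (e (Fin.castAdd m 1)))
      (solutionSpan b (fun i => CompleteFlag.ofBasis (e i)) h) h 1 (b - 1) 1 0 := by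
  have T := he.isTransverse hE
  obtain ⟨s, t, hst, hq, hspan⟩ := he.exists_pointB hE hh
  have hne := he.second_ne s t hst hq
  refine hasProfile_of_bounds (by omega) (fun k _ hk => ?_) ?_ (Nat.zero_le _) ?_
  · have hle : (CompleteFlag.ofBasis (e (Fin.castAdd m 1))).space k ≤
      spaceC b fun i => CompleteFlag.ofBasis (e i) := CompleteFlag.mono _ (by omega)
    have h1 := finrank_inf_add_le hle ((spaceD b fun i => CompleteFlag.ofBasis (e i)) ⊔ h)
    have h2 := T.finrank_C_inf hh
    have h3 : finrank ℂ ↥((CompleteFlag.ofBasis (e (Fin.castAdd m 1))).space k ⊓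
        ((spaceD b fun i => CompleteFlag.ofBasis (e i)) ⊔ h)) ≤
        finrank ℂ ↥((CompleteFlag.ofBasis (e (Fin.castAdd m 1))).space k ⊓
          solutionSpan b (fun i => CompleteFlag.ofBasis (e i)) h) :=
      Submodule.finrank_mono (le_inf inf_le_left
        ((inf_le_inf_right _ hle).trans le_sup_right))
    rw [CompleteFlag.finrank_space, T.finrank_C] at h1
    omega
  · have hbot : (CompleteFlag.ofBasis (e (Fin.castAdd m 1))).space 1 ⊓
        solutionSpan b (fun i => CompleteFlag.ofBasis (e i)) h = ⊥ := by
      rw [Submodule.eq_bot_iff]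
      rintro x ⟨hx, hX⟩
      have hsum := mem_ofBasis_space_iff_sum.1 hx
      rw [Finset.sum_range_one] at hsum
      have h0 := normalForm_eq_zero_of_mem hq hspan (IsTransverse.liftSpace_le hX)
      rw [hsum, normalForm_smul, mul_eq_zero] at h0
      rw [hsum, h0.resolve_right (left_ne_zero_of_mul hne), zero_smul]
    rw [hbot, finrank_bot]
  · have hbot : (CompleteFlag.ofBasis (e (Fin.castAdd m 1))).space (b - 1) ⊓ h = ⊥ := by
      rw [Submodule.eq_bot_iff]
      rintro x ⟨hx, hxh⟩
      rw [SetLike.mem_coe, hspan] at hxh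
      obtain ⟨_, hα, _, hβ, rfl⟩ := Submodule.mem_sup.1 hxh
      obtain ⟨α, rfl⟩ := Submodule.mem_span_singleton.1 hα
      obtain ⟨β, rfl⟩ := Submodule.mem_span_singleton.1 hβ
      have hC : α • projA b e (pointB e s t) + β • projC b e (pointB e s t) ∈
        (CompleteFlag.ofBasis (e (Fin.castAdd m 1))).space b := CompleteFlag.mono _ (by omega) hx
      obtain ⟨hα0, -⟩ := eq_and_eq_of_add_eq_add T.inf_eq_bot
        (Submodule.smul_mem _ α (projA_mem hE (pointB e s t))) (Submodule.zero_mem _)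
        (Submodule.smul_mem _ β (projC_mem (pointB e s t))) hC (zero_add _).symm
      have h0 := mem_ofBasis_space.1 hx _ le_rfl
      rw [hα0, zero_add, map_smul, smul_eq_mul, mul_eq_zero] at h0
      rw [hα0, h0.resolve_right (right_ne_zero_of_mul hne), zero_smul, add_zero]
    rw [hbot, finrank_bot]

theorem hasProfile₃ (hh : IsBaseSolution b (fun i => CompleteFlag.ofBasis (e i)) h) :
    HasProfile (CompleteFlag.ofBasis (e (Fin.castAdd m 2)))
      (solutionSpan b (fun i => CompleteFlag.ofBasis (e i)) h) h 3 (b + 2) 2 1 := by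
  have T := he.isTransverse hE
  obtain ⟨s, t, hst, hq, hspan⟩ := he.exists_pointB hE hh
  have h2 := T.finrank_eq_two hh
  refine hasProfile_of_bounds (by omega)
    (fun k _ hk => le_finrank_inf_solutionSpan T hh _ (by omega)) ?_ ?_ ?_
  · refine (finrank_inf_solutionSpan_add_two_le he hE hq hspan
      (CompleteFlag.mono _ (by omega) (pointB_mem e 1 1)) (frameVec_mem (by omega))
      (he.third_ne s t hst hq)).trans ?_
    rw [CompleteFlag.finrank_space]
    omega
  · rw [inf_comm]
    refine (T.one_le_finrank_inf hh).2.2.1.trans (Submodule.finrank_mono (inf_le_inf_left _ ?_))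
    exact CompleteFlag.mono _ (by omega)
  · refine finrank_inf_le_of_notMem h2 (x := projA b e (pointB e s t)) ?_ fun hmem => ?_
    · rw [hspan]
      exact Submodule.mem_sup_left (Submodule.mem_span_singleton_self _)
    · exact right_ne_zero_of_mul (he.third_fourth_ne s t hst hq)
        (mem_ofBasis_space.1 hmem _ (by omega))

/-- Both `D` and `X_h` lie in the hyperplane `D ⊔ h`, so `X_h` cuts `D` in codimension at most 1. To
see that `F_{b+1}` misses `h`, the minor of the coordinates `b + 1`, `b + 2` is used, as that of `b
+ 2`, `b + 3` is `baseForm` and vanishes. -/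
theorem hasProfile₄ (hh : IsBaseSolution b (fun i => CompleteFlag.ofBasis (e i)) h) :
    HasProfile (CompleteFlag.ofBasis (e (Fin.castAdd m 3)))
      (solutionSpan b (fun i => CompleteFlag.ofBasis (e i)) h) h 1 (b + 1) 1 0 := by
  have T := he.isTransverse hE
  obtain ⟨s, t, hst, hq, hspan⟩ := he.exists_pointB hE hh
  refine hasProfile_of_bounds (by omega) (fun k _ hk => ?_) ?_ (Nat.zero_le _) ?_
  · have hle : (CompleteFlag.ofBasis (e (Fin.castAdd m 3))).space k ≤
      spaceD b fun i => CompleteFlag.ofBasis (e i) := CompleteFlag.mono _ (by omega)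
    have h1 := finrank_inf_add_le hle (solutionSpan b (fun i => CompleteFlag.ofBasis (e i)) h)
    have h2 := Submodule.finrank_sup_add_finrank_inf_eq
      (spaceD b fun i => CompleteFlag.ofBasis (e i))
      (solutionSpan b (fun i => CompleteFlag.ofBasis (e i)) h)
    have h3 : finrank ℂ ↥((spaceD b fun i => CompleteFlag.ofBasis (e i)) ⊔
        solutionSpan b (fun i => CompleteFlag.ofBasis (e i)) h) ≤ b + 3 := by
      rw [← T.finrank_D_sup hh]
      exact Submodule.finrank_mono (sup_le le_sup_left IsTransverse.liftSpace_le)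
    have h4 : finrank ℂ (solutionSpan b (fun i => CompleteFlag.ofBasis (e i)) h) = b + 2 :=
      T.finrank_liftSpace hh
    rw [CompleteFlag.finrank_space, T.finrank_D] at h1
    rw [T.finrank_D] at h2
    omega
  · have hbot : (CompleteFlag.ofBasis (e (Fin.castAdd m 3))).space 1 ⊓
        solutionSpan b (fun i => CompleteFlag.ofBasis (e i)) h = ⊥ := by
      rw [Submodule.eq_bot_iff]
      rintro x ⟨hx, hX⟩
      have hsum := mem_ofBasis_space_iff_sum.1 hx
      rw [Finset.sum_range_one] at hsum
      have h0 := (normalForm_proj_eq_zero_of_mem he hE hq hspan hX).1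
      rw [hsum, map_smul, normalForm_smul, mul_eq_zero] at h0
      rw [hsum, h0.resolve_right (left_ne_zero_of_mul (he.third_fourth_ne s t hst hq)), zero_smul]
    rw [hbot, finrank_bot]
  · rw [hspan, inf_span_eq_bot_of_coordMinor_ne_zero le_rfl (by omega)
      (he.fourth_ne s t hst hq), finrank_bot]

theorem hasProfile (hh : IsBaseSolution b (fun i => CompleteFlag.ofBasis (e i)) h) (j : Fin m) :
    HasProfile (CompleteFlag.ofBasis (e (Fin.natAdd 4 j)))
      (solutionSpan b (fun i => CompleteFlag.ofBasis (e i)) h) h 2 (b + 2) 2 0 := by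
  have T := he.isTransverse hE
  obtain ⟨s, t, hst, hq, hspan⟩ := he.exists_pointB hE hh
  refine hasProfile_of_bounds (by omega)
    (fun k _ hk => le_finrank_inf_solutionSpan T hh _ (by omega)) ?_ (Nat.zero_le _) ?_
  · refine (finrank_inf_solutionSpan_add_two_le he hE hq hspan
      (frameVec_mem (by omega)) (frameVec_mem (by omega)) (he.span_ne j s t hst hq)).trans ?_
    rw [CompleteFlag.finrank_space]
    omega
  · rw [hspan, inf_span_eq_bot_of_coordMinor_ne_zero le_rfl (by omega)
      (he.minor_ne j s t hst hq), finrank_bot]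

include hb in
theorem isGeneric : IsGeneric b fun i => CompleteFlag.ofBasis (e i) where
  transverse := he.isTransverse hE
  profile₁ _ hh := he.hasProfile₁ hE hh
  profile₂ _ hh := he.hasProfile₂ hb hE hh
  profile₃ _ hh := he.hasProfile₃ hE hh
  profile₄ _ hh := he.hasProfile₄ hE hh
  profile _ hh j := he.hasProfile hE hh j

end IsGood

end GoodFramesAreGeneric

/-! ### Openness of the set of good tuples of bases -/

section Openness

variable {E : Type*} [AddCommGroup E] [Module ℂ E] [FiniteDimensional ℂ E]

/-- Families of binary linear forms with regular coefficients. -/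
def IsRegularLinear {n : ℕ} (ℓ : Frames n E → ℂ → ℂ → ℂ) : Prop :=
  ∃ f g : Frames n E → ℂ, IsRegularFun f ∧ IsRegularFun g ∧ ∀ e s t, ℓ e s t = s * f e + t * g e

/-- Families of binary quadratic forms with regular coefficients. -/
def IsRegularQuadratic {n : ℕ} (q : Frames n E → ℂ → ℂ → ℂ) : Prop :=
  ∃ f g h : Frames n E → ℂ, IsRegularFun f ∧ IsRegularFun g ∧ IsRegularFun h ∧
    ∀ e s t, q e s t = f e * s ^ 2 + g e * s * t + h e * t ^ 2

section

variable {n : ℕ} {ℓ ℓ' q q' : Frames n E → ℂ → ℂ → ℂ}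

theorem IsRegularLinear.mul (h : IsRegularLinear ℓ) (h' : IsRegularLinear ℓ') :
    IsRegularQuadratic fun e s t => ℓ e s t * ℓ' e s t := by
  obtain ⟨f, g, hf, hg, hℓ⟩ := h
  obtain ⟨f', g', hf', hg', hℓ'⟩ := h'
  refine ⟨_, _, _, hf.mul hf', (hf.mul hg').add (hg.mul hf'), hg.mul hg', fun e s t => ?_⟩
  simp only [hℓ, hℓ']; ring

theorem IsRegularLinear.sub (h : IsRegularLinear ℓ) (h' : IsRegularLinear ℓ') :
    IsRegularLinear fun e s t => ℓ e s t - ℓ' e s t := by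
  obtain ⟨f, g, hf, hg, hℓ⟩ := h
  obtain ⟨f', g', hf', hg', hℓ'⟩ := h'
  refine ⟨_, _, hf.sub hf', hg.sub hg', fun e s t => ?_⟩
  simp only [hℓ, hℓ']; ring

theorem IsRegularLinear.mul_fun (h : IsRegularLinear ℓ) {f : Frames n E → ℂ}
    (hf : IsRegularFun f) : IsRegularLinear fun e s t => ℓ e s t * f e := by
  obtain ⟨g, g', hg, hg', hℓ⟩ := h
  refine ⟨_, _, hg.mul hf, hg'.mul hf, fun e s t => ?_⟩
  simp only [hℓ]; ring

theorem IsRegularQuadratic.sub (h : IsRegularQuadratic q) (h' : IsRegularQuadratic q') :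
    IsRegularQuadratic fun e s t => q e s t - q' e s t := by
  obtain ⟨f, g, k, hf, hg, hk, hq⟩ := h
  obtain ⟨f', g', k', hf', hg', hk', hq'⟩ := h'
  refine ⟨_, _, _, hf.sub hf', hg.sub hg', hk.sub hk', fun e s t => ?_⟩
  simp only [hq, hq']; ring

/-- The resultant replaces the quantifier over `(s, t)` by one inequation in the coefficients. -/
theorem frameOpen_noCommonZero (h : IsRegularQuadratic q) (h' : IsRegularQuadratic q') :
    FrameOpen (noCommonZero q q') := by
  obtain ⟨f, g, k, hf, hg, hk, hq⟩ := h
  obtain ⟨f', g', k', hf', hg', hk', hq'⟩ := h'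
  have : noCommonZero q q' =
      {e | quadraticResultant (f e) (g e) (k e) (f' e) (g' e) (k' e) ≠ 0} := by
    ext e
    rw [Set.mem_ofPred_eq, quadraticResultant_ne_zero_iff, noCommonZero, Set.mem_ofPred_eq]
    simp only [hq, hq']
  rw [this]
  exact FrameOpen.of_ne ((((hf.mul hk').sub (hf'.mul hk)).pow 2).sub
    (((hf.mul hg').sub (hf'.mul hg)).mul ((hg.mul hk').sub (hg'.mul hk))))

end

variable {m : ℕ} (b : ℕ)

theorem isRegularFun_crossMatrix (k l : Fin b) :
    IsRegularFun fun e : Frames (4 + m) E => crossMatrix b e k l :=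
  (IsRegularVec.frameVec _ _).frameCoord _ _

theorem IsRegularVec.projC {v : Frames (4 + m) E → E} (hv : IsRegularVec v) :
    IsRegularVec fun e => projC b e (v e) := by
  simp only [_root_.projC, LinearMap.sum_apply, LinearMap.smul_apply, LinearMap.smulRight_apply]
  exact IsRegularVec.sum _ fun l _ => IsRegularVec.sum _ fun k _ =>
    IsRegularVec.smul (IsRegularFun.adjugate (isRegularFun_crossMatrix b) l k)
      (IsRegularVec.smul (hv.frameCoord _ _) (IsRegularVec.frameVec _ _))

theorem IsRegularVec.projA {v : Frames (4 + m) E → E} (hv : IsRegularVec v) :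
    IsRegularVec fun e => projA b e (v e) := by
  simp only [_root_.projA, LinearMap.sub_apply, LinearMap.smul_apply, LinearMap.id_apply]
  exact (IsRegularVec.smul (IsRegularFun.det (isRegularFun_crossMatrix b)) hv).sub (hv.projC b)

theorem isRegularLinear_frameCoord_projA (i : Fin (4 + m)) (k : ℕ) :
    IsRegularLinear fun (e : Frames (4 + m) E) s t =>
      frameCoord (e i) k (projA b e (pointB e s t)) :=
  ⟨_, _, ((IsRegularVec.frameVec (Fin.castAdd m 2) 0).projA b).frameCoord i k,
    ((IsRegularVec.frameVec (Fin.castAdd m 2) 1).projA b).frameCoord i k, fun e s t => by simp [pointB]⟩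

theorem isRegularLinear_frameCoord_projC (i : Fin (4 + m)) (k : ℕ) :
    IsRegularLinear fun (e : Frames (4 + m) E) s t =>
      frameCoord (e i) k (projC b e (pointB e s t)) :=
  ⟨_, _, ((IsRegularVec.frameVec (Fin.castAdd m 2) 0).projC b).frameCoord i k,
    ((IsRegularVec.frameVec (Fin.castAdd m 2) 1).projC b).frameCoord i k, fun e s t => by simp [pointB]⟩

theorem isRegularQuadratic_coordMinor (i : Fin (4 + m)) (j k : ℕ) :
    IsRegularQuadratic fun (e : Frames (4 + m) E) s t =>
      coordMinor (e i) j k (projA b e (pointB e s t)) (projC b e (pointB e s t)) :=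
  ((isRegularLinear_frameCoord_projA b i j).mul (isRegularLinear_frameCoord_projC b i k)).sub
    ((isRegularLinear_frameCoord_projA b i k).mul (isRegularLinear_frameCoord_projC b i j))

theorem isRegularLinear_normalForm {v : Frames (4 + m) E → E} (hv : IsRegularVec v) :
    IsRegularLinear fun e s t => normalForm b e s t (v e) :=
  ((isRegularLinear_frameCoord_projA b _ _).mul_fun (hv.frameCoord _ _)).sub
    ((isRegularLinear_frameCoord_projA b _ _).mul_fun (hv.frameCoord _ _))

theorem isRegularQuadratic_spanForm {v w : Frames (4 + m) E → E} (hv : IsRegularVec v)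
    (hw : IsRegularVec w) : IsRegularQuadratic fun e s t => spanForm b e s t (v e) (w e) :=
  ((isRegularLinear_normalForm b (hv.projA b)).mul
      (isRegularLinear_normalForm b (hw.projC b))).sub
    ((isRegularLinear_normalForm b (hw.projA b)).mul (isRegularLinear_normalForm b (hv.projC b)))

theorem frameOpen_isGood : FrameOpen {e : Frames (4 + m) E | IsGood b e} := by
  have hbase : IsRegularQuadratic (baseForm b : Frames (4 + m) E → ℂ → ℂ → ℂ) :=
    isRegularQuadratic_coordMinor b _ _ _
  have hv (i : Fin (4 + m)) (k : ℕ) := IsRegularVec.frameVec (E := E) i k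
  have hA (k : ℕ) := isRegularLinear_frameCoord_projA (E := E) b (Fin.castAdd m 3) k
  have hC (k : ℕ) := isRegularLinear_frameCoord_projC (E := E) b (Fin.castAdd m 3) k
  have h := (FrameOpen.of_ne (IsRegularFun.det (isRegularFun_crossMatrix (E := E) (m := m) b))).inter <|
    (frameOpen_noCommonZero ((hA (b + 2)).mul (hA (b + 2))) ((hA (b + 3)).mul (hA (b + 3)))).inter <|
    (frameOpen_noCommonZero ((hC (b + 2)).mul (hC (b + 2))) ((hC (b + 3)).mul (hC (b + 3)))).inter <|
    (frameOpen_noCommonZero hbase ((isRegularLinear_normalForm b ((hv (Fin.castAdd m 0) 4).projC b)).mul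
      (isRegularLinear_frameCoord_projC b (Fin.castAdd m 0) (b + 3)))).inter <|
    (frameOpen_noCommonZero hbase ((isRegularLinear_normalForm b (hv (Fin.castAdd m 1) 0)).mul
      (isRegularLinear_frameCoord_projC b (Fin.castAdd m 1) (b - 1)))).inter <|
    (frameOpen_noCommonZero hbase ((isRegularLinear_normalForm b ((hv (Fin.castAdd m 3) 0).projA b)).mul
      (isRegularLinear_frameCoord_projA b (Fin.castAdd m 2) (b + 3)))).inter <|
    (frameOpen_noCommonZero hbase (isRegularQuadratic_spanForm b
      ((IsRegularVec.smul (IsRegularFun.const 1) (hv (Fin.castAdd m 2) 0)).add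
        (IsRegularVec.smul (IsRegularFun.const 1) (hv (Fin.castAdd m 2) 1)))
      (hv (Fin.castAdd m 2) 2))).inter <|
    (frameOpen_noCommonZero hbase
      (isRegularQuadratic_coordMinor b (Fin.castAdd m 3) (b + 1) (b + 2))).inter <|
    (FrameOpen.iInter fun j : Fin m => frameOpen_noCommonZero hbase
      (isRegularQuadratic_spanForm b (hv (Fin.natAdd 4 j) 0) (hv (Fin.natAdd 4 j) 1))).inter <|
    FrameOpen.iInter fun j : Fin m => frameOpen_noCommonZero hbase
      (isRegularQuadratic_coordMinor b (Fin.natAdd 4 j) (b + 2) (b + 3))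
  convert h using 1
  ext e
  simp only [Set.mem_inter_iff, Set.mem_iInter]
  constructor
  · intro he
    exact ⟨he.1, he.2, he.3, he.4, he.5, he.6, he.7, he.8, he.9, he.10⟩
  · rintro ⟨h1, h2, h3, h4, h5, h6, h7, h8, h9, h10⟩
    exact ⟨h1, h2, h3, h4, h5, h6, h7, h8, h9, h10⟩

end Openness

/-! ### Shuffles and positions -/

section Shuffle

/-- Weakly increasing sequences bounded by `b`, which describe shuffles of `n` and `b` symbols: the
`j`-th of the first symbols comes after `r j` of the other symbols. -/
structure IsShuffle (b : ℕ) (r : ℕ → ℕ) : Prop where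
  mono : Monotone r
  le : ∀ j, r j ≤ b

/-- The position of the `k`-th of the other symbols in a shuffle. -/
def slot (n : ℕ) (r : ℕ → ℕ) (k : ℕ) : ℕ := k + ((Finset.range n).filter (r · ≤ k)).card

variable {n b : ℕ} {r : ℕ → ℕ}

theorem slot_strictMono : StrictMono (slot n r) := fun k l hkl => by
  have : ((Finset.range n).filter (r · ≤ k)).card ≤ ((Finset.range n).filter (r · ≤ l)).card :=
    Finset.card_le_card (Finset.monotone_filter_right _ fun j _ hj => le_trans hj hkl.le)
  unfold slot
  omega

theorem slot_le_add (k : ℕ) : slot n r k ≤ k + n := by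
  have := Finset.card_filter_le (Finset.range n) (r · ≤ k)
  rw [Finset.card_range] at this
  unfold slot
  omega

namespace IsShuffle

variable (h : IsShuffle b r)

include h

theorem strictMono : StrictMono fun j => j + r j := fun i j hij => by
  have := h.mono hij.le
  dsimp only
  omega

theorem slot_le {k c : ℕ} (hc : k < r c) : slot n r k ≤ k + c := by
  have : (Finset.range n).filter (r · ≤ k) ⊆ Finset.range c := fun j hj => by
    rw [Finset.mem_filter] at hj
    rw [Finset.mem_range]
    by_contra! hcj
    have := h.mono hcj
    omega
  have := Finset.card_le_card this
  rw [Finset.card_range] at this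
  unfold slot
  omega

theorem le_slot {k c : ℕ} (hcn : c ≤ n) (hc : ∀ j < c, r j ≤ k) : k + c ≤ slot n r k := by
  have : Finset.range c ⊆ (Finset.range n).filter (r · ≤ k) := fun j hj => by
    rw [Finset.mem_range] at hj
    rw [Finset.mem_filter, Finset.mem_range]
    exact ⟨by omega, hc j hj⟩
  have := Finset.card_le_card this
  rw [Finset.card_range] at this
  unfold slot
  omega

/-- If `k < r j`, the `k`-th other symbol precedes the `j`-th of the first symbols, so its position
is at most `k + j`; otherwise it is at least `k + j + 1`. -/
theorem ne_slot {j : ℕ} (hj : j < n) (k : ℕ) : j + r j ≠ slot n r k := by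
  rcases lt_or_ge k (r j) with hk | hk
  · have := h.slot_le (n := n) hk
    omega
  · have := h.le_slot (n := n) (k := k) (c := j + 1) (by omega)
      fun i hi => (h.mono (by omega : i ≤ j)).trans hk
    omega

/-- The bijection given by a shuffle. -/
def equiv {N : ℕ} (hN : N = b + n) : Fin n ⊕ Fin b ≃ Fin N :=
  Equiv.ofBijective
    (Sum.elim (fun j => ⟨j + r j, by have := h.le j; omega⟩)
      (fun k => ⟨slot n r k, by have := slot_le_add (n := n) (r := r) k; omega⟩)) <| by
    rw [Fintype.bijective_iff_injective_and_card]
    refine ⟨?_, by simp [hN, add_comm]⟩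
    rintro (i | i) (j | j) hij <;> simp only [Sum.elim_inl, Sum.elim_inr, Fin.mk.injEq] at hij
    · rw [Fin.ext (h.strictMono.injective hij)]
    · exact absurd hij (h.ne_slot i.2 _)
    · exact absurd hij.symm (h.ne_slot j.2 _)
    · rw [Fin.ext (slot_strictMono.injective hij)]

end IsShuffle

theorem exists_forall_le_iff_le {f : ℕ → ℕ} (hf : StrictMono f) (t : ℕ) :
    ∃ α, ∀ j, t ≤ f j ↔ α ≤ j := by
  classical
  have hex : ∃ α, t ≤ f α := ⟨t, hf.id_le t⟩
  exact ⟨Nat.find hex, fun j => ⟨Nat.find_min' hex,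
    fun h => (Nat.find_spec hex).trans (hf.monotone h)⟩⟩

end Shuffle

/-! ### Merging bases of `V` and of `E/V` -/

section Interleave

variable {E : Type*} [AddCommGroup E] [Module ℂ E] [FiniteDimensional ℂ E] {V : Submodule ℂ E}
  {σ : (E ⧸ V) →ₗ[ℂ] E} (hσ : V.mkQ ∘ₗ σ = LinearMap.id)

include hσ

theorem mkQ_section (w : E ⧸ V) : V.mkQ (σ w) = w := LinearMap.congr_fun hσ w

theorem mkQ_add_section (v : V) (w : E ⧸ V) : V.mkQ (v + σ w) = w := by
  rw [map_add, mkQ_section hσ, V.mkQ_apply, (Submodule.Quotient.mk_eq_zero V).2 v.2, zero_add]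

theorem exists_add_section (x : E) : ∃ (v : V) (w : E ⧸ V), (v : E) + σ w = x :=
  ⟨⟨x - σ (V.mkQ x), by
    rw [← Submodule.Quotient.mk_eq_zero V, ← V.mkQ_apply, map_sub, mkQ_section hσ, sub_self]⟩,
    V.mkQ x, by simp⟩

/-- The decomposition of a space given by a section of the quotient map. -/
def splitEquiv : (V × (E ⧸ V)) ≃ₗ[ℂ] E :=
  LinearEquiv.ofBijective (V.subtype.coprod σ) <| by
    constructor
    · rw [← LinearMap.ker_eq_bot, LinearMap.ker_eq_bot']
      rintro ⟨v, w⟩ hvw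
      have hvw' : (v : E) + σ w = 0 := hvw
      have hw := mkQ_add_section hσ v w
      rw [hvw', map_zero] at hw
      subst hw
      simpa using hvw'
    · intro x
      obtain ⟨v, w, h⟩ := exists_add_section hσ x
      exact ⟨(v, w), h⟩

theorem splitEquiv_apply (v : V) (w : E ⧸ V) : splitEquiv hσ (v, w) = v + σ w := rfl

variable {r : ℕ → ℕ} (hr : IsShuffle (finrank ℂ (E ⧸ V)) r)

/-- The basis that shuffles a basis of `V` and a basis of a complement. -/
def interleave (e : Basis (Fin (finrank ℂ V)) ℂ V) (g : Basis (Fin (finrank ℂ (E ⧸ V))) ℂ (E ⧸ V)) :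
    Basis (Fin (finrank ℂ E)) ℂ E :=
  ((e.prod g).map (splitEquiv hσ)).reindex
    (hr.equiv (Submodule.finrank_quotient_add_finrank V).symm)

variable (e : Basis (Fin (finrank ℂ V)) ℂ V) (g : Basis (Fin (finrank ℂ (E ⧸ V))) ℂ (E ⧸ V))

theorem interleave_apply (k : Fin (finrank ℂ E)) :
    interleave hσ hr e g k =
      Sum.elim (fun j => (e j : E)) (fun j => σ (g j))
        ((hr.equiv (Submodule.finrank_quotient_add_finrank V).symm).symm k) := by
  rw [interleave, Basis.reindex_apply]
  rcases (hr.equiv (Submodule.finrank_quotient_add_finrank V).symm).symm k with j | j <;>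
    simp [splitEquiv_apply, Basis.prod_apply]

theorem frameVec_interleave {j : ℕ} (hj : j < finrank ℂ V) :
    frameVec (interleave hσ hr e g) (j + r j) = frameVec e j := by
  have hN := Submodule.finrank_quotient_add_finrank V
  have := hr.le j
  rw [frameVec, dif_pos (by omega), frameVec, dif_pos hj, interleave_apply]
  have : (hr.equiv hN.symm) (Sum.inl ⟨j, hj⟩) = ⟨j + r j, by omega⟩ := rfl
  rw [← this, Equiv.symm_apply_apply]
  rfl

theorem frameCoord_interleave_add_section {j : ℕ} (hj : j < finrank ℂ V) (v : V) (w : E ⧸ V) :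
    frameCoord (interleave hσ hr e g) (j + r j) (v + σ w) = frameCoord e j v := by
  have hN := Submodule.finrank_quotient_add_finrank V
  have := hr.le j
  rw [frameCoord, dif_pos (by omega), frameCoord, dif_pos hj]
  have : (hr.equiv hN.symm) (Sum.inl ⟨j, hj⟩) = ⟨j + r j, by omega⟩ := rfl
  rw [← this, Basis.coord_apply, interleave, Basis.repr_reindex_apply, Equiv.symm_apply_apply,
    ← splitEquiv_apply hσ]
  simp

theorem frameCoord_interleave {j : ℕ} (hj : j < finrank ℂ V) (v : V) :
    frameCoord (interleave hσ hr e g) (j + r j) v = frameCoord e j v := by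
  simpa using frameCoord_interleave_add_section hσ hr e g hj v 0

theorem frameCoord_slot_interleave {k : ℕ} (hk : k < finrank ℂ (E ⧸ V)) (v : V) (w : E ⧸ V) :
    frameCoord (interleave hσ hr e g) (slot (finrank ℂ V) r k) (v + σ w) = frameCoord g k w := by
  have hN := Submodule.finrank_quotient_add_finrank V
  have := slot_le_add (n := finrank ℂ V) (r := r) k
  rw [frameCoord, dif_pos (by omega), frameCoord, dif_pos hk]
  have : (hr.equiv hN.symm) (Sum.inr ⟨k, hk⟩) = ⟨slot (finrank ℂ V) r k, by omega⟩ := rfl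
  rw [← this, Basis.coord_apply, interleave, Basis.repr_reindex_apply, Equiv.symm_apply_apply,
    ← splitEquiv_apply hσ]
  simp

/-- Every vector of the merged basis lies in `V` or in the image of `σ`, so the members of its flag
split. The numbers `α` and `β` count the vectors of the two kinds before position `t`. -/
theorem add_section_mem_interleave_space {t α β : ℕ} (hα : ∀ j < finrank ℂ V, t ≤ j + r j ↔ α ≤ j)
    (hβ : ∀ k < finrank ℂ (E ⧸ V), t ≤ slot (finrank ℂ V) r k ↔ β ≤ k) {v : V} {w : E ⧸ V} :
    (v : E) + σ w ∈ (CompleteFlag.ofBasis (interleave hσ hr e g)).space t ↔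
      v ∈ (CompleteFlag.ofBasis e).space α ∧ w ∈ (CompleteFlag.ofBasis g).space β := by
  have hN := Submodule.finrank_quotient_add_finrank V
  simp only [mem_ofBasis_space]
  constructor
  · refine fun h => ⟨fun j hj => ?_, fun k hk => ?_⟩
    · by_cases hj' : j < finrank ℂ V
      · rw [← frameCoord_interleave_add_section hσ hr e g hj' v w]
        exact h _ ((hα j hj').2 hj)
      · simp [frameCoord, hj']
    · by_cases hk' : k < finrank ℂ (E ⧸ V)
      · rw [← frameCoord_slot_interleave hσ hr e g hk' v w]
        exact h _ ((hβ k hk').2 hk)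
      · simp [frameCoord, hk']
  · rintro ⟨h1, h2⟩ l hl
    by_cases hl' : l < finrank ℂ E
    · obtain ⟨x, hx⟩ := (hr.equiv hN.symm).surjective ⟨l, hl'⟩
      have hx' := congrArg Fin.val hx
      rcases x with j | k
      · have hj : (j : ℕ) + r j = l := hx'
        rw [← hj, frameCoord_interleave_add_section hσ hr e g j.2]
        exact h1 _ ((hα j j.2).1 (hj ▸ hl))
      · have hk : slot (finrank ℂ V) r k = l := hx'
        rw [← hk, frameCoord_slot_interleave hσ hr e g k.2]
        exact h2 _ ((hβ k k.2).1 (hk ▸ hl))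
    · simp [frameCoord, hl']

theorem exists_add_section_mem_interleave_space (t : ℕ) :
    ∃ α β, ∀ (v : V) (w : E ⧸ V),
      (v : E) + σ w ∈ (CompleteFlag.ofBasis (interleave hσ hr e g)).space t ↔
        v ∈ (CompleteFlag.ofBasis e).space α ∧ w ∈ (CompleteFlag.ofBasis g).space β := by
  obtain ⟨α, hα⟩ := exists_forall_le_iff_le hr.strictMono t
  obtain ⟨β, hβ⟩ := exists_forall_le_iff_le (slot_strictMono (n := finrank ℂ V) (r := r)) t
  exact ⟨α, β, fun v w => add_section_mem_interleave_space hσ hr e g (fun j _ => hα j)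
    fun k _ => hβ k⟩

theorem flagOfChain_comap_interleave :
    (flagOfChain fun t => ((CompleteFlag.ofBasis (interleave hσ hr e g)).space t).comap V.subtype) =
      CompleteFlag.ofBasis e := by
  refine flagOfChain_eq (isFlagChain_comap_subtype _ _) _ fun t => ?_
  obtain ⟨α, β, h⟩ := exists_add_section_mem_interleave_space hσ hr e g t
  refine ⟨α, ?_⟩
  ext v
  have := h v 0
  rw [map_zero, add_zero] at this
  rw [Submodule.mem_comap, Submodule.subtype_apply, this, and_iff_left (Submodule.zero_mem _)]

/-- Since `X` contains the image of `σ`, intersecting with `X` removes nothing from that part of the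
split member, and the part in `V` dies in the quotient. -/
theorem flagOfChain_map_interleave {X : Submodule ℂ E} (hX : ∀ w, σ w ∈ X) :
    (flagOfChain fun t =>
      ((CompleteFlag.ofBasis (interleave hσ hr e g)).space t ⊓ X).map V.mkQ) =
      CompleteFlag.ofBasis g := by
  have hX' : X.map V.mkQ = ⊤ := by
    rw [eq_top_iff]
    exact fun w _ => ⟨σ w, hX w, mkQ_section hσ w⟩
  refine flagOfChain_eq (isFlagChain_map _ _ _ hX') _ fun t => ?_
  obtain ⟨α, β, h⟩ := exists_add_section_mem_interleave_space hσ hr e g t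
  refine ⟨β, ?_⟩
  ext w
  constructor
  · rintro ⟨x, hx, rfl⟩
    obtain ⟨v, w, rfl⟩ := exists_add_section hσ x
    rw [mkQ_add_section hσ]
    exact ((h v w).1 hx.1).2
  · intro hw
    have := (h 0 w).2 ⟨Submodule.zero_mem _, hw⟩
    rw [Submodule.coe_zero, zero_add] at this
    exact ⟨σ w, ⟨this, hX w⟩, mkQ_section hσ w⟩

end Interleave

/-! ### Tuples of flags that induce prescribed instances -/

section InterleaveTuples

variable {E : Type*} [AddCommGroup E] [Module ℂ E] [FiniteDimensional ℂ E] {V : Submodule ℂ E}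
  {m b : ℕ}

/-- The shuffles for which interleaving inverts the construction of the induced instances. -/
def shuffleSeq (b : ℕ) : Fin (4 + m) → ℕ → ℕ :=
  Fin.append ![fun j => if j < 2 then 0 else if j < 3 then 2 else b,
    fun j => if j < 1 then 0 else if j < 2 then b - 2 else b,
    fun j => if j < 3 then 0 else b,
    fun j => if j < 1 then 0 else b] fun _ j => if j < 2 then 0 else b

/-- With `v` for vectors of `V` and `w` for lifts from `E/V`, the orders are `v v w w v w⋯w v`, then
`v w⋯w v w w v v` with `b - 2` lifts in the first run, then `v v v w⋯w v`, then `v w⋯w v v v`, and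
`v v w⋯w v v` for the remaining flags. So `A` has two vectors of each kind, `C` has two `v` and `b -
2` lifts, `B` lies in `V`, and `D` contains all lifts. -/
theorem isShuffle_shuffleSeq (hb : 2 ≤ b) (i : Fin (4 + m)) : IsShuffle b (shuffleSeq b i) := by
  revert i
  rw [forall_fin_four_add]
  simp only [shuffleSeq, Fin.append_left, Fin.append_right, Matrix.cons_val]
  refine ⟨?_, ?_, ?_, ?_, fun _ => ?_⟩ <;>
    exact ⟨fun i j hij => by split_ifs <;> omega,
      fun j => by split_ifs <;> omega⟩

variable {σ : (E ⧸ V) →ₗ[ℂ] E} (hσ : V.mkQ ∘ₗ σ = LinearMap.id)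
  (hr : ∀ i : Fin (4 + m), IsShuffle (finrank ℂ (E ⧸ V)) (shuffleSeq b i))
  (n : Basis (Fin (finrank ℂ V)) ℂ V)

/-- The tuple of bases obtained from bases of `V` and of `E/V`. The last bases use a fixed
basis of `V`. -/
def interleaveFrames (e : Frames 4 V) (g : Frames (4 + m) (E ⧸ V)) : Frames (4 + m) E :=
  fun i => interleave hσ (hr i) (Fin.append e (fun _ : Fin m => n) i) (g i)

theorem isRegularVec_interleaveFrames_left (g : Frames (4 + m) (E ⧸ V)) (i j) :
    IsRegularVec fun e : Frames 4 V => interleaveFrames hσ hr n e g i j := by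
  simp only [interleaveFrames, interleave_apply]
  rcases ((hr i).equiv (Submodule.finrank_quotient_add_finrank V).symm).symm j with k | k
  · simp only [Sum.elim_inl]
    induction i using Fin.addCases with
    | left i =>
      simp only [Fin.append_left]
      exact (IsRegularVec.basis i k).map V.subtype
    | right i =>
      simp only [Fin.append_right]
      exact IsRegularVec.const _
  · exact IsRegularVec.const _

theorem isRegularVec_interleaveFrames_right (e : Frames 4 V) (i j) :
    IsRegularVec fun g : Frames (4 + m) (E ⧸ V) => interleaveFrames hσ hr n e g i j := by
  simp only [interleaveFrames, interleave_apply]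
  rcases ((hr i).equiv (Submodule.finrank_quotient_add_finrank V).symm).symm j with k | k
  · exact IsRegularVec.const _
  · exact (IsRegularVec.basis i k).map σ

variable (e : Frames 4 V) (g : Frames (4 + m) (E ⧸ V))

section Spaces

variable (hb : 2 ≤ b) (hV : finrank ℂ V = 4) (hW : finrank ℂ (E ⧸ V) = b) (v : V) (w : E ⧸ V)

include hV hW

include hb in
theorem add_section_mem_first :
    (v : E) + σ w ∈
      (CompleteFlag.ofBasis (interleaveFrames hσ hr n e g (Fin.castAdd m 0))).space 4 ↔
      v ∈ (CompleteFlag.ofBasis (e 0)).space 2 ∧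
        w ∈ (CompleteFlag.ofBasis (g (Fin.castAdd m 0))).space 2 := by
  have h := hr (Fin.castAdd m 0)
  have key := add_section_mem_interleave_space hσ h (e 0) (g (Fin.castAdd m 0)) (t := 4) (α := 2)
    (β := 2) (v := v) (w := w) (fun j hj => by
      simp only [shuffleSeq, Fin.append_left, Matrix.cons_val]
      split_ifs <;> omega) (fun k hk => by
      rcases lt_or_ge k 2 with hk | hk
      · have := h.slot_le (n := finrank ℂ V) (k := k) (c := 2)
          (by simpa [shuffleSeq, Fin.append_left] using hk)
        omega
      · have := h.le_slot (n := finrank ℂ V) (k := k) (c := 2) (by omega) fun j hj => by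
          simp only [shuffleSeq, Fin.append_left, Matrix.cons_val]
          split_ifs <;> omega
        omega)
  rw [← key, interleaveFrames, Fin.append_left]

include hb in
theorem add_section_mem_second :
    (v : E) + σ w ∈
      (CompleteFlag.ofBasis (interleaveFrames hσ hr n e g (Fin.castAdd m 1))).space b ↔
      v ∈ (CompleteFlag.ofBasis (e 1)).space 2 ∧
        w ∈ (CompleteFlag.ofBasis (g (Fin.castAdd m 1))).space (b - 2) := by
  have h := hr (Fin.castAdd m 1)
  have key := add_section_mem_interleave_space hσ h (e 1) (g (Fin.castAdd m 1)) (t := b) (α := 2)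
    (β := b - 2) (v := v) (w := w) (fun j hj => by
      simp only [shuffleSeq, Fin.append_left, Matrix.cons_val]
      split_ifs <;> omega) (fun k hk => by
      rcases lt_or_ge k (b - 2) with hk | hk
      · have := h.slot_le (n := finrank ℂ V) (k := k) (c := 1)
          (by simpa [shuffleSeq, Fin.append_left] using hk)
        omega
      · have := h.le_slot (n := finrank ℂ V) (k := k) (c := 2) (by omega) fun j hj => by
          simp only [shuffleSeq, Fin.append_left, Matrix.cons_val]
          split_ifs <;> omega
        omega)
  rw [← key, interleaveFrames, Fin.append_left]

theorem add_section_mem_third :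
    (v : E) + σ w ∈
      (CompleteFlag.ofBasis (interleaveFrames hσ hr n e g (Fin.castAdd m 2))).space 2 ↔
      v ∈ (CompleteFlag.ofBasis (e 2)).space 2 ∧ w = 0 := by
  have h := hr (Fin.castAdd m 2)
  have key := add_section_mem_interleave_space hσ h (e 2) (g (Fin.castAdd m 2)) (t := 2) (α := 2)
    (β := 0) (v := v) (w := w) (fun j hj => by
      simp only [shuffleSeq, Fin.append_left, Matrix.cons_val]
      split_ifs <;> omega) (fun k hk => by
      have := h.le_slot (n := finrank ℂ V) (k := k) (c := 3) (by omega) fun j hj => by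
        simp only [shuffleSeq, Fin.append_left, Matrix.cons_val]
        split_ifs
        omega
      omega)
  rw [CompleteFlag.space_zero, Submodule.mem_bot] at key
  rw [← key, interleaveFrames, Fin.append_left]

theorem section_mem_fourth : σ w ∈
    (CompleteFlag.ofBasis (interleaveFrames hσ hr n e g (Fin.castAdd m 3))).space (b + 2) := by
  have h := hr (Fin.castAdd m 3)
  have key := add_section_mem_interleave_space hσ h (e 3) (g (Fin.castAdd m 3)) (t := b + 2)
    (α := 2) (β := b) (v := 0) (w := w) (fun j hj => by
      simp only [shuffleSeq, Fin.append_left, Matrix.cons_val]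
      split_ifs <;> omega) (fun k hk => by
      have := h.slot_le (n := finrank ℂ V) (k := k) (c := 1)
        (by simp [shuffleSeq, Fin.append_left]; omega)
      omega)
  rw [CompleteFlag.space_eq_top _ hW.le, Submodule.coe_zero, zero_add] at key
  rw [interleaveFrames, Fin.append_left]
  exact key.2 ⟨Submodule.zero_mem _, trivial⟩

end Spaces

section Induced

variable (hb : 2 ≤ b) (hV : finrank ℂ V = 4) (hE : finrank ℂ E = b + 4)
  (hgood : IsGood b (interleaveFrames hσ hr n e g))

include hb hV hE hgood

/-- As `V` is the sum of its planes in `A` and in `C` and contains `B`, the components of vectors of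
`B` stay in `V`. Equality follows by dimension. -/
theorem baseSpace_interleaveFrames :
    baseSpace b (fun i => CompleteFlag.ofBasis (interleaveFrames hσ hr n e g i)) = V := by
  have hW : finrank ℂ (E ⧸ V) = b := by
    have := Submodule.finrank_quotient_add_finrank V
    omega
  have T := hgood.isTransverse hE
  have hA (v w) := add_section_mem_first hσ hr n e g hb hV hW v w
  have hC (v w) := add_section_mem_second hσ hr n e g hb hV hW v w
  have hB (v w) := add_section_mem_third hσ hr n e g hV hW v w
  have hinf : (CompleteFlag.ofBasis (e 0)).space 2 ⊓ (CompleteFlag.ofBasis (e 1)).space 2 = ⊥ := by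
    rw [Submodule.eq_bot_iff]
    rintro v ⟨h0, h1⟩
    have h := T.inf_eq_bot.le ⟨(hA v 0).2 ⟨h0, Submodule.zero_mem _⟩,
      (hC v 0).2 ⟨h1, Submodule.zero_mem _⟩⟩
    simpa using h
  have hsup : (CompleteFlag.ofBasis (e 0)).space 2 ⊔ (CompleteFlag.ofBasis (e 1)).space 2 = ⊤ := by
    apply Submodule.eq_top_of_finrank_eq
    rw [finrank_sup_of_inf_eq_bot hinf, CompleteFlag.finrank_space, CompleteFlag.finrank_space]
    omega
  have key {p w : E} (hp : p ∈ spaceA fun i => CompleteFlag.ofBasis (interleaveFrames hσ hr n e g i))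
      (hw : w ∈ spaceC b fun i => CompleteFlag.ofBasis (interleaveFrames hσ hr n e g i))
      (hpw : p + w ∈ spaceB fun i => CompleteFlag.ofBasis (interleaveFrames hσ hr n e g i)) :
      p ∈ V ∧ w ∈ V := by
    obtain ⟨v, z, hvz⟩ := exists_add_section hσ (p + w)
    rw [← hvz] at hpw
    obtain ⟨-, rfl⟩ := (hB v z).1 hpw
    obtain ⟨v₁, h1, v₂, h2, rfl⟩ := Submodule.mem_sup.1 (hsup.ge (Submodule.mem_top (x := v)))
    have h1' := (hA v₁ 0).2 ⟨h1, Submodule.zero_mem _⟩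
    have h2' := (hC v₂ 0).2 ⟨h2, Submodule.zero_mem _⟩
    rw [map_zero, add_zero] at h1' h2' hvz
    obtain ⟨rfl, rfl⟩ := eq_and_eq_of_add_eq_add T.inf_eq_bot hp h1' hw h2' hvz.symm
    exact ⟨v₁.2, v₂.2⟩
  refine Submodule.eq_of_le_of_finrank_eq (sup_le (fun p hp => ?_) fun w hw => ?_)
    (T.finrank_crossSpace.trans hV.symm)
  · obtain ⟨hp, w, hw, hpw⟩ := T.mem_projA.1 hp
    exact (key hp hw hpw).1
  · obtain ⟨hw, p, hp, hpw⟩ := T.mem_projC.1 hw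
    exact (key hp hw hpw).2

/-- The quotient is a sum of two members of flags whose lifts lie in `A ⊓ D` and in `C ⊓ D`. Nothing
is required of `h`, so the fiber flags do not depend on it. -/
theorem section_mem_solutionSpan (h : Submodule ℂ E) (w : E ⧸ V) :
    σ w ∈ solutionSpan b (fun i => CompleteFlag.ofBasis (interleaveFrames hσ hr n e g i)) h := by
  have hW : finrank ℂ (E ⧸ V) = b := by
    have := Submodule.finrank_quotient_add_finrank V
    omega
  have T := hgood.isTransverse hE
  have hA (w) := add_section_mem_first hσ hr n e g hb hV hW 0 w
  have hC (w) := add_section_mem_second hσ hr n e g hb hV hW 0 w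
  have hD (w) := section_mem_fourth hσ hr n e g hV hW w
  simp only [Submodule.coe_zero, zero_add, Submodule.zero_mem, true_and] at hA hC
  have hinf : (CompleteFlag.ofBasis (g (Fin.castAdd m 0))).space 2 ⊓
      (CompleteFlag.ofBasis (g (Fin.castAdd m 1))).space (b - 2) = ⊥ := by
    rw [Submodule.eq_bot_iff]
    rintro w ⟨h0, h1⟩
    have h := T.inf_eq_bot.le ⟨(hA w).2 h0, (hC w).2 h1⟩
    rw [Submodule.mem_bot] at h
    rw [← mkQ_section hσ w, h, map_zero]
  have hsup : (CompleteFlag.ofBasis (g (Fin.castAdd m 0))).space 2 ⊔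
      (CompleteFlag.ofBasis (g (Fin.castAdd m 1))).space (b - 2) = ⊤ := by
    apply Submodule.eq_top_of_finrank_eq
    rw [finrank_sup_of_inf_eq_bot hinf, CompleteFlag.finrank_space, CompleteFlag.finrank_space]
    omega
  obtain ⟨w₁, h1, w₂, h2, rfl⟩ := Submodule.mem_sup.1 (hsup.ge (Submodule.mem_top (x := w)))
  rw [map_add]
  exact add_mem (Submodule.mem_sup_left ⟨(hA w₁).2 h1, Submodule.mem_sup_left (hD w₁)⟩)
    (Submodule.mem_sup_right ⟨(hC w₂).2 h2, Submodule.mem_sup_left (hD w₂)⟩)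

theorem inducedOn_interleaveFrames :
    inducedOn b (fun i => CompleteFlag.ofBasis (interleaveFrames hσ hr n e g i))
      (baseSpace b fun i => CompleteFlag.ofBasis (interleaveFrames hσ hr n e g i)) =
    ⟨V, fun i => CompleteFlag.ofBasis (e i), fun _ i => CompleteFlag.ofBasis (g i)⟩ := by
  rw [baseSpace_interleaveFrames hσ hr n e g hb hV hE hgood]
  have h1 : baseFlags (fun i => CompleteFlag.ofBasis (interleaveFrames hσ hr n e g i)) V =
      fun i => CompleteFlag.ofBasis (e i) := by
    funext i
    have := flagOfChain_comap_interleave hσ (hr (Fin.castAdd m i)) (e i) (g (Fin.castAdd m i))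
    simpa only [baseFlags, interleaveFrames, Fin.append_left] using this
  have h2 (h : Submodule ℂ E) :
      fiberFlags b (fun i => CompleteFlag.ofBasis (interleaveFrames hσ hr n e g i)) V h =
        fun i => CompleteFlag.ofBasis (g i) := by
    funext i
    exact flagOfChain_map_interleave hσ (hr i) _ (g i)
      (section_mem_solutionSpan hσ hr n e g hb hV hE hgood h)
  simp only [inducedOn, h1, h2]

end Induced

end InterleaveTuples

/-! ### An explicit example in dimension four -/

section BasesFromMatrices

variable {V : Type*} [AddCommGroup V] [Module ℂ V] [FiniteDimensional ℂ V]

/-- The rows of `M` are the basis vectors, and the columns of `N = M⁻¹` are their coordinate forms.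
-/
theorem exists_basis_of_mul_eq_one {n : ℕ} (hV : finrank ℂ V = n) (v : Basis (Fin n) ℂ V)
    {M N : Matrix (Fin n) (Fin n) ℂ} (hMN : M * N = 1) :
    ∃ e : Basis (Fin (finrank ℂ V)) ℂ V, (∀ i : Fin n, frameVec e i = v.equivFun.symm (M i)) ∧
      ∀ (i : Fin n) (x : Fin n → ℂ), frameCoord e i (v.equivFun.symm x) = Matrix.vecMul x N i := by
  subst hV
  have hNM := mul_eq_one_comm.1 hMN
  let T : (Fin (finrank ℂ V) → ℂ) ≃ₗ[ℂ] (Fin (finrank ℂ V) → ℂ) :=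
    LinearEquiv.ofLinearMap (Matrix.vecMulLinear N) (Matrix.vecMulLinear M)
      (LinearMap.ext fun x => by simp [Matrix.vecMul_vecMul, hMN])
      (LinearMap.ext fun x => by simp [Matrix.vecMul_vecMul, hNM])
  let L : V ≃ₗ[ℂ] (Fin (finrank ℂ V) → ℂ) := v.equivFun.trans T
  refine ⟨Basis.ofEquivFun L, fun i => ?_, fun i x => ?_⟩
  · rw [frameVec, dif_pos i.2, Basis.coe_ofEquivFun]
    simp [L, T]
  · have hL : L (v.equivFun.symm x) = Matrix.vecMul x N := by
      simp only [L, LinearEquiv.trans_apply, LinearEquiv.apply_symm_apply]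
      rfl
    rw [frameCoord, dif_pos i.2, Basis.coord_apply, Basis.ofEquivFun_repr_apply, hL]

end BasesFromMatrices

section Example

variable {V : Type*} [AddCommGroup V] [Module ℂ V] [FiniteDimensional ℂ V]

/-- The properties of the four bases of a four-dimensional space that are used as an example, and
of the fixed basis `n`, with respect to the basis `v`. -/
structure IsModelFrames (v : Basis (Fin 4) ℂ V) (e : Frames 4 V)
    (n : Basis (Fin (finrank ℂ V)) ℂ V) : Prop where
  vec_first : frameVec (e 0) 2 = v.equivFun.symm ![0, 0, 1, 1]
  vec_second : frameVec (e 1) 0 = v.equivFun.symm ![0, 0, 1, 1]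
  vec_third_zero : frameVec (e 2) 0 = v.equivFun.symm ![1, 0, 1, 0]
  vec_third_one : frameVec (e 2) 1 = v.equivFun.symm ![0, 1, 0, 1]
  vec_third_two : frameVec (e 2) 2 = v.equivFun.symm ![1, 1, 0, 0]
  vec_fourth : frameVec (e 3) 0 = v.equivFun.symm ![-1, 1, 1, 1]
  vec_zero : frameVec n 0 = v.equivFun.symm ![1, 1, 0, 0]
  vec_one : frameVec n 1 = v.equivFun.symm ![0, 0, 1, 1]
  coord_first_two : ∀ x, frameCoord (e 0) 2 (v.equivFun.symm x) = x 2
  coord_first_three : ∀ x, frameCoord (e 0) 3 (v.equivFun.symm x) = x 3 - x 2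
  coord_second_one : ∀ x, frameCoord (e 1) 1 (v.equivFun.symm x) = x 3 - x 2
  coord_second_two : ∀ x, frameCoord (e 1) 2 (v.equivFun.symm x) = x 0
  coord_second_three : ∀ x, frameCoord (e 1) 3 (v.equivFun.symm x) = x 1
  coord_third : ∀ x, frameCoord (e 2) 3 (v.equivFun.symm x) = x 1 - x 3 - x 0 + x 2
  coord_fourth_one : ∀ x, frameCoord (e 3) 1 (v.equivFun.symm x) = x 3 - x 2
  coord_fourth_two : ∀ x, frameCoord (e 3) 2 (v.equivFun.symm x) = x 0 + x 2 - x 1 + x 3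
  coord_fourth_three : ∀ x, frameCoord (e 3) 3 (v.equivFun.symm x) = x 1 - x 3
  coord_two : ∀ x, frameCoord n 2 (v.equivFun.symm x) = x 1 - x 0
  coord_three : ∀ x, frameCoord n 3 (v.equivFun.symm x) = x 3 - x 2

theorem exists_isModelFrames (hV : finrank ℂ V = 4) (v : Basis (Fin 4) ℂ V) :
    ∃ e n, IsModelFrames v e n := by
  have mk (M N : Matrix (Fin 4) (Fin 4) ℂ) (h : M * N = 1) := exists_basis_of_mul_eq_one hV v h
  obtain ⟨e₁, h₁, h₁'⟩ := mk !![1, 0, 0, 0; 0, 1, 0, 0; 0, 0, 1, 1; 0, 0, 0, 1]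
    !![1, 0, 0, 0; 0, 1, 0, 0; 0, 0, 1, -1; 0, 0, 0, 1]
    (by ext i j; fin_cases i <;> fin_cases j <;> simp [Matrix.mul_apply, Fin.sum_univ_four])
  obtain ⟨e₂, h₂, h₂'⟩ := mk !![0, 0, 1, 1; 0, 0, 0, 1; 1, 0, 0, 0; 0, 1, 0, 0]
    !![0, 0, 1, 0; 0, 0, 0, 1; 1, -1, 0, 0; 0, 1, 0, 0]
    (by ext i j; fin_cases i <;> fin_cases j <;> simp [Matrix.mul_apply, Fin.sum_univ_four])
  obtain ⟨e₃, h₃, h₃'⟩ := mk !![1, 0, 1, 0; 0, 1, 0, 1; 1, 1, 0, 0; 0, 1, 0, 0]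
    !![0, 0, 1, -1; 0, 0, 0, 1; 1, 0, -1, 1; 0, 1, 0, -1]
    (by ext i j; fin_cases i <;> fin_cases j <;> simp [Matrix.mul_apply, Fin.sum_univ_four])
  obtain ⟨e₄, h₄, h₄'⟩ := mk !![-1, 1, 1, 1; 0, 1, 0, 1; 1, 0, 0, 0; 1, 1, 0, 0]
    !![0, 0, 1, 0; 0, 0, -1, 1; 1, -1, 1, 0; 0, 1, 1, -1]
    (by ext i j; fin_cases i <;> fin_cases j <;> simp [Matrix.mul_apply, Fin.sum_univ_four])
  obtain ⟨n, h₅, h₅'⟩ := mk !![1, 1, 0, 0; 0, 0, 1, 1; 0, 1, 0, 0; 0, 0, 0, 1]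
    !![1, 0, -1, 0; 0, 0, 1, 0; 0, 1, 0, -1; 0, 0, 0, 1]
    (by ext i j; fin_cases i <;> fin_cases j <;> simp [Matrix.mul_apply, Fin.sum_univ_four])
  refine ⟨![e₁, e₂, e₃, e₄], n, h₁ 2, h₂ 0, h₃ 0, h₃ 1, h₃ 2, h₄ 0, h₅ 0, h₅ 1,
    fun x => (h₁' 2 x).trans ?_, fun x => (h₁' 3 x).trans ?_, fun x => (h₂' 1 x).trans ?_,
    fun x => (h₂' 2 x).trans ?_, fun x => (h₂' 3 x).trans ?_, fun x => (h₃' 3 x).trans ?_,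
    fun x => (h₄' 1 x).trans ?_, fun x => (h₄' 2 x).trans ?_, fun x => (h₄' 3 x).trans ?_,
    fun x => (h₅' 2 x).trans ?_, fun x => (h₅' 3 x).trans ?_⟩ <;>
  · simp [Matrix.vecMul, dotProduct, Fin.sum_univ_four]
    try ring

end Example

/-! ### The example is good -/

section ModelIsGood

variable {E : Type*} [AddCommGroup E] [Module ℂ E] [FiniteDimensional ℂ E] {V : Submodule ℂ E}
  {m b : ℕ} {σ : (E ⧸ V) →ₗ[ℂ] E} (hσ : V.mkQ ∘ₗ σ = LinearMap.id)
  (hr : ∀ i : Fin (4 + m), IsShuffle (finrank ℂ (E ⧸ V)) (shuffleSeq b i))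
  {v : Basis (Fin 4) ℂ V} {e : Frames 4 V} {n : Basis (Fin (finrank ℂ V)) ℂ V}
  (he : IsModelFrames v e n) {g : Frames (4 + m) (E ⧸ V)}

theorem ne_zero_and_of_mul_eq_zero {s t : ℂ} (hst : s ≠ 0 ∨ t ≠ 0) (h : s * t = 0) :
    s + t ≠ 0 ∧ s - t ≠ 0 := by
  rcases mul_eq_zero.1 h with rfl | rfl <;> simpa using hst

include he in
-- In the example `baseForm` is `-2 ε² s t`, with `ε` the determinant, so its roots are `(1 : 0)`
-- and `(0 : 1)`. The forms to be tested against it are nonzero multiples of `(s + t)(s - t)` or `(s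
-- - t)²`, which do not vanish there.
theorem IsModelFrames.isGood (hb : 2 ≤ b) (hV : finrank ℂ V = 4) (hE : finrank ℂ E = b + 4)
    (hg : (CompleteFlag.ofBasis (g (Fin.castAdd m 0))).space 2 ⊓
      (CompleteFlag.ofBasis (g (Fin.castAdd m 1))).space (b - 2) = ⊥) :
    IsGood b (interleaveFrames hσ hr n e g) := by
  have hW : finrank ℂ (E ⧸ V) = b := by
    have := Submodule.finrank_quotient_add_finrank V
    omega
  set f := interleaveFrames hσ hr n e g with hf
  set u : (Fin 4 → ℂ) →ₗ[ℂ] E := V.subtype ∘ₗ v.equivFun.symm.toLinearMap with hu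
  have hu' (x) : ((v.equivFun.symm x : V) : E) = u x := rfl
  have hA (v w) := add_section_mem_first hσ hr n e g hb hV hW v w
  have hC (v w) := add_section_mem_second hσ hr n e g hb hV hW v w
  rw [← hf] at hA hC
  have he0 (x : Fin 4 → ℂ) : v.equivFun.symm x ∈ (CompleteFlag.ofBasis (e 0)).space 2 ↔
      x 2 = 0 ∧ x 3 = 0 := by
    rw [mem_ofBasis_space]
    constructor
    · intro h
      have h2 := h 2 le_rfl
      have h3 := h 3 (by omega)
      rw [he.coord_first_two] at h2
      rw [he.coord_first_three, h2, sub_zero] at h3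
      exact ⟨h2, h3⟩
    · rintro ⟨h2, h3⟩ k hk
      by_cases hk4 : k < 4
      · obtain rfl | rfl : k = 2 ∨ k = 3 := by omega
        · rw [he.coord_first_two, h2]
        · rw [he.coord_first_three, h2, h3, sub_zero]
      · simp [frameCoord, hV, hk4]
  have he1 (x : Fin 4 → ℂ) : v.equivFun.symm x ∈ (CompleteFlag.ofBasis (e 1)).space 2 ↔
      x 0 = 0 ∧ x 1 = 0 := by
    rw [mem_ofBasis_space]
    constructor
    · intro h
      have h2 := h 2 le_rfl
      have h3 := h 3 (by omega)
      rw [he.coord_second_two] at h2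
      rw [he.coord_second_three] at h3
      exact ⟨h2, h3⟩
    · rintro ⟨h2, h3⟩ k hk
      by_cases hk4 : k < 4
      · obtain rfl | rfl : k = 2 ∨ k = 3 := by omega
        · rw [he.coord_second_two, h2]
        · rw [he.coord_second_three, h3]
      · simp [frameCoord, hV, hk4]
  have hdet : (crossMatrix b f).det ≠ 0 := by
    rw [det_crossMatrix_ne_zero_iff hE, Submodule.eq_bot_iff]
    rintro x ⟨h1, h2⟩
    obtain ⟨y, w, rfl⟩ := exists_add_section hσ x
    obtain ⟨x, rfl⟩ := v.equivFun.symm.surjective y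
    obtain ⟨h1, h1'⟩ := (hA _ _).1 h1
    obtain ⟨h2, h2'⟩ := (hC _ _).1 h2
    have hw : w = 0 := (Submodule.eq_bot_iff _).1 hg w ⟨h1', h2'⟩
    have hx : x = 0 := by
      funext i
      fin_cases i
      · exact ((he1 x).1 h2).1
      · exact ((he1 x).1 h2).2
      · exact ((he0 x).1 h1).1
      · exact ((he0 x).1 h1).2
    rw [hw, hx]
    simp
  set ε := (crossMatrix b f).det with hε
  have hproj (x : Fin 4 → ℂ) : projA b f (u x) = ε • u ![x 0, x 1, 0, 0] ∧
      projC b f (u x) = ε • u ![0, 0, x 2, x 3] := by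
    have h1 := (hA (v.equivFun.symm ![x 0, x 1, 0, 0]) 0).2
      ⟨(he0 _).2 ⟨rfl, rfl⟩, Submodule.zero_mem _⟩
    have h2 := (hC (v.equivFun.symm ![0, 0, x 2, x 3]) 0).2
      ⟨(he1 _).2 ⟨rfl, rfl⟩, Submodule.zero_mem _⟩
    rw [map_zero, add_zero] at h1 h2
    have := proj_of_add hE hdet h1 h2
    rw [hu', hu', ← map_add] at this
    have hx : ![x 0, x 1, 0, 0] + ![0, 0, x 2, x 3] = x := by
      funext i
      fin_cases i <;> simp
    rwa [hx] at this
  have hf0 (i : Fin 4) : f (Fin.castAdd m i) =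
      interleave hσ (hr (Fin.castAdd m i)) (e i) (g (Fin.castAdd m i)) := by
    rw [hf, interleaveFrames, Fin.append_left]
  have hf1 (j : Fin m) : f (Fin.natAdd 4 j) =
      interleave hσ (hr (Fin.natAdd 4 j)) n (g (Fin.natAdd 4 j)) := by
    rw [hf, interleaveFrames, Fin.append_right]
  have vec (i : Fin 4) (j l : ℕ) (hj : j < 4) (x)
      (hx : frameVec (e i) j = v.equivFun.symm x)
      (hl : j + shuffleSeq b (Fin.castAdd m i) j = l) :
      frameVec (f (Fin.castAdd m i)) l = u x := by
    rw [hf0, ← hl, frameVec_interleave hσ _ _ _ (hV ▸ hj), hx, hu']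
  have vec' (k : Fin m) (j l : ℕ) (hj : j < 4) (x) (hx : frameVec n j = v.equivFun.symm x)
      (hl : j + shuffleSeq b (Fin.natAdd 4 k) j = l) :
      frameVec (f (Fin.natAdd 4 k)) l = u x := by
    rw [hf1, ← hl, frameVec_interleave hσ _ _ _ (hV ▸ hj), hx, hu']
  have coord (i : Fin 4) (j l : ℕ) (hj : j < 4) (x)
      (hl : j + shuffleSeq b (Fin.castAdd m i) j = l) :
      frameCoord (f (Fin.castAdd m i)) l (u x) = frameCoord (e i) j (v.equivFun.symm x) := by
    rw [hf0, ← hl, ← hu', frameCoord_interleave hσ _ _ _ (hV ▸ hj)]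
  have coord' (k : Fin m) (j l : ℕ) (hj : j < 4) (x)
      (hl : j + shuffleSeq b (Fin.natAdd 4 k) j = l) :
      frameCoord (f (Fin.natAdd 4 k)) l (u x) = frameCoord n j (v.equivFun.symm x) := by
    rw [hf1, ← hl, ← hu', frameCoord_interleave hσ _ _ _ (hV ▸ hj)]
  have v1 := vec 0 2 4 (by omega) _ he.vec_first (by simp [shuffleSeq, Fin.append_left])
  have v2 := vec 1 0 0 (by omega) _ he.vec_second (by simp [shuffleSeq, Fin.append_left])
  have v30 := vec 2 0 0 (by omega) _ he.vec_third_zero (by simp [shuffleSeq, Fin.append_left])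
  have v31 := vec 2 1 1 (by omega) _ he.vec_third_one (by simp [shuffleSeq, Fin.append_left])
  have v32 := vec 2 2 2 (by omega) _ he.vec_third_two (by simp [shuffleSeq, Fin.append_left])
  have v4 := vec 3 0 0 (by omega) _ he.vec_fourth (by simp [shuffleSeq, Fin.append_left])
  have v50 (k) := vec' k 0 0 (by omega) _ he.vec_zero (by simp [shuffleSeq, Fin.append_right])
  have v51 (k) := vec' k 1 1 (by omega) _ he.vec_one (by simp [shuffleSeq, Fin.append_right])
  have c13 (x) := (coord 0 3 (b + 3) (by omega) x
    (by simp [shuffleSeq, Fin.append_left]; omega)).trans (he.coord_first_three x)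
  have c21 (x) := (coord 1 1 (b - 1) (by omega) x
    (by simp [shuffleSeq, Fin.append_left]; omega)).trans (he.coord_second_one x)
  have c33 (x) := (coord 2 3 (b + 3) (by omega) x
    (by simp [shuffleSeq, Fin.append_left]; omega)).trans (he.coord_third x)
  have c41 (x) := (coord 3 1 (b + 1) (by omega) x
    (by simp [shuffleSeq, Fin.append_left]; omega)).trans (he.coord_fourth_one x)
  have c42 (x) := (coord 3 2 (b + 2) (by omega) x
    (by simp [shuffleSeq, Fin.append_left]; omega)).trans (he.coord_fourth_two x)
  have c43 (x) := (coord 3 3 (b + 3) (by omega) x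
    (by simp [shuffleSeq, Fin.append_left]; omega)).trans (he.coord_fourth_three x)
  have c52 (k) (x) := (coord' k 2 (b + 2) (by omega) x
    (by simp [shuffleSeq, Fin.append_right]; omega)).trans (he.coord_two x)
  have c53 (k) (x) := (coord' k 3 (b + 3) (by omega) x
    (by simp [shuffleSeq, Fin.append_right]; omega)).trans (he.coord_three x)
  have hpoint (s t : ℂ) : pointB f s t = u ![s, t, s, t] := by
    rw [pointB, v30, v31, ← map_smul, ← map_smul, ← map_add]
    simp
  have hp (s t) : projA b f (pointB f s t) = ε • u ![s, t, 0, 0] := by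
    rw [hpoint, (hproj _).1]
    rfl
  have hq (s t) : projC b f (pointB f s t) = ε • u ![0, 0, s, t] := by
    rw [hpoint, (hproj _).2]
    rfl
  have hN (s t x) : normalForm b f s t (u x) =
      ε * ((s - t) * (x 1 - x 3) - t * (x 0 + x 2 - x 1 + x 3)) := by
    simp only [normalForm, coordMinor, hp, map_smul, c42, c43, smul_eq_mul, Matrix.cons_val]
    ring
  have hN' (s t x) : normalForm b f s t (ε • u x) =
      ε ^ 2 * ((s - t) * (x 1 - x 3) - t * (x 0 + x 2 - x 1 + x 3)) := by
    rw [← map_smul, hN]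
    simp only [Pi.smul_apply, smul_eq_mul]
    ring
  have hbase {s t : ℂ} (hst : s ≠ 0 ∨ t ≠ 0) (h : baseForm b f s t = 0) :
      s + t ≠ 0 ∧ s - t ≠ 0 := by
    refine ne_zero_and_of_mul_eq_zero hst ?_
    rw [baseForm, hq, hN'] at h
    simp only [Matrix.cons_val] at h
    have h' : -2 * ε ^ 2 * (s * t) = 0 := by linear_combination h
    exact (mul_eq_zero.1 h').resolve_left (by simp [hdet])
  have hspan (s t x y) : spanForm b f s t (u x) (u y) = ε ^ 4 *
      (((s - t) * x 1 - t * (x 0 - x 1)) * (-(s - t) * y 3 - t * (y 2 + y 3)) -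
      ((s - t) * y 1 - t * (y 0 - y 1)) * (-(s - t) * x 3 - t * (x 2 + x 3))) := by
    simp only [spanForm, (hproj _).1, (hproj _).2, hN', Matrix.cons_val]
    ring
  refine ⟨hdet, ?_, ?_, ?_, ?_, ?_, ?_, ?_, fun j => ?_, fun j => ?_⟩ <;>
    intro s t hst h0
  · simp only [hp, map_smul, c42, c43, smul_eq_mul, Matrix.cons_val] at h0 ⊢
    have h1 : s = t := by simpa [hdet, sub_eq_zero] using h0
    have : t ≠ 0 := by simpa [h1] using hst
    simp [hdet, this]
  · simp only [hq, map_smul, c42, c43, smul_eq_mul, Matrix.cons_val] at h0 ⊢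
    have h1 : s + t = 0 := by simpa [hdet] using h0
    have : t ≠ 0 := by
      rintro rfl
      simp_all
    simp [hdet, this]
  all_goals obtain ⟨h1, h2⟩ := hbase hst h0
  · have : ε ^ 3 * ((s + t) * (s - t)) ≠ 0 := by simp [hdet, h1, h2]
    simp only [v1, (hproj _).2, hN', hq, map_smul, c13, smul_eq_mul, Matrix.cons_val]
    convert this using 1
    ring
  · have : ε ^ 2 * ((s + t) * (s - t)) ≠ 0 := by simp [hdet, h1, h2]
    simp only [v2, hN, hq, map_smul, c21, smul_eq_mul, Matrix.cons_val]
    convert this using 1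
    ring
  · have : -ε ^ 3 * ((s + t) * (s - t)) ≠ 0 := by simp [hdet, h1, h2]
    simp only [v4, (hproj _).1, hN', hp, map_smul, c33, smul_eq_mul, Matrix.cons_val]
    convert this using 1
    ring
  · have : ε ^ 4 * ((s + t) * (s - t)) ≠ 0 := by simp [hdet, h1, h2]
    simp only [v32, hpoint, hspan, Matrix.cons_val]
    convert this using 1
    ring
  · have : ε ^ 2 * ((s - t) * (s - t)) ≠ 0 := by simp [hdet, h2]
    simp only [coordMinor, hp, hq, map_smul, c41, c42, smul_eq_mul, Matrix.cons_val]
    convert this using 1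
    ring
  · have : -ε ^ 4 * ((s + t) * (s - t)) ≠ 0 := by simp [hdet, h1, h2]
    simp only [v50, v51, hspan, Matrix.cons_val]
    convert this using 1
    ring
  · have : ε ^ 2 * ((s - t) * (s - t)) ≠ 0 := by simp [hdet, h2]
    simp only [coordMinor, hp, hq, map_smul, c52, c53, smul_eq_mul, Matrix.cons_val]
    convert this using 1
    ring

/-- A coordinate flag and the flag of the reversed basis are transverse. -/
theorem exists_transverse_frames {W : Type*} [AddCommGroup W] [Module ℂ W] [FiniteDimensional ℂ W]
    (hW : finrank ℂ W = b) : ∃ g : Frames (4 + m) W,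
      (CompleteFlag.ofBasis (g (Fin.castAdd m 0))).space 2 ⊓
        (CompleteFlag.ofBasis (g (Fin.castAdd m 1))).space (b - 2) = ⊥ := by
  refine ⟨Fin.append ![finBasis ℂ W, (finBasis ℂ W).reindex Fin.revPerm, finBasis ℂ W,
    finBasis ℂ W] fun _ => finBasis ℂ W, ?_⟩
  simp only [Fin.append_left, Matrix.cons_val, Submodule.eq_bot_iff]
  rintro x ⟨h1, h2⟩
  rw [SetLike.mem_coe, mem_ofBasis_space] at h1 h2
  apply (finBasis ℂ W).ext_elem
  intro i
  rcases lt_or_ge (i : ℕ) 2 with hi | hi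
  · have h := h2 (Fin.rev i) (by rw [Fin.val_rev]; omega)
    rw [frameCoord, dif_pos (Fin.rev i).2, Fin.eta] at h
    simpa using h
  · have h := h1 i hi
    rw [frameCoord, dif_pos i.2] at h
    simpa using h

theorem exists_isGood_interleaveFrames (hb : 2 ≤ b) (hV : finrank ℂ V = 4)
    (hE : finrank ℂ E = b + 4) : ∃ n e g, IsGood b (interleaveFrames hσ hr n e g) := by
  obtain ⟨e, n, he⟩ := exists_isModelFrames hV ((finBasis ℂ V).reindex (finCongr hV))
  have hW : finrank ℂ (E ⧸ V) = b := by
    have := Submodule.finrank_quotient_add_finrank V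
    omega
  obtain ⟨g, hg⟩ := exists_transverse_frames (m := m) hW
  exact ⟨n, e, g, he.isGood hσ hr hb hV hE hg⟩

end ModelIsGood

/-! ### Shapes and sizes of the partitions -/

section Partitions

theorem sum_rect {r n c : ℕ} (hr : r ≤ n) : ∑ j ∈ Finset.range n, rect r c j = r * c := by
  rw [← Finset.sum_subset (Finset.range_mono hr) fun j _ hj => by
    rw [Finset.mem_range] at hj
    simp [rect, hj], Finset.sum_congr rfl fun j hj => by
    rw [rect, if_pos (Finset.mem_range.1 hj)]]
  simp

theorem sum_prependRows (r n c : ℕ) (p : ℕ → ℕ) :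
    ∑ j ∈ Finset.range (r + n), prependRows r c p j = r * c + ∑ j ∈ Finset.range n, p j := by
  rw [Finset.sum_range_add]
  congr 1
  · rw [Finset.sum_congr rfl fun j hj => by rw [prependRows, if_pos (Finset.mem_range.1 hj)]]
    simp
  · simp [prependRows]

theorem antitone_prependRows {r c : ℕ} {p : ℕ → ℕ} (hp : Antitone p) (hc : p 0 ≤ c) :
    Antitone (prependRows r c p) := fun i j hij => by
  have h0 : p (j - r) ≤ p 0 := hp (Nat.zero_le _)
  have h1 : p (j - r) ≤ p (i - r) := hp (by omega)
  unfold prependRows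
  split_ifs <;> omega

theorem antitone_rect_add {r c : ℕ} {p : ℕ → ℕ} (hp : Antitone p) : Antitone (rect r c + p) :=
  fun i j hij => by
    have h1 : p j ≤ p i := hp hij
    simp only [Pi.add_apply, rect]
    split_ifs <;> omega

theorem Antitone.eq_zero_of_le {p : ℕ → ℕ} (hp : Antitone p) {i j : ℕ} (h : p i = 0)
    (hij : i ≤ j) : p j = 0 :=
  Nat.le_zero.1 (h ▸ hp hij)

theorem sum_range_eq_of_antitone {p : ℕ → ℕ} (hp : Antitone p) {i j : ℕ} (h : p i = 0)
    (hij : i ≤ j) : ∑ k ∈ Finset.range j, p k = ∑ k ∈ Finset.range i, p k :=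
  (Finset.sum_subset (Finset.range_mono hij) fun k _ hk =>
    hp.eq_zero_of_le h (by simpa using hk)).symm

variable {a b m : ℕ} {κ ρ ν₃ ν₄ : ℕ → ℕ} {τ : Fin m → ℕ → ℕ}

theorem fiberBounds_of_isSchubertProblem (ha : 0 < a) (hab : a < b) (hκ : IsPartition κ)
    (hκ₁ : κ 0 ≤ b - a - 1) (hρ : IsPartition ρ) (hρₐ : ρ (a - 1) = 0)
    (hν : IsSchubertProblem a b (fiberProblem a b κ ρ ν₃ ν₄ τ)) :
    FiberBounds a b κ ρ ν₃ ν₄ τ := by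
  obtain ⟨-, h, -⟩ := hν
  rw [forall_fin_four_add] at h
  simp only [fiberProblem, Fin.append_left, Fin.append_right, Matrix.cons_val] at h
  obtain ⟨h₁, h₂, h₃, h₄, hτ⟩ := h
  refine ⟨ha, hab, hκ.1, hκ₁, ?_, hρ.1, fun h1 => ?_, hρₐ, h₃, h₄, hτ⟩
  · have := h₁.2.2
    rwa [prependRows, if_neg (by omega)] at this
  · have := h₂.2.1
    rw [Pi.add_apply, rect, if_pos (by omega)] at this
    omega

/-- The first four partitions grow by `b - a + 1`, `a + 1`, `b - a + 1`, `a + 1`. The total `2b + 4`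
is the difference of the dimensions of the two Grassmannians. -/
theorem FiberBounds.isSchubertProblem (hB : FiberBounds a b κ ρ ν₃ ν₄ τ)
    (hν : IsSchubertProblem a b (fiberProblem a b κ ρ ν₃ ν₄ τ)) :
    IsSchubertProblem (2 + a) (4 + b) (totalProblem a b κ ρ ν₃ ν₄ τ) := by
  have ha := hB.pos
  have hab := hB.lt
  have hκ₁ := hB.κ_zero
  have hρ₀ : ρ 0 ≤ b - a := by
    rcases Nat.lt_or_ge 1 a with h | h
    · have := hB.ρ_zero h
      omega
    -- For `a = 1` the fiber problem gives no bound on `ρ 0`, but then `ρ` is zero.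
    · have := hB.ρ_last
      obtain rfl : a = 1 := by omega
      exact this.le.trans (Nat.zero_le _)
  have h3 := hB.part₃.2.1
  have h4 := hB.part₄.2.1
  refine ⟨by omega, ?_, ?_⟩
  · rw [forall_fin_four_add]
    simp only [totalProblem, Fin.append_left, Fin.append_right, Matrix.cons_val]
    refine ⟨⟨antitone_prependRows hB.antitone_κ (by omega), ?_, ?_⟩,
      ⟨antitone_rect_add hB.antitone_ρ, ?_, ?_⟩,
      ⟨antitone_prependRows hB.part₃.1 (by omega), ?_, ?_⟩,
      ⟨antitone_rect_add hB.part₄.1, ?_, ?_⟩,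
      fun j => ⟨(hB.part j).1, ?_, (hB.part j).1.eq_zero_of_le (hB.part j).2.2 (by omega)⟩⟩
    · rw [prependRows, if_pos (by omega)]
      omega
    · rw [prependRows, if_neg (by omega)]
      exact hB.antitone_κ.eq_zero_of_le hB.κ_last (by omega)
    · rw [Pi.add_apply, rect, if_pos ha]
      omega
    · rw [Pi.add_apply, rect, if_neg (by omega), zero_add]
      exact hB.antitone_ρ.eq_zero_of_le hB.ρ_last (by omega)
    · rw [prependRows, if_pos (by omega)]
      omega
    · rw [prependRows, if_neg (by omega)]
      exact hB.part₃.1.eq_zero_of_le hB.part₃.2.2 (by omega)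
    · rw [Pi.add_apply, rect, if_pos (by omega)]
      omega
    · rw [Pi.add_apply, rect, if_neg (by omega), zero_add]
      exact hB.part₄.1.eq_zero_of_le hB.part₄.2.2 (by omega)
    · have := (hB.part j).2.1
      omega
  · have h := hν.2.2
    rw [Fin.sum_univ_add, Fin.sum_univ_four] at h ⊢
    simp only [fiberProblem, totalProblem, Fin.append_left, Fin.append_right, Matrix.cons_val,
      Pi.add_apply, Finset.sum_add_distrib] at h ⊢
    have e1 := sum_prependRows 1 (a - 1) (b - a - 1) κ
    rw [Nat.add_sub_cancel' ha] at e1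
    have e2 := sum_prependRows 1 (1 + a) (b - a + 1) ν₃
    rw [← add_assoc] at e2
    rw [e1, sum_rect (by omega)] at h
    rw [sum_prependRows, sum_rect (by omega), e2, sum_rect (by omega),
      sum_range_eq_of_antitone hB.antitone_κ hB.κ_last (by omega : a - 1 ≤ a),
      sum_range_eq_of_antitone hB.antitone_ρ (hB.antitone_ρ.eq_zero_of_le hB.ρ_last
        (by omega : a - 1 ≤ a)) (by omega : a ≤ 2 + a),
      sum_range_eq_of_antitone hB.part₃.1 hB.part₃.2.2 (by omega : a ≤ 1 + a),
      sum_range_eq_of_antitone hB.part₄.1 hB.part₄.2.2 (by omega : a ≤ 2 + a),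
      Finset.sum_congr rfl fun j _ =>
        sum_range_eq_of_antitone (hB.part j).1 (hB.part j).2.2 (by omega : a ≤ 2 + a)]
    obtain ⟨c, rfl⟩ := Nat.exists_eq_add_of_lt hab
    have hc : 4 + (a + c + 1) - (2 + a) = c + 3 := by omega
    have hc' : a + c + 1 - a = c + 1 := by omega
    rw [hc'] at h
    rw [hc, hc']
    have : (2 + a) * (c + 3) = a * (c + 1) + 2 * c + 2 * a + 6 := by ring
    rw [this, h]
    omega

end Partitions

/-! ### Assembly of the fibration -/

section Fibration

variable {a b m : ℕ} {κ ρ ν₃ ν₄ : ℕ → ℕ} {τ : Fin m → ℕ → ℕ}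

/-- The instances whose flags are defined by good tuples of bases. -/
def goodInstances (b m : ℕ) (E : Type*) [AddCommGroup E] [Module ℂ E] [FiniteDimensional ℂ E] :
    Set (Fin (4 + m) → CompleteFlag E) :=
  {F | ∃ e ∈ {e : Frames (4 + m) E | IsGood b e}, (fun i => CompleteFlag.ofBasis (e i)) = F}

/-- `B` is the slice of the good pairs at a fixed `g₀`, and `C` is the slice at the given `e`.
Membership of `e` in the first slice says that `(e, g₀)` is good, so the second one is not empty. -/
theorem exists_open_induced {E : Type*} [AddCommGroup E] [Module ℂ E] [FiniteDimensional ℂ E]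
    (hb : 2 ≤ b) (hE : finrank ℂ E = b + 4) (V : Submodule ℂ E) (hV : finrank ℂ V = 4) :
    ∃ B : Set (Fin 4 → CompleteFlag V), IsZariskiOpen B ∧ B.Nonempty ∧ ∀ F' ∈ B,
      ∃ C : Set (Fin (4 + m) → CompleteFlag (E ⧸ V)), IsZariskiOpen C ∧ C.Nonempty ∧
        ∀ G ∈ C, ∃ F ∈ goodInstances b m E, inducedOn b F (baseSpace b F) = ⟨V, F', fun _ => G⟩ := by
  obtain ⟨σ, hσ⟩ := V.mkQ.exists_rightInverse_of_surjective V.range_mkQ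
  have hW : finrank ℂ (E ⧸ V) = b := by
    have := Submodule.finrank_quotient_add_finrank V
    omega
  have hr (i : Fin (4 + m)) : IsShuffle (finrank ℂ (E ⧸ V)) (shuffleSeq b i) :=
    hW ▸ isShuffle_shuffleSeq hb i
  obtain ⟨n, e₀, g₀, h₀⟩ := exists_isGood_interleaveFrames hσ hr hb hV hE
  refine ⟨_, ((frameOpen_isGood b).preimage
    (isRegularVec_interleaveFrames_left hσ hr n g₀)).isZariskiOpen, ⟨_, e₀, h₀, rfl⟩, ?_⟩
  rintro _ ⟨e, he, rfl⟩
  refine ⟨_, ((frameOpen_isGood b).preimage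
    (isRegularVec_interleaveFrames_right hσ hr n e)).isZariskiOpen, ⟨_, g₀, he, rfl⟩, ?_⟩
  rintro _ ⟨g, hg, rfl⟩
  exact ⟨_, ⟨_, hg, rfl⟩, inducedOn_interleaveFrames hσ hr n e g hb hV hE hg⟩

theorem FiberBounds.isFiberedOver (hB : FiberBounds a b κ ρ ν₃ ν₄ τ) :
    IsFiberedOver 2 4 a b (totalProblem a b κ ρ ν₃ ν₄ τ) (fun _ : Fin 4 => rect 1 1)
      (fiberProblem a b κ ρ ν₃ ν₄ τ) := by
  have hb : 2 ≤ b := by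
    have := hB.pos
    have := hB.lt
    omega
  have hE : finrank ℂ (Fin (4 + b) → ℂ) = b + 4 := by simp [add_comm]
  have hpart (V : Submodule ℂ (Fin (4 + b) → ℂ)) := exists_open_induced (m := m) hb hE V
  refine ⟨goodInstances b m _, fun F => inducedOn b F (baseSpace b F),
    (frameOpen_isGood b).isZariskiOpen, ?_, ?_, fun V hV => ?_⟩
  · obtain ⟨V, hV⟩ : ∃ V : Submodule ℂ (Fin (4 + b) → ℂ), finrank ℂ V = 4 :=
      ⟨(CompleteFlag.ofBasis (finBasis ℂ _)).space 4, by
        rw [CompleteFlag.finrank_space, hE]; omega⟩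
    obtain ⟨B, -, ⟨F', hF'⟩, h⟩ := hpart V hV
    obtain ⟨C, -, ⟨G, hG⟩, h⟩ := h F' hF'
    obtain ⟨F, hF, -⟩ := h G hG
    exact ⟨F, hF⟩
  · rintro _ ⟨e, he, rfl⟩
    have hF := IsGood.isGeneric he hb hE
    refine ⟨hF.finrank_baseSpace, fun H hH => hF.comap_mem_solutions_base hB hH,
      fun h _ H hH hHh => ?_, hF.bijOn_solutions hB⟩
    subst hHh
    exact hF.map_mem_solutions_fiber hB hH
  · obtain ⟨B, hBo, hBn, h⟩ := hpart V hV
    refine ⟨B, hBo, hBn, fun F' hF' => ?_⟩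
    obtain ⟨C, hCo, hCn, h⟩ := h F' hF'
    -- One set `C` serves all solutions `k`, because the induced fiber instance is constant in `k`.
    refine ⟨?_, fun k _ => ⟨C, hCo, hCn, fun G hG => ?_⟩⟩
    · obtain ⟨G, hG⟩ := hCn
      obtain ⟨F, hF, hind⟩ := h G hG
      exact ⟨F, hF, _, hind⟩
    · obtain ⟨F, hF, hind⟩ := h G hG
      exact ⟨F, hF, _, hind, rfl⟩

end Fibration

end

theorem theorem3p7 (a b m : ℕ) (ha : 0 < a) (hab : a < b)
    (κ ρ ν₃ ν₄ : ℕ → ℕ) (τ : Fin m → ℕ → ℕ)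
    (hκ : IsPartition κ) (hκ₁ : κ 0 ≤ b - a - 1)
    (hρ : IsPartition ρ) (hρₐ : ρ (a - 1) = 0)
    (hν : IsSchubertProblem a b
      (Fin.append ![prependRows 1 (b - a - 1) κ, rect (a - 1) 1 + ρ, ν₃, ν₄] τ)) :
    IsSchubertProblem (2 + a) (4 + b)
      (Fin.append ![prependRows 2 (b - a) κ, rect a 2 + ρ,
        prependRows 1 (b - a + 1) ν₃, rect (a + 1) 1 + ν₄] τ) ∧
    IsFiberedOver 2 4 a b
      (Fin.append ![prependRows 2 (b - a) κ, rect a 2 + ρ,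
        prependRows 1 (b - a + 1) ν₃, rect (a + 1) 1 + ν₄] τ)
      (fun _ : Fin 4 => rect 1 1)
      (Fin.append ![prependRows 1 (b - a - 1) κ, rect (a - 1) 1 + ρ, ν₃, ν₄] τ) := by
  have hB := fiberBounds_of_isSchubertProblem ha hab hκ hκ₁ hρ hρₐ hν
  exact ⟨hB.isSchubertProblem hν, hB.isFiberedOver⟩
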